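/- **Setting.** Let $a_1,\dots,a_d$ be a basis of $\mathbb{R}^d$, $\mathscr{L}=\bigoplus_j\mathbb{Z}a_j$, and $\mathscr{L}^*=\bigoplus_j\mathbb{Z}b_j$ with $b_i\cdot a_j=2\pi\delta_{ij}$. Let $\Gamma$ (resp. $\Gamma^*$) be a measurable set whose $\mathscr{L}$- (resp. $\mathscr{L}^*$-) translates partition $\mathbb{R}^d$ and whose interior is that of the Wigner–Seitz cell $\{x:|x|\le|x-\ell|\ \forall \ell\}$ of the lattice; $P_\Gamma z$ is the element of $\Gamma$ with $z-P_\Gamma z\in\mathscr{L}$, and $\gamma_-=\inf_{\partial\Gamma}|z|$. Let $\hbar,\lambda>0$. For $u\in L^2(\mathbb{R}^d)$, its Bloch transform is $u_k(x)=\sum_{\ell\in\mathscr{L}}u(x+\ell)e^{-ik\cdot(x+\ell)}$ (convergence in $L^2(\Gamma^*;L^2_{\rm per}(\Gamma))$). Let $\mathcal{S}^+_{\mathscr{L}}$ be the set of nonnegative, possibly unbounded, self-adjoint operators on $L^2(\mathbb{R}^d;\mathbb{C})$ commuting with the translations by $\mathscr{L}$. For $A\in\mathcal{S}^+_{\mathscr{L}}$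 with Bloch decomposition $(A_k)_{k\in\Gamma^*}$, i.e. self-adjoint operators $A_k$ on $L^2_{\rm per}(\Gamma)$ with $(A\varphi)_k=A_k\varphi_k$ for $\varphi\in D(A)$, put $\underline{\mathrm{Tr}}(A)=\frac{1}{|\Gamma^*|}\int_{\Gamma^*}\mathrm{Tr}(A_k)\,dk\in[0,\infty]$. Let $\mathcal{P}_{\mathscr{L}}$ be the set of nonnegative $f\in L^1_{\rm loc}(\mathbb{R}^d\times\mathbb{R}^d)$, $\mathscr{L}$-periodic in the first variable, with $\iint_{\Gamma\times\mathbb{R}^d}f=1$. **Töplitz operator.** Let $|q,p\rangle(y)=(\pi\hbar)^{-d/4}e^{-|y-q|^2/(2\hbar)}e^{ip\cdot y/\hbar}$ and $|\underline{q,p}\rangle(y)=\sum_{\ell\in\mathscr{L}}|q,p\rangle(y+\ell)$. For $f\in\mathcal{P}_{\mathscr{L}}$, $$T_{\mathscr{L}}[f]\varphi(y)=\iint_{\Gamma\times\mathbb{R}^d}\Big(\frac{1}{|\Gamma^*|}\int_{\Gamma^*}e^{ik\cdot y}\langle\underline{q,p-\hbar k}|\varphi_k\rangle_{L^2_{\rm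 per}(\Gamma)}\,|\underline{q,p-\hbar k}\rangle(y)\,dk\Big)f(q,p)\,dq\,dp .$$ **Pseudo-distance.** A coupling of $f\in\mathcal{P}_{\mathscr{L}}$ and $R\in\mathcal{S}^+_{\mathscr{L}}$ is a measurable map $Q:\mathbb{R}^d\times\mathbb{R}^d\to\mathcal{S}^+_{\mathscr{L}}$, $\mathscr{L}$-periodic in its first variable, with $\underline{\mathrm{Tr}}(Q(x,\xi))=f(x,\xi)$ for all $(x,\xi)\in\Gamma\times\mathbb{R}^d$ and $\iint_{\Gamma\times\mathbb{R}^d}Q(x,\xi)\,dx\,d\xi=R$ (in the sense of quadratic forms); $\mathcal{C}(f,R)$ is the set of couplings. Let $\Theta(r)=\int_0^r(1-s/\gamma_-)_+\,ds$, let $c_\lambda(x,\xi)=\lambda^2\Theta(|P_\Gamma(x-y)|^2)+(\xi+i\hbar\nabla_y)^2$ as an operator on $L^2(\mathbb{R}^d)$ with domain $H^2(\mathbb{R}^d)$, and $$E_{\hbar,\lambda}(f,R)=\inf_{Q\in\mathcal{C}(f,R)}\Big(\iint_{\Gamma\times\mathbb{R}^d}\underline{\mathrm{Tr}}\big(Q(x,\xi)^{1/2}c_\lambda(x,\xi)Q(x,\xi)^{1/2}\big)\,dx\,d\xi\Big)^{1/2}\in[0,\infty],$$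 where only those $Q$ compete for which the operator product $Q^{1/2}c_\lambda Q^{1/2}$ (on its natural domain) belongs to $\mathcal{S}^+_{\mathscr{L}}$ for almost every $(x,\xi)\in\Gamma\times\mathbb{R}^d$ with measurable periodic trace. **Proposition.** For every $f\in\mathcal{P}_{\mathscr{L}}$ with finite second moments, $\iint_{\Gamma\times\mathbb{R}^d}(|x|^2+|\xi|^2)f(x,\xi)\,dx\,d\xi<\infty$, one has $$E_{\hbar,\lambda}(f,T_{\mathscr{L}}[f])\le\sqrt{\frac{1+\lambda^2}{2}\,d\,\hbar}.$$ -/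

import Mathlib

open MeasureTheory Filter Topology ComplexConjugate
open scoped ENNReal ContDiff InnerProductSpace

noncomputable section

namespace Bloch

/-- The space `ℝ^d` with its Euclidean structure. -/
abbrev Pos (d : ℕ) : Type := EuclideanSpace ℝ (Fin d)

/-- The Hilbert space `L²(ℝ^d; ℂ)`. -/
abbrev L2 (d : ℕ) : Type := Lp ℂ 2 (volume : Measure (Pos d))

/-- The Hilbert space `L²_per(Γ)`: a periodic function is identified with its restriction to the
unit cell `Γ`, and the inner product is that of `L²(Γ)`. -/
abbrev L2per {d : ℕ} (Γ : Set (Pos d)) : Type := Lp ℂ 2 ((volume : Measure (Pos d)).restrict Γ)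

/-! ### Unbounded operators

An operator is a `LinearPMap`, i.e. a linear map defined on a linear subspace (its domain). -/

section Operators

variable {H : Type*} [NormedAddCommGroup H] [InnerProductSpace ℂ H]

/-- The operator whose graph is `{(φ, g) | r φ g}`. This is meant for relations `r` whose graph is
already a linear subspace which is the graph of an operator; taking the span changes nothing then. -/
def opOfRel (r : H → H → Prop) : H →ₗ.[ℂ] H :=
  (Submodule.span ℂ {p : H × H | r p.1 p.2}).toLinearPMap

/-- The product `A B`, on its natural domain `{φ ∈ D(B) | B φ ∈ D(A)}`. -/
def opMul (A B : H →ₗ.[ℂ] H) : H →ₗ.[ℂ] H :=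
  opOfRel fun φ g => ∃ ψ, (φ, ψ) ∈ B.graph ∧ (ψ, g) ∈ A.graph

/-- Nonnegativity of an operator: `⟨φ, A φ⟩ ≥ 0` on the domain. -/
def OpNonneg (A : H →ₗ.[ℂ] H) : Prop :=
  ∀ φ : A.domain, 0 ≤ (⟪(φ : H), A φ⟫_ℂ).re

/-- `S = A^{1/2}`: the (unique) nonnegative self-adjoint operator with `S S = A`. -/
def IsOpSqrt [CompleteSpace H] (A S : H →ₗ.[ℂ] H) : Prop :=
  IsSelfAdjoint S ∧ OpNonneg S ∧ opMul S S = A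

/-- The trace, in `[0, ∞]`, of a nonnegative self-adjoint operator `A`: the supremum of
`∑ ⟨v, A v⟩` over the finite orthonormal families of vectors `v` of the domain. It is
`∑ ⟨e_j, A e_j⟩` for any orthonormal basis if `A` is bounded, and `∞` if `A` is unbounded. -/
def opTrace (A : H →ₗ.[ℂ] H) : ℝ≥0∞ :=
  ⨆ (s : Finset A.domain) (_ : Orthonormal ℂ (fun v : s => ((v : A.domain) : H))),
    ∑ v ∈ s, ENNReal.ofReal (⟪(v : H), A v⟫_ℂ).re

/-- The closed quadratic form, with values in `[0, ∞]`, of a nonnegative self-adjoint operator `A`,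
at an arbitrary vector `ψ`: it is `‖A^{1/2} ψ‖²` if `ψ ∈ D(A^{1/2})` and `∞` otherwise, and thus
`⟨ψ, A ψ⟩` for `ψ ∈ D(A)`. It is obtained here as the supremum over `φ ∈ D(A)` of
`2 Re ⟨A φ, ψ⟩ - ⟨A φ, φ⟩`, that is of `‖A^{1/2} ψ‖² - ‖A^{1/2} (φ - ψ)‖²`. -/
def opForm (A : H →ₗ.[ℂ] H) (ψ : H) : ℝ≥0∞ :=
  ⨆ φ : A.domain, ENNReal.ofReal (2 * (⟪A φ, ψ⟫_ℂ).re - (⟪A φ, (φ : H)⟫_ℂ).re)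

end Operators

/-! ### The crystal -/

/-- `Γ` is a unit cell of the lattice `L`: its translates by the lattice partition the space, and
its interior is the interior of the Wigner-Seitz cell. -/
structure IsUnitCell {d : ℕ} (L : Submodule ℤ (Pos d)) (Γ : Set (Pos d)) : Prop where
  measurableSet : MeasurableSet Γ
  partition : ∀ z : Pos d, ∃! ℓ : Pos d, ℓ ∈ L ∧ z - ℓ ∈ Γ
  interior_eq : interior Γ = interior {x : Pos d | ∀ ℓ ∈ L, ‖x‖ ≤ ‖x - ℓ‖}

/-- A crystal of `ℝ^d`: a basis of the Bravais lattice, the dual basis of the reciprocal lattice,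
and a unit cell for each. -/
structure Crystal (d : ℕ) where
  a : Fin d → Pos d
  linearIndependent : LinearIndependent ℝ a
  b : Fin d → Pos d
  dual : ∀ i j, ⟪b i, a j⟫_ℝ = if i = j then 2 * Real.pi else 0
  Γ : Set (Pos d)
  Γs : Set (Pos d)
  isUnitCell : IsUnitCell (Submodule.span ℤ (Set.range a)) Γ
  isUnitCell_dual : IsUnitCell (Submodule.span ℤ (Set.range b)) Γs

namespace Crystal

variable {d : ℕ} (C : Crystal d)

/-- The Bravais lattice. -/
def L : Submodule ℤ (Pos d) := Submodule.span ℤ (Set.range C.a)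

/-- The phase space region `Γ × ℝ^d`. -/
def phaseCell : Set (Pos d × Pos d) := C.Γ ×ˢ Set.univ

/-- `P_Γ z`, the unique element of `Γ` with `z - P_Γ z` in the lattice. -/
def proj (z : Pos d) : Pos d := Classical.epsilon fun w => w ∈ C.Γ ∧ z - w ∈ C.L

/-- `γ_- = inf_{z ∈ ∂Γ} |z|`. -/
def gammaMinus : ℝ := sInf ((fun z => ‖z‖) '' frontier C.Γ)

/-- `Θ(r) = ∫_0^r (1 - s / γ_-)_+ ds`. -/
def Theta (r : ℝ) : ℝ := ∫ s in (0 : ℝ)..r, max (1 - s / C.gammaMinus) 0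

/-- The translation `τ_ℓ ψ (y) = ψ (y - ℓ)`. -/
def translate (ℓ : Pos d) (ψ : L2 d) : L2 d :=
  Lp.compMeasurePreserving (fun y => y - ℓ) (measurePreserving_sub_right volume ℓ) ψ

/-- `𝒮⁺`: the nonnegative self-adjoint operators on `L²(ℝ^d)` that commute with the lattice
translations. -/
def SPlus : Set (L2 d →ₗ.[ℂ] L2 d) :=
  {A | IsSelfAdjoint A ∧ OpNonneg A ∧
    ∀ ℓ ∈ C.L, ∀ φ g : L2 d, (φ, g) ∈ A.graph → (translate ℓ φ, translate ℓ g) ∈ A.graph}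

/-- `k ↦ v k` is the Bloch transform `k ↦ u_k` of `u ∈ L²(ℝ^d)`: it is the limit in
`L²(Γ*; L²_per(Γ))` of the partial sums of `∑_ℓ u(x + ℓ) e^{-i k·(x + ℓ)}`. -/
def IsBlochTransform (u : L2 d) (v : Pos d → L2per C.Γ) : Prop :=
  AEStronglyMeasurable v (volume.restrict C.Γs) ∧
  Tendsto (fun F : Finset C.L =>
      ∫⁻ k in C.Γs, ∫⁻ x in C.Γ,
        ‖v k x - ∑ ℓ ∈ F, u (x + (ℓ : Pos d)) *
          Complex.exp (-Complex.I * (⟪k, x + (ℓ : Pos d)⟫_ℝ : ℝ))‖ₑ ^ 2)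
    atTop (𝓝 0)

/-- `k ↦ A_k` is the Bloch decomposition of `A`: a family of self-adjoint operators on `L²_per(Γ)`
such that `(A φ)_k = A_k φ_k` for every `φ ∈ D(A)`. -/
def IsBlochFamily (A : L2 d →ₗ.[ℂ] L2 d) (Ak : Pos d → (L2per C.Γ →ₗ.[ℂ] L2per C.Γ)) : Prop :=
  (∀ k ∈ C.Γs, IsSelfAdjoint (Ak k)) ∧
  ∀ φ : A.domain, ∃ u v : Pos d → L2per C.Γ,
    C.IsBlochTransform φ u ∧ C.IsBlochTransform (A φ) v ∧
    ∀ᵐ k ∂(volume.restrict C.Γs), (u k, v k) ∈ (Ak k).graph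

/-- The operator `A` belongs to `𝒮⁺` and its periodic trace, the average over `k ∈ Γ*` of the
trace of `A_k`, is `t ∈ [0, ∞]`. (The Bloch decomposition is unique up to null sets.) -/
def HasPeriodicTrace (A : L2 d →ₗ.[ℂ] L2 d) (t : ℝ≥0∞) : Prop :=
  A ∈ C.SPlus ∧ ∃ Ak : Pos d → (L2per C.Γ →ₗ.[ℂ] L2per C.Γ),
    C.IsBlochFamily A Ak ∧ t = ⨍⁻ k in C.Γs, opTrace (Ak k) ∂volume

/-- The class `𝒫` of probability densities on `Γ × ℝ^d`, periodic in the first variable. -/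
structure IsPeriodicDensity (f : Pos d × Pos d → ℝ) : Prop where
  locallyIntegrable : LocallyIntegrable f volume
  nonneg : ∀ z, 0 ≤ f z
  periodic : ∀ ℓ ∈ C.L, ∀ x ξ, f (x + ℓ, ξ) = f (x, ξ)
  integral_eq_one : ∫ z in C.phaseCell, f z = 1

/-- `f` has finite second moments on `Γ × ℝ^d`. -/
def FiniteSecondMoments (f : Pos d × Pos d → ℝ) : Prop :=
  IntegrableOn (fun z : Pos d × Pos d => (‖z.1‖ ^ 2 + ‖z.2‖ ^ 2) * f z) C.phaseCell volume

/-! ### Coherent states and the Töplitz operator -/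

/-- The Schrödinger coherent state `|q, p⟩`. -/
def coherent (ħ : ℝ) (q p y : Pos d) : ℂ :=
  (((Real.pi * ħ) ^ (-(d : ℝ) / 4) * Real.exp (-‖y - q‖ ^ 2 / (2 * ħ)) : ℝ) : ℂ) *
    Complex.exp (Complex.I * ((⟪p, y⟫_ℝ / ħ : ℝ) : ℂ))

/-- The periodic Schrödinger coherent state. -/
def perCoherent (ħ : ℝ) (q p y : Pos d) : ℂ :=
  ∑' ℓ : C.L, coherent ħ q p (y + (ℓ : Pos d))

/-- The periodic Töplitz operator `T[f]`: with `|q, p⟩_per` the periodic coherent states,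
`T[f] φ (y) = ∬_{Γ × ℝ^d} (⨍_{Γ*} e^{i k·y} ⟨(q, p - ħ k)_per, φ_k⟩ |q, p - ħ k⟩_per (y) dk)
f(q, p) dq dp`. -/
def toeplitz (ħ : ℝ) (f : Pos d × Pos d → ℝ) : L2 d →ₗ.[ℂ] L2 d :=
  opOfRel fun φ g => ∃ u : Pos d → L2per C.Γ, C.IsBlochTransform φ u ∧
    ∀ᵐ y : Pos d, g y =
      ∫ z in C.phaseCell,
        (⨍ k in C.Γs, Complex.exp (Complex.I * (⟪k, y⟫_ℝ : ℝ)) *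
          (∫ x in C.Γ, conj (C.perCoherent ħ z.1 (z.2 - ħ • k) x) * u k x) *
          C.perCoherent ħ z.1 (z.2 - ħ • k) y ∂volume) * (f z : ℂ)

/-! ### Transportation cost, couplings and the pseudo-distance -/

/-- The `j`-th component of `(ξ + i ħ ∇) Φ`, for a smooth function `Φ`. -/
def momentum (ħ : ℝ) (ξ : Pos d) (j : Fin d) (Φ : Pos d → ℂ) (y : Pos d) : ℂ :=
  (ξ j : ℂ) * Φ y + Complex.I * (ħ : ℂ) * fderiv ℝ Φ y (EuclideanSpace.single j 1)

/-- The expression `λ² Θ(|P_Γ(x - y)|²) Φ(y) + (ξ + i ħ ∇)² Φ(y)`, for a smooth function `Φ`. -/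
def costExpr (ħ lam : ℝ) (z : Pos d × Pos d) (Φ : Pos d → ℂ) (y : Pos d) : ℂ :=
  ((lam ^ 2 * C.Theta (‖C.proj (z.1 - y)‖ ^ 2) : ℝ) : ℂ) * Φ y +
    ∑ j, momentum ħ z.2 j (momentum ħ z.2 j Φ) y

/-- The transportation cost `c_λ(x, ξ)`, an unbounded operator on `L²(ℝ^d)`: `ψ` is in the domain
and `c_λ(x, ξ) ψ = g` if `ψ, g ∈ L²` and the identity
`λ² Θ(|P_Γ(x - y)|²) ψ + (ξ + i ħ ∇_y)² ψ = g` holds in the sense of distributions (the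
differential expression is formally self-adjoint). The domain is the Sobolev space `H²(ℝ^d)`. -/
def cost (ħ lam : ℝ) (z : Pos d × Pos d) : L2 d →ₗ.[ℂ] L2 d :=
  opOfRel fun ψ g => ∀ Φ : Pos d → ℂ, ContDiff ℝ ∞ Φ → HasCompactSupport Φ →
    ∫ y, conj (Φ y) * g y = ∫ y, conj (C.costExpr ħ lam z Φ y) * ψ y

/-- `Q` is a coupling of the density `f` and the operator `R`. Measurability of `Q` is that of the
resolvents `(1 + Q)⁻¹ ψ`, and the integral of the (possibly unbounded) nonnegative operators
`Q(x, ξ)` is taken in the sense of quadratic forms. -/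
structure IsCoupling (f : Pos d × Pos d → ℝ) (R : L2 d →ₗ.[ℂ] L2 d)
    (Q : Pos d × Pos d → (L2 d →ₗ.[ℂ] L2 d)) : Prop where
  right_mem : R ∈ C.SPlus
  mem : ∀ z, Q z ∈ C.SPlus
  measurable : ∀ ψ : L2 d, ∃ g : Pos d × Pos d → L2 d,
    AEStronglyMeasurable g volume ∧ ∀ z, (g z, ψ - g z) ∈ (Q z).graph
  periodic : ∀ ℓ ∈ C.L, ∀ x ξ, Q (x + ℓ, ξ) = Q (x, ξ)
  left_marginal : ∀ z ∈ C.phaseCell, C.HasPeriodicTrace (Q z) (ENNReal.ofReal (f z))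
  right_marginal : ∀ ψ : L2 d, ∫⁻ z in C.phaseCell, opForm (Q z) ψ = opForm R ψ

/-- The total cost `∬_{Γ × ℝ^d} Tr(Q^{1/2} c_λ Q^{1/2}) dx dξ` of `Q`, with the periodic trace of
the product operator, is `t ∈ [0, ∞]`. -/
def HasCost (ħ lam : ℝ) (Q : Pos d × Pos d → (L2 d →ₗ.[ℂ] L2 d)) (t : ℝ≥0∞) : Prop :=
  ∃ w : Pos d × Pos d → ℝ≥0∞, AEMeasurable w (volume.restrict C.phaseCell) ∧
    (∀ᵐ z ∂(volume.restrict C.phaseCell), ∃ S, IsOpSqrt (Q z) S ∧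
      C.HasPeriodicTrace (opMul S (opMul (C.cost ħ lam z) S)) (w z)) ∧
    t = ∫⁻ z in C.phaseCell, w z

/-- The pseudo-distance `E_{ħ,λ}(f, R) ∈ [0, ∞]`. -/
def pseudoDist (ħ lam : ℝ) (f : Pos d × Pos d → ℝ) (R : L2 d →ₗ.[ℂ] L2 d) : ℝ≥0∞ :=
  ⨅ (Q : Pos d × Pos d → (L2 d →ₗ.[ℂ] L2 d)) (_ : C.IsCoupling f R Q)
    (t : ℝ≥0∞) (_ : C.HasCost ħ lam Q t), t ^ (1 / 2 : ℝ)

end Crystal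

end Bloch

end

/-! The competitor is `Q(q,p) = f(q,p) P_{q,p}`, where `P_{q,p} = ∑_m τ_m |q,p⟩⟨q,p| τ_m*`, summed
over the lattice, is the periodized projection on a coherent state. The Bloch transform is unitary
and turns `τ_m` into multiplication by `e^{-ik·m}`, so `P_{q,p}` acts on the fibre over `k` as the
rank one operator `|c_k⟩⟨c_k|`, where `c_k` is the Bloch fibre of `|q,p⟩`. This fibre is the
periodic coherent state of momentum `p - ħk`. Hence the periodic trace of `P_{q,p}` is the zone
average of `‖c_k‖²`, namely `‖|q,p⟩‖² = 1`, and the integral of `Q` over phase space is the Töplitz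
operator: both marginals are right (`isCoupling_cohCoupling`).

The cost operator commutes with the lattice translations, hence acts fibrewise on packets of
translated coherent states (`synth_mem_graph_cost`). With `g_k` the fibre of `c_λ|q,p⟩`, the
operator `Q^{1/2} c_λ Q^{1/2}` has rank one fibres of trace `f ⟨c_k, g_k⟩` (`exists_sqrt_fiberOp`).
Two facts are needed to make sense of this without unbounded fibres. The norm `‖c_k‖` is bounded
below, because the mean of `c_k` over the cell is a Gaussian in `k` (`exists_le_norm_bloch_cohL2`).
The number `⟨c_k, g_k⟩` is nonnegative: `c_λ` is a sum of squares `G_i* G_i`, and comparing Fourier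
coefficients in `k` identifies `⟨c_k, g_k⟩` with the sum of the squared fibre norms of the
`G_i|q,p⟩` (`ae_inner_bloch_costL2`).

Averaging over `k`, the cost at a phase space point is `f` times `⟨q,p|c_λ|q,p⟩`, which does not
depend on the point. Each momentum component contributes `ħ/2`. Since `Θ(r) ≤ r` and, almost
everywhere, `P_Γ` does not increase the norm, the potential contributes at most `λ²` times the
position variance `dħ/2`. As `f` has mass one, the total is at most `(1 + λ²)dħ/2`. -/

noncomputable section

namespace Bloch

/-! ### Bounded operators as unbounded operators with full domain -/

section BoundedOperators

variable {H : Type*} [NormedAddCommGroup H] [InnerProductSpace ℂ H]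

/-- A bounded operator, seen as a `LinearPMap` with full domain. -/
def totalPMap (B : H →L[ℂ] H) : H →ₗ.[ℂ] H := (B : H →ₗ[ℂ] H).toPMap ⊤

@[simp] lemma totalPMap_apply (B : H →L[ℂ] H) (x : (totalPMap B).domain) :
    totalPMap B x = B x := rfl

lemma mem_graph_totalPMap (B : H →L[ℂ] H) {x y : H} :
    (x, y) ∈ (totalPMap B).graph ↔ y = B x := by
  rw [LinearPMap.mem_graph_iff]
  constructor
  · rintro ⟨z, rfl, rfl⟩
    rfl
  · rintro rfl
    exact ⟨⟨x, trivial⟩, rfl, rfl⟩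

/-- An operator defined by a relation which is the graph of a submodule has that graph. -/
lemma graph_opOfRel {r : H → H → Prop} (S : Submodule ℂ (H × H))
    (hS : ∀ x y, r x y ↔ (x, y) ∈ S) (h0 : ∀ y, r 0 y → y = 0) :
    (opOfRel r).graph = S := by
  have hspan : Submodule.span ℂ {p : H × H | r p.1 p.2} = S := by
    have : {p : H × H | r p.1 p.2} = S := by
      ext ⟨x, y⟩
      exact hS x y
    rw [this, Submodule.span_eq]
  rw [opOfRel, hspan]
  refine Submodule.toLinearPMap_graph_eq _ ?_
  rintro ⟨x, y⟩ hxy hx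
  simp only at hx
  subst hx
  exact h0 y ((hS _ _).2 hxy)

lemma opOfRel_eq_totalPMap {r : H → H → Prop} {B : H →L[ℂ] H}
    (h : ∀ x y, r x y ↔ y = B x) : opOfRel r = totalPMap B := by
  refine LinearPMap.eq_of_eq_graph ?_
  refine graph_opOfRel _ (fun x y => ?_) fun y hy => ?_
  · rw [h, mem_graph_totalPMap]
  · simpa using (h 0 y).1 hy

/-- An unbounded `A` composed with an everywhere defined `S` is everywhere defined once `S` maps
into the domain of `A`; values are determined because a graph is single valued. This is how the
unbounded cost operator is absorbed. -/
lemma opMul_eq_totalPMap {A B : H →ₗ.[ℂ] H} {S K : H →L[ℂ] H} (hB : B = totalPMap S)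
    (h : ∀ x, (S x, K x) ∈ A.graph) : opMul A B = totalPMap K := by
  subst hB
  refine opOfRel_eq_totalPMap fun x y => ?_
  simp only [mem_graph_totalPMap, exists_eq_left]
  constructor
  · intro hy
    exact A.mem_graph_snd_inj hy (h x) rfl
  · rintro rfl
    exact h x

lemma opMul_totalPMap (A B : H →L[ℂ] H) :
    opMul (totalPMap A) (totalPMap B) = totalPMap (A.comp B) :=
  opMul_eq_totalPMap rfl fun x => by rw [mem_graph_totalPMap]; rfl

lemma isSelfAdjoint_totalPMap [CompleteSpace H] {B : H →L[ℂ] H} (hB : IsSelfAdjoint B) :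
    IsSelfAdjoint (totalPMap B) := by
  rw [LinearPMap.isSelfAdjoint_def, totalPMap,
    ContinuousLinearMap.toPMap_adjoint_eq_adjoint_toPMap_of_dense B (by simp),
    ContinuousLinearMap.isSelfAdjoint_iff'.1 hB]

lemma opNonneg_totalPMap {B : H →L[ℂ] H} (hB : ∀ x, 0 ≤ (⟪x, B x⟫_ℂ).re) :
    OpNonneg (totalPMap B) := fun x => hB x

/-- Positivity of `B` at `φ - ψ`, expanded, bounds every competitor in the supremum; `φ = ψ` attains
the bound. -/
lemma opForm_totalPMap [CompleteSpace H] {B : H →L[ℂ] H} (hB : IsSelfAdjoint B)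
    (hpos : ∀ x, 0 ≤ (⟪x, B x⟫_ℂ).re) (ψ : H) :
    opForm (totalPMap B) ψ = ENNReal.ofReal (⟪ψ, B ψ⟫_ℂ).re := by
  have hsymm : ∀ x y, ⟪B x, y⟫_ℂ = ⟪x, B y⟫_ℂ := fun x y => by
    conv_lhs => rw [← ContinuousLinearMap.isSelfAdjoint_iff'.1 hB]
    rw [ContinuousLinearMap.adjoint_inner_left]
  refine le_antisymm (iSup_le fun φ => ENNReal.ofReal_le_ofReal ?_) ?_
  · have h := hpos ((φ : H) - ψ)
    simp only [map_sub, inner_sub_left, inner_sub_right, Complex.sub_re] at h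
    have h1 : (⟪(φ : H), B ψ⟫_ℂ).re = (⟪B (φ : H), ψ⟫_ℂ).re := by rw [hsymm]
    have h2 : (⟪ψ, B (φ : H)⟫_ℂ).re = (⟪B (φ : H), ψ⟫_ℂ).re := by
      rw [← inner_conj_symm, Complex.conj_re]
    have h3 : (⟪B (φ : H), (φ : H)⟫_ℂ).re = (⟪(φ : H), B φ⟫_ℂ).re := by rw [hsymm]
    simp only [totalPMap_apply]
    linarith
  · refine le_iSup_of_le (⟨ψ, trivial⟩ : (totalPMap B).domain) (ENNReal.ofReal_le_ofReal ?_)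
    have h3 : (⟪B ψ, ψ⟫_ℂ).re = (⟪ψ, B ψ⟫_ℂ).re := by rw [hsymm]
    simp only [totalPMap_apply]
    linarith

/-- The rank one operator `|v⟩⟨v|`. -/
def rankOneSelf (v : H) : H →L[ℂ] H := (innerSL ℂ v).smulRight v

@[simp] lemma rankOneSelf_apply (v w : H) : rankOneSelf v w = ⟪v, w⟫_ℂ • v := rfl

lemma isSelfAdjoint_rankOneSelf [CompleteSpace H] (v : H) : IsSelfAdjoint (rankOneSelf v) := by
  rw [ContinuousLinearMap.isSelfAdjoint_iff_isSymmetric]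
  intro x y
  simp only [ContinuousLinearMap.coe_coe, rankOneSelf_apply, inner_smul_left, inner_smul_right,
    inner_conj_symm]
  ring

lemma re_inner_rankOneSelf (v w : H) : (⟪w, rankOneSelf v w⟫_ℂ).re = ‖⟪w, v⟫_ℂ‖ ^ 2 := by
  rw [rankOneSelf_apply, inner_smul_right, ← inner_conj_symm v w, Complex.conj_mul']
  norm_cast

/-- The upper bound is Bessel's inequality for `v`; the normalized vector `v/‖v‖` alone attains it.
-/
lemma opTrace_rankOneSelf (v : H) :
    opTrace (totalPMap (rankOneSelf v)) = ENNReal.ofReal (‖v‖ ^ 2) := by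
  refine le_antisymm (iSup₂_le fun s hs => ?_) ?_
  · rw [← ENNReal.ofReal_sum_of_nonneg]
    · refine ENNReal.ofReal_le_ofReal ?_
      have := hs.sum_inner_products_le (x := v) (s := Finset.univ)
      refine le_trans (le_of_eq ?_) this
      rw [← Finset.sum_coe_sort]
      exact Finset.sum_congr rfl fun i _ => re_inner_rankOneSelf _ _
    · intro i _
      rw [totalPMap_apply, re_inner_rankOneSelf]
      positivity
  · by_cases hv : v = 0
    · simp [hv]
    · have hv' : ‖v‖ ≠ 0 := norm_ne_zero_iff.2 hv
      set e : H := ((‖v‖⁻¹ : ℝ) : ℂ) • v with he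
      have hn : ‖e‖ = 1 := by
        rw [he, norm_smul, Complex.norm_real, norm_inv, norm_norm, inv_mul_cancel₀ hv']
      refine le_iSup₂_of_le {(⟨e, trivial⟩ : (totalPMap (rankOneSelf v)).domain)} ?_ ?_
      · rw [orthonormal_iff_ite]
        rintro ⟨i, hi⟩ ⟨j, hj⟩
        rw [Finset.mem_singleton] at hi hj
        subst hi hj
        rw [if_pos rfl, inner_self_eq_norm_sq_to_K]
        simp [hn]
      · rw [Finset.sum_singleton]
        refine ENNReal.ofReal_le_ofReal ?_
        rw [totalPMap_apply, re_inner_rankOneSelf]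
        simp only [he, inner_smul_left, Complex.conj_ofReal, norm_mul, Complex.norm_real, norm_inv,
          norm_norm, inner_self_eq_norm_sq_to_K]
        simp only [Complex.coe_algebraMap, norm_pow, Complex.norm_real, norm_norm]
        field_simp
        exact le_rfl

end BoundedOperators


/-! ### Geometry of unit cells -/

section UnitCell

variable {d : ℕ}

/-- Rounding down the coordinates in a lattice basis leaves a bounded remainder. This radius serves
as a bound on both unit cells, which are controlled only up to null sets. -/
lemma exists_covering_radius (L : Submodule ℤ (Pos d)) [DiscreteTopology L] [IsZLattice ℝ L] :
    ∃ ρ : ℝ, 0 ≤ ρ ∧ ∀ x : Pos d, ∃ ℓ ∈ L, ‖x - ℓ‖ ≤ ρ := by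
  set b := (Module.Free.chooseBasis ℤ L)
  set B := b.ofZLatticeBasis ℝ L
  refine ⟨∑ i, ‖B i‖, by positivity, fun x => ⟨ZSpan.floor B x, ?_, ZSpan.norm_fract_le B x⟩⟩
  exact (Module.Basis.ofZLatticeBasis_span ℝ L b).le (ZSpan.floor B x).2

lemma exists_nearest_lattice_point (L : Submodule ℤ (Pos d)) [DiscreteTopology L] (z : Pos d) :
    ∃ m ∈ L, ∀ ℓ ∈ L, ‖z - m‖ ≤ ‖z - ℓ‖ := by
  have : DiscreteTopology L.toAddSubgroup := inferInstanceAs (DiscreteTopology L)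
  have hcl : IsClosed (L : Set (Pos d)) := AddSubgroup.isClosed_of_discrete (H := L.toAddSubgroup)
  obtain ⟨m, hm, hd⟩ := hcl.exists_infDist_eq_dist ⟨0, L.zero_mem⟩ z
  refine ⟨m, hm, fun ℓ hℓ => ?_⟩
  rw [← dist_eq_norm, ← dist_eq_norm, ← hd]
  exact Metric.infDist_le_dist_of_mem hℓ

/-- The Wigner-Seitz cell. -/
def wignerSeitz (L : Submodule ℤ (Pos d)) : Set (Pos d) := {x | ∀ ℓ ∈ L, ‖x‖ ≤ ‖x - ℓ‖}

/-- The cell is an intersection of half-spaces `2⟨ℓ,x⟩ ≤ ‖ℓ‖²`. Convexity is wanted because it makes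
the frontier a null set. -/
lemma convex_wignerSeitz (L : Submodule ℤ (Pos d)) : Convex ℝ (wignerSeitz L) := by
  have : wignerSeitz L = ⋂ ℓ ∈ L, {x : Pos d | 2 * ⟪ℓ, x⟫_ℝ ≤ ‖ℓ‖ ^ 2} := by
    ext x
    simp only [wignerSeitz, Set.mem_ofPred_eq, Set.mem_iInter]
    refine forall₂_congr fun ℓ _ => ?_
    rw [← sq_le_sq₀ (norm_nonneg _) (norm_nonneg _), norm_sub_sq_real, real_inner_comm]
    constructor <;> intro h <;> linarith
  rw [this]
  refine convex_iInter₂ fun ℓ _ x hx y hy s t hs ht hst => ?_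
  simp only [Set.mem_ofPred_eq, inner_add_right, inner_smul_right] at hx hy ⊢
  calc 2 * (s * ⟪ℓ, x⟫_ℝ + t * ⟪ℓ, y⟫_ℝ) = s * (2 * ⟪ℓ, x⟫_ℝ) + t * (2 * ⟪ℓ, y⟫_ℝ) := by ring
    _ ≤ s * ‖ℓ‖ ^ 2 + t * ‖ℓ‖ ^ 2 := by gcongr
    _ = ‖ℓ‖ ^ 2 := by rw [← add_mul, hst, one_mul]

lemma norm_le_of_mem_wignerSeitz {L : Submodule ℤ (Pos d)} {ρ : ℝ}
    (hρ : ∀ x : Pos d, ∃ ℓ ∈ L, ‖x - ℓ‖ ≤ ρ) {x : Pos d} (hx : x ∈ wignerSeitz L) : ‖x‖ ≤ ρ := by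
  obtain ⟨ℓ, hℓ, h⟩ := hρ x
  exact (hx ℓ hℓ).trans h

instance (L : Submodule ℤ (Pos d)) : VAddInvariantMeasure L (Pos d) volume :=
  inferInstanceAs (VAddInvariantMeasure L.toAddSubgroup (Pos d) volume)

/-- Subtracting a nearest lattice point lands in the cell, and the countably many translates of its
frontier are null. -/
lemma ae_sub_mem_interior_wignerSeitz (L : Submodule ℤ (Pos d)) [DiscreteTopology L]
    [IsZLattice ℝ L] :
    ∀ᵐ z : Pos d, ∃ ℓ ∈ L, z - ℓ ∈ interior (wignerSeitz L) := by
  have h0 : volume (frontier (wignerSeitz L)) = 0 := (convex_wignerSeitz L).addHaar_frontier _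
  have h1 : ∀ᵐ z : Pos d, ∀ ℓ : L, z - ℓ ∉ frontier (wignerSeitz L) := by
    rw [ae_all_iff]
    intro ℓ
    exact (measurePreserving_sub_right volume (ℓ : Pos d)).quasiMeasurePreserving.ae
      (measure_eq_zero_iff_ae_notMem.1 h0)
  filter_upwards [h1] with z hz
  obtain ⟨m, hm, hmin⟩ := exists_nearest_lattice_point L z
  refine ⟨m, hm, ?_⟩
  have hW : z - m ∈ wignerSeitz L := fun ℓ hℓ => by
    have := hmin (m + ℓ) (L.add_mem hm hℓ)
    rwa [sub_add_eq_sub_sub] at this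
  have := hz ⟨m, hm⟩
  by_contra hcon
  exact this ⟨subset_closure hW, hcon⟩

namespace IsUnitCell

variable {L : Submodule ℤ (Pos d)} {Γ : Set (Pos d)}

lemma eq_of_sub_mem (h : IsUnitCell L Γ) {x y : Pos d} (hx : x ∈ Γ) (hy : y ∈ Γ)
    (hxy : x - y ∈ L) : x = y := by
  obtain ⟨ℓ, -, hu⟩ := h.partition x
  have h1 := hu 0 ⟨L.zero_mem, by simpa using hx⟩
  have h2 := hu (x - y) ⟨hxy, by simpa using hy⟩
  rw [← sub_eq_zero, h2, h1]

lemma isAddFundamentalDomain (h : IsUnitCell L Γ) :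
    IsAddFundamentalDomain L Γ (volume : Measure (Pos d)) := by
  refine IsAddFundamentalDomain.mk' h.measurableSet.nullMeasurableSet fun x => ?_
  obtain ⟨ℓ, ⟨hℓ, hx⟩, hu⟩ := h.partition x
  refine ⟨-⟨ℓ, hℓ⟩, ?_, fun m hm => ?_⟩
  · change -ℓ + x ∈ Γ
    rwa [neg_add_eq_sub]
  · have := hu (-(m : Pos d)) ⟨L.neg_mem m.2, by rw [sub_neg_eq_add, add_comm]; exact hm⟩
    refine Subtype.ext ?_
    change (m : Pos d) = -ℓ
    rw [← this, neg_neg]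

variable [DiscreteTopology L] [IsZLattice ℝ L]

lemma volume_eq (h : IsUnitCell L Γ) : volume Γ =
    volume (ZSpan.fundamentalDomain ((Module.Free.chooseBasis ℤ L).ofZLatticeBasis ℝ L)) :=
  h.isAddFundamentalDomain.measure_eq
    (ZLattice.isAddFundamentalDomain (Module.Free.chooseBasis ℤ L) volume)

lemma volume_ne_top (h : IsUnitCell L Γ) : volume Γ ≠ ⊤ := by
  rw [h.volume_eq]
  exact (ZSpan.fundamentalDomain_isBounded _).measure_lt_top.ne

lemma volume_ne_zero (h : IsUnitCell L Γ) : volume Γ ≠ 0 := by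
  rw [h.volume_eq]
  exact ZSpan.measure_fundamentalDomain_ne_zero _

/-- Only the interiors of `Γ` and of the Wigner-Seitz cell are known to agree. For almost every `z`
the representative of `z` in the Wigner-Seitz cell is interior, hence lies in `Γ`, and
representatives in `Γ` are unique. -/
lemma ae_forall_mem_wignerSeitz (h : IsUnitCell L Γ) :
    ∀ᵐ z : Pos d, ∀ w ∈ Γ, z - w ∈ L → w ∈ wignerSeitz L := by
  filter_upwards [ae_sub_mem_interior_wignerSeitz L] with z hz w hw hzw
  obtain ⟨ℓ, hℓ, hi⟩ := hz
  have hΓ : z - ℓ ∈ Γ := by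
    have hi' : z - ℓ ∈ interior Γ := by rw [h.interior_eq]; exact hi
    exact interior_subset hi'
  have : w = z - ℓ := h.eq_of_sub_mem hw hΓ (by
    have : w - (z - ℓ) = ℓ - (z - w) := by abel
    rw [this]
    exact L.sub_mem hℓ hzw)
  rw [this]
  exact interior_subset hi

lemma ae_norm_le (h : IsUnitCell L Γ) {ρ : ℝ} (hρ : ∀ x : Pos d, ∃ ℓ ∈ L, ‖x - ℓ‖ ≤ ρ) :
    ∀ᵐ x ∂(volume.restrict Γ), ‖x‖ ≤ ρ := by
  rw [ae_restrict_iff' h.measurableSet]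
  filter_upwards [h.ae_forall_mem_wignerSeitz] with x hx hxΓ
  exact norm_le_of_mem_wignerSeitz hρ (hx x hxΓ (by simp))

lemma setLIntegral_eq_of_periodic (h : IsUnitCell L Γ) (f : Pos d → ℝ≥0∞) :
    ∫⁻ x, f x = ∑' ℓ : L, ∫⁻ x in Γ, f (x + ℓ) := by
  rw [h.isAddFundamentalDomain.lintegral_eq_tsum'']
  refine tsum_congr fun ℓ => lintegral_congr fun x => ?_
  rw [add_comm]
  rfl

end IsUnitCell

end UnitCell

/-! ### Polynomial decay -/

section Decay

variable {d : ℕ}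

/-- The weight `(1 + |y|)^{-(d+1)}`. -/
def decayWeight (y : Pos d) : ℝ := ((1 + ‖y‖) ^ (d + 1))⁻¹

lemma decayWeight_pos (y : Pos d) : 0 < decayWeight y := by
  unfold decayWeight
  positivity

lemma decayWeight_le_one (y : Pos d) : decayWeight y ≤ 1 := by
  refine inv_le_one_of_one_le₀ (one_le_pow₀ ?_)
  linarith [norm_nonneg y]

/-- This rests on `1 + ‖y‖ ≤ (1 + ‖x‖)(1 + ‖x + y‖)`: a translation costs only a polynomial factor
in its length. -/
lemma decayWeight_add_le (x y : Pos d) :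
    decayWeight (x + y) ≤ (1 + ‖x‖) ^ (d + 1) * decayWeight y := by
  unfold decayWeight
  rw [← div_eq_mul_inv, le_div_iff₀ (by positivity), inv_mul_le_iff₀ (by positivity), ← mul_pow]
  refine pow_le_pow_left₀ (by positivity) ?_ _
  have h1 : ‖y‖ ≤ ‖x + y‖ + ‖x‖ := by
    calc ‖y‖ = ‖(x + y) - x‖ := by congr 1; abel
      _ ≤ _ := norm_sub_le _ _
  nlinarith [norm_nonneg x, norm_nonneg (x + y)]

lemma continuous_decayWeight : Continuous (decayWeight (d := d)) := by
  unfold decayWeight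
  refine Continuous.inv₀ (by fun_prop) fun y => by positivity

/-- The exponent `d + 1` exceeds the rank of the lattice; it makes the integral over the whole space
converge as well. -/
lemma summable_decayWeight (L : Submodule ℤ (Pos d)) [DiscreteTopology L] [IsZLattice ℝ L] :
    Summable fun ℓ : L => decayWeight (ℓ : Pos d) := by
  have hr : Module.finrank ℤ L < d + 1 := by
    rw [ZLattice.rank ℝ L, finrank_euclideanSpace_fin]
    exact Nat.lt_succ_self d
  refine Summable.of_norm_bounded_eventually (ZLattice.summable_norm_pow_inv L (d + 1) hr) ?_
  -- At `ℓ = 0` the comparison fails: the inverse power of the norm is `0` by convention, while the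
  -- weight is `1`.
  filter_upwards [(Set.finite_singleton (0 : L)).compl_mem_cofinite] with ℓ hℓ
  have hℓ' : 0 < ‖ℓ‖ := norm_pos_iff.2 hℓ
  rw [Real.norm_of_nonneg (decayWeight_pos _).le, decayWeight, inv_pow]
  refine inv_anti₀ (by positivity) (pow_le_pow_left₀ hℓ'.le ?_ _)
  simp

lemma integrable_decayWeight : Integrable (decayWeight (d := d)) := by
  have := integrable_one_add_norm (E := Pos d) (μ := volume) (r := (d + 1 : ℝ)) (by simp)
  refine this.congr (ae_of_all _ fun y => ?_)
  simp only [decayWeight]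
  rw [Real.rpow_neg (by positivity)]
  norm_cast

lemma memLp_decayWeight : MemLp (decayWeight (d := d)) 2 := by
  rw [memLp_two_iff_integrable_sq continuous_decayWeight.aestronglyMeasurable]
  refine integrable_decayWeight.mono (continuous_decayWeight.pow 2).aestronglyMeasurable
    (ae_of_all _ fun y => ?_)
  rw [Real.norm_of_nonneg (by positivity), Real.norm_of_nonneg (decayWeight_pos _).le]
  nlinarith [decayWeight_pos y, decayWeight_le_one y]

end Decay


/-! ### Plane waves and the reciprocal lattice -/

section PlaneWave

variable {d : ℕ}

/-- The plane wave `e^{-i k·y}`. -/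
def planeWave (k y : Pos d) : ℂ := Complex.exp (-Complex.I * (⟪k, y⟫_ℝ : ℝ))

@[simp] lemma norm_planeWave (k y : Pos d) : ‖planeWave k y‖ = 1 := by
  rw [planeWave, neg_mul, ← mul_neg, ← Complex.ofReal_neg, Complex.norm_exp_I_mul_ofReal]

lemma planeWave_add (k x y : Pos d) : planeWave k (x + y) = planeWave k x * planeWave k y := by
  rw [planeWave, inner_add_right, planeWave, planeWave, ← Complex.exp_add]
  push_cast
  ring_nf

lemma planeWave_add_left (k k' y : Pos d) :
    planeWave (k + k') y = planeWave k y * planeWave k' y := by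
  rw [planeWave, inner_add_left, planeWave, planeWave, ← Complex.exp_add]
  push_cast
  ring_nf

lemma conj_planeWave (k y : Pos d) : conj (planeWave k y) = planeWave k (-y) := by
  rw [planeWave, planeWave, ← Complex.exp_conj, inner_neg_right]
  congr 1
  simp

@[simp] lemma planeWave_zero (k : Pos d) : planeWave k 0 = 1 := by simp [planeWave]

lemma continuous_planeWave_left (y : Pos d) : Continuous fun k : Pos d => planeWave k y := by
  unfold planeWave
  fun_prop

lemma continuous_planeWave_right (k : Pos d) : Continuous fun y : Pos d => planeWave k y := by
  unfold planeWave
  fun_prop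

end PlaneWave

/-! ### The lattice, its reciprocal lattice and the normalized measure on the zone -/

namespace Crystal

variable {d : ℕ} (C : Crystal d)

/-- The reciprocal lattice. -/
def Ls : Submodule ℤ (Pos d) := Submodule.span ℤ (Set.range C.b)

lemma linearIndependent_dual : LinearIndependent ℝ C.b := by
  rw [Fintype.linearIndependent_iff]
  intro g hg j
  have h := congrArg (fun x => ⟪x, C.a j⟫_ℝ) hg
  simp only [sum_inner, inner_smul_left, C.dual, inner_zero_left] at h
  simpa [Real.pi_ne_zero] using h

/-- The basis of the lattice. -/
def basis : Module.Basis (Fin d) ℝ (Pos d) :=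
  basisOfLinearIndependentOfCardEqFinrank' C.a C.linearIndependent (by simp)

/-- The basis of the reciprocal lattice. -/
def dualBasis : Module.Basis (Fin d) ℝ (Pos d) :=
  basisOfLinearIndependentOfCardEqFinrank' C.b C.linearIndependent_dual (by simp)

@[simp] lemma coe_basis : ⇑C.basis = C.a :=
  coe_basisOfLinearIndependentOfCardEqFinrank' ..

@[simp] lemma coe_dualBasis : ⇑C.dualBasis = C.b :=
  coe_basisOfLinearIndependentOfCardEqFinrank' ..

instance : DiscreteTopology C.L := by
  rw [L, ← coe_basis]
  infer_instance

instance : DiscreteTopology C.Ls := by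
  rw [Ls, ← coe_dualBasis]
  infer_instance

instance : IsZLattice ℝ C.L := by
  simp only [L, ← coe_basis]
  infer_instance

instance : IsZLattice ℝ C.Ls := by
  simp only [Ls, ← coe_dualBasis]
  infer_instance

lemma unitCell : IsUnitCell C.L C.Γ := C.isUnitCell

lemma unitCell_dual : IsUnitCell C.Ls C.Γs := C.isUnitCell_dual

/-- The normalized Lebesgue measure on the reciprocal unit cell. -/
def zoneMeasure : Measure (Pos d) := (volume C.Γs)⁻¹ • volume.restrict C.Γs

instance : IsProbabilityMeasure C.zoneMeasure := by
  refine ⟨?_⟩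
  rw [zoneMeasure, Measure.smul_apply, Measure.restrict_apply_univ, smul_eq_mul,
    ENNReal.inv_mul_cancel C.unitCell_dual.volume_ne_zero C.unitCell_dual.volume_ne_top]

instance : IsFiniteMeasure ((volume : Measure (Pos d)).restrict C.Γ) :=
  ⟨by rw [Measure.restrict_apply_univ]; exact C.unitCell.volume_ne_top.lt_top⟩

lemma zoneMeasure_ac : C.zoneMeasure ≪ volume.restrict C.Γs :=
  Measure.smul_absolutelyContinuous

lemma ac_zoneMeasure : volume.restrict C.Γs ≪ C.zoneMeasure :=
  Measure.absolutelyContinuous_smul (by simpa using C.unitCell_dual.volume_ne_top)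

lemma restrict_eq_smul_zoneMeasure :
    volume.restrict C.Γs = volume C.Γs • C.zoneMeasure := by
  rw [zoneMeasure, smul_smul, ENNReal.mul_inv_cancel C.unitCell_dual.volume_ne_zero
    C.unitCell_dual.volume_ne_top, one_smul]

lemma exists_inner_eq_two_pi_mul {g ℓ : Pos d} (hg : g ∈ C.Ls) (hℓ : ℓ ∈ C.L) :
    ∃ n : ℤ, ⟪g, ℓ⟫_ℝ = n * (2 * Real.pi) := by
  induction hg using Submodule.span_induction with
  | mem x hx =>
    obtain ⟨i, rfl⟩ := hx
    induction hℓ using Submodule.span_induction with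
    | mem y hy =>
      obtain ⟨j, rfl⟩ := hy
      rw [C.dual]
      split_ifs
      · exact ⟨1, by simp⟩
      · exact ⟨0, by simp⟩
    | zero => exact ⟨0, by simp⟩
    | add y z _ _ hy hz =>
      obtain ⟨m, hm⟩ := hy
      obtain ⟨n, hn⟩ := hz
      exact ⟨m + n, by rw [inner_add_right, hm, hn]; push_cast; ring⟩
    | smul c y _ hy =>
      obtain ⟨m, hm⟩ := hy
      refine ⟨c * m, ?_⟩
      rw [← Int.cast_smul_eq_zsmul ℝ, inner_smul_right, hm]
      push_cast
      ring
  | zero => exact ⟨0, by simp⟩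
  | add y z _ _ hy hz =>
    obtain ⟨m, hm⟩ := hy
    obtain ⟨n, hn⟩ := hz
    exact ⟨m + n, by rw [inner_add_left, hm, hn]; push_cast; ring⟩
  | smul c y _ hy =>
    obtain ⟨m, hm⟩ := hy
    refine ⟨c * m, ?_⟩
    rw [← Int.cast_smul_eq_zsmul ℝ, real_inner_smul_left, hm]
    push_cast
    ring

lemma planeWave_eq_one {g ℓ : Pos d} (hg : g ∈ C.Ls) (hℓ : ℓ ∈ C.L) : planeWave g ℓ = 1 := by
  obtain ⟨n, hn⟩ := C.exists_inner_eq_two_pi_mul hg hℓ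
  rw [planeWave, hn, Complex.exp_eq_one_iff]
  exact ⟨-n, by push_cast; ring⟩

lemma mem_Ls_of_forall {g : Pos d} (h : ∀ i, ∃ n : ℤ, ⟪g, C.a i⟫_ℝ = n * (2 * Real.pi)) :
    g ∈ C.Ls := by
  choose n hn using h
  have : g = ∑ i, n i • C.b i := by
    rw [← sub_eq_zero]
    refine InnerProductSpace.ext_inner_right_basis C.basis fun i => ?_
    rw [coe_basis, inner_sub_left, sum_inner, inner_zero_left, hn]
    simp only [← Int.cast_smul_eq_zsmul ℝ, inner_smul_left, C.dual]
    simp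
  rw [this]
  exact C.Ls.sum_mem fun i _ => C.Ls.smul_mem _ (Submodule.subset_span ⟨i, rfl⟩)

-- Shifting `k` by `h = πm/‖m‖²` multiplies the integrand by `e^{-iπ} = -1`. The integrand is
-- periodic under the reciprocal lattice, so its integral is the same over the fundamental domains
-- `Γ*` and `h + Γ*`, and therefore equals its own negative.
open scoped Pointwise in
lemma integral_planeWave_of_ne_zero {m : Pos d} (hm : m ∈ C.L) (hm0 : m ≠ 0) :
    ∫ k, planeWave k m ∂C.zoneMeasure = 0 := by
  set h : Pos d := (Real.pi / ‖m‖ ^ 2) • m with hh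
  have hw : planeWave h m = -1 := by
    have : ⟪h, m⟫_ℝ = Real.pi := by
      rw [hh, real_inner_smul_left, real_inner_self_eq_norm_sq, div_mul_cancel₀]
      exact pow_ne_zero _ (norm_ne_zero_iff.2 hm0)
    rw [planeWave, this, neg_mul, Complex.exp_neg, mul_comm, Complex.exp_pi_mul_I]
    norm_num
  have hfd := C.unitCell_dual.isAddFundamentalDomain
  have hfd' := hfd.vadd_of_comm h
  have h1 : ∫ k in C.Γs, planeWave k m = ∫ k in h +ᵥ C.Γs, planeWave k m :=
    hfd.setIntegral_eq hfd' fun g k => by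
      change planeWave ((g : Pos d) + k) m = _
      rw [planeWave_add_left, C.planeWave_eq_one g.2 hm, one_mul]
  have h2 : ∫ k in h +ᵥ C.Γs, planeWave k m = ∫ k in C.Γs, planeWave (h + k) m :=
    (measurePreserving_vadd h volume).setIntegral_image_emb (measurableEmbedding_const_vadd h) _ _
  simp only [planeWave_add_left, hw, neg_one_mul, integral_neg] at h2
  rw [h2] at h1
  have h3 : ∫ k in C.Γs, planeWave k m = 0 := by
    linear_combination (1 / 2 : ℂ) * h1
  rw [zoneMeasure, integral_smul_measure, h3, smul_zero]

/-! ### Completeness of the lattice characters on the zone -/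

/-- The coordinates of `k` in the reciprocal basis, modulo one. -/
def toTorus (k : Pos d) : UnitAddTorus (Fin d) :=
  fun i => ((⟪k, C.a i⟫_ℝ / (2 * Real.pi) : ℝ) : UnitAddCircle)

lemma continuous_toTorus : Continuous C.toTorus := by
  refine continuous_pi fun i => ?_
  exact (AddCircle.continuous_mk' 1).comp (by fun_prop)

lemma mFourier_toTorus (n : Fin d → ℤ) (k : Pos d) :
    UnitAddTorus.mFourier n (C.toTorus k) = planeWave k (-∑ i, n i • C.a i) := by
  rw [← conj_planeWave, planeWave, ← Complex.exp_conj, inner_sum]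
  simp only [UnitAddTorus.mFourier, ContinuousMap.coe_mk, toTorus, fourier_coe_apply]
  rw [← Complex.exp_sum]
  congr 1
  simp only [← Int.cast_smul_eq_zsmul ℝ, inner_smul_right, map_mul, map_neg, Complex.conj_I,
    Complex.conj_ofReal]
  push_cast
  rw [neg_neg, Finset.mul_sum]
  refine Finset.sum_congr rfl fun i _ => ?_
  have : (Real.pi : ℂ) ≠ 0 := by exact_mod_cast Real.pi_ne_zero
  field_simp

lemma toTorus_injOn : Set.InjOn C.toTorus C.Γs := by
  intro k hk k' hk' h
  refine C.unitCell_dual.eq_of_sub_mem hk hk' (C.mem_Ls_of_forall fun i => ?_)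
  have hi := congrFun h i
  simp only [toTorus] at hi
  rw [← sub_eq_zero, ← AddCircle.coe_sub, AddCircle.coe_eq_zero_iff] at hi
  obtain ⟨n, hn⟩ := hi
  refine ⟨n, ?_⟩
  have hpi := Real.pi_ne_zero
  rw [zsmul_eq_mul, mul_one] at hn
  rw [inner_sub_left, hn]
  field_simp

/-- The plane waves indexed by the lattice are complete on the reciprocal unit cell. -/
lemma ae_eq_zero_of_fourier {h : Pos d → ℂ} (hh : MemLp h 2 C.zoneMeasure)
    (h0 : ∀ m ∈ C.L, ∫ k, conj (planeWave k m) * h k ∂C.zoneMeasure = 0) :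
    h =ᵐ[C.zoneMeasure] 0 := by
  -- The zone measure is pushed forward to the torus. The coordinate map is injective on `Γ*`, hence
  -- a measurable embedding of a standard Borel space, so `h` is the pullback of a function `g`.
  -- Trigonometric polynomials are dense in `L²` of any finite measure on the torus, so `ν` need not
  -- be identified with Haar measure.
  set ν : Measure (UnitAddTorus (Fin d)) := C.zoneMeasure.map C.toTorus with hν
  have hπ : Measurable C.toTorus := C.continuous_toTorus.measurable
  have : IsProbabilityMeasure ν := Measure.isProbabilityMeasure_map hπ.aemeasurable
  have : StandardBorelSpace C.Γs := C.unitCell_dual.measurableSet.standardBorel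
  have hemb : MeasurableEmbedding (fun k : C.Γs => C.toTorus k) :=
    (hπ.comp measurable_subtype_coe).measurableEmbedding fun k k' hkk' =>
      Subtype.ext (C.toTorus_injOn k.2 k'.2 hkk')
  set h' := hh.1.mk h with hh'
  have hmeas : Measurable h' := hh.1.stronglyMeasurable_mk.measurable
  obtain ⟨g, hg, hgh⟩ := hemb.exists_measurable_extend (hmeas.comp measurable_subtype_coe)
    fun _ => inferInstance
  have hgk : ∀ᵐ k ∂C.zoneMeasure, g (C.toTorus k) = h k := by
    have h1 : ∀ᵐ k ∂C.zoneMeasure, k ∈ C.Γs :=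
      C.zoneMeasure_ac.ae_le (ae_restrict_mem C.unitCell_dual.measurableSet)
    filter_upwards [h1, hh.1.ae_eq_mk] with k hk hk'
    rw [hk']
    exact congrFun hgh ⟨k, hk⟩
  have hgL : MemLp g 2 ν := by
    rw [hν, memLp_map_measure_iff hg.aestronglyMeasurable hπ.aemeasurable]
    exact hh.ae_eq (hgk.mono fun k hk => hk.symm)
  have hG : hgL.toLp g = 0 := by
    have hdense : (Submodule.span ℂ (Set.range fun n : Fin d → ℤ =>
        ContinuousMap.toLp (E := ℂ) 2 ν ℂ (UnitAddTorus.mFourier n))).topologicalClosure = ⊤ := by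
      simpa only [Submodule.map_span, ContinuousLinearMap.coe_coe, ← Set.range_comp,
        Function.comp_def] using
        (ContinuousMap.toLp_denseRange ℂ ν ℂ (by simp)).topologicalClosure_map_submodule
          (UnitAddTorus.span_mFourier_closure_eq_top (d := Fin d))
    rw [← Submodule.mem_bot (R := ℂ), ← Submodule.top_orthogonal_eq_bot, ← hdense,
      Submodule.orthogonal_closure, Submodule.mem_orthogonal]
    intro u hu
    induction hu using Submodule.span_induction with
    | zero => simp
    | add x y _ _ hx hy => rw [inner_add_left, hx, hy, add_zero]
    | smul c x _ hx => rw [inner_smul_left, hx, mul_zero]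
    | mem x hx =>
      obtain ⟨n, rfl⟩ := hx
      rw [L2.inner_def]
      have hm : -∑ i, n i • C.a i ∈ C.L :=
        C.L.neg_mem (C.L.sum_mem fun i _ => C.L.smul_mem _ (Submodule.subset_span ⟨i, rfl⟩))
      rw [← h0 _ hm]
      have : ∫ t, conj (UnitAddTorus.mFourier n t) * g t ∂ν
          = ∫ k, conj (planeWave k (-∑ i, n i • C.a i)) * h k ∂C.zoneMeasure := by
        rw [hν, integral_map hπ.aemeasurable]
        · refine integral_congr_ae (hgk.mono fun k hk => ?_)
          simp only [hk, mFourier_toTorus]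
        · exact (Continuous.aestronglyMeasurable (by fun_prop)).mul hg.aestronglyMeasurable
      rw [← this]
      refine integral_congr_ae ?_
      filter_upwards [ContinuousMap.coeFn_toLp (p := 2) (𝕜 := ℂ) ν (UnitAddTorus.mFourier n),
        hgL.coeFn_toLp] with t h1 h2
      rw [h1, h2, RCLike.inner_apply, mul_comm]
  have hg0 : g =ᵐ[ν] 0 := by
    have := hgL.coeFn_toLp
    rw [hG] at this
    exact this.symm.trans (Lp.coeFn_zero ..)
  filter_upwards [hgk, ae_of_ae_map hπ.aemeasurable hg0] with k h1 h2
  rw [← h1, h2]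
  rfl

end Crystal


/-! ### Auxiliary facts on `L²` spaces -/

section LpAux

variable {α E : Type*} [MeasurableSpace α] {ν : Measure α} [NormedAddCommGroup E]

lemma lintegral_enorm_sq_eq (w : Lp E 2 ν) : ∫⁻ x, ‖w x‖ₑ ^ 2 ∂ν = ‖w‖ₑ ^ 2 := by
  rw [Lp.enorm_def, eLpNorm_eq_lintegral_rpow_enorm_toReal (by simp) (by simp), ← ENNReal.rpow_natCast,
    ← ENNReal.rpow_mul]
  simp

lemma Lp.coeFn_finset_sum {ι : Type*} (s : Finset ι) (F : ι → Lp E 2 ν) :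
    ((∑ i ∈ s, F i : Lp E 2 ν) : α → E) =ᵐ[ν] fun x => ∑ i ∈ s, F i x := by
  classical
  induction s using Finset.induction_on with
  | empty =>
    simp only [Finset.sum_empty]
    exact Lp.coeFn_zero ..
  | insert i s hi ih =>
    rw [Finset.sum_insert hi]
    filter_upwards [Lp.coeFn_add (F i) (∑ j ∈ s, F j), ih] with x h1 h2
    rw [h1, Pi.add_apply, h2, Finset.sum_insert hi]

/-- Convergence in `L²` implies convergence in measure, hence almost everywhere along a sequence of
finite sets going to `atTop`; there the limit must be the pointwise sum. -/
lemma ae_eq_of_hasSum {ι : Type*} [Countable ι] {F : ι → Lp E 2 ν} {f : Lp E 2 ν}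
    (hF : HasSum F f) {g : α → E} (hg : ∀ᵐ x ∂ν, HasSum (fun i => F i x) (g x)) :
    f =ᵐ[ν] g := by
  have h1 : TendstoInMeasure ν (fun s : Finset ι => ⇑(∑ i ∈ s, F i)) atTop f :=
    tendstoInMeasure_of_tendsto_Lp hF
  obtain ⟨ns, hns, hae⟩ := h1.exists_seq_tendsto_ae'
  have h2 : ∀ᵐ x ∂ν, ∀ n, (∑ i ∈ ns n, F i : Lp E 2 ν) x = ∑ i ∈ ns n, F i x :=
    ae_all_iff.2 fun n => Lp.coeFn_finset_sum _ _
  filter_upwards [hae, h2, hg] with x hx1 hx2 hx3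
  simp only [hx2] at hx1
  exact tendsto_nhds_unique hx1 (hx3.comp hns)

lemma tendsto_toLp_of_dominated {X : Type*} {l : Filter X} [l.IsCountablyGenerated]
    {F : X → α → E} {f : α → E}
    (hF : ∀ x, MemLp (F x) 2 ν) (hf : MemLp f 2 ν) {g : α → ℝ} (hg : MemLp g 2 ν)
    (hbound : ∀ᶠ x in l, ∀ᵐ a ∂ν, ‖F x a‖ ≤ g a) (hfg : ∀ᵐ a ∂ν, ‖f a‖ ≤ g a)
    (hlim : ∀ᵐ a ∂ν, Tendsto (fun x => F x a) l (𝓝 (f a))) :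
    Tendsto (fun x => (hF x).toLp (F x)) l (𝓝 (hf.toLp f)) := by
  rw [Lp.tendsto_Lp_iff_tendsto_eLpNorm'']
  have key : Tendsto (fun x => ∫⁻ a, ‖F x a - f a‖ₑ ^ 2 ∂ν) l (𝓝 (∫⁻ _, 0 ∂ν)) := by
    refine tendsto_lintegral_filter_of_dominated_convergence' (fun a => (2 * ‖g a‖ₑ) ^ 2) ?_ ?_ ?_ ?_
    · exact Eventually.of_forall fun x => ((hF x).1.sub hf.1).enorm.pow_const 2
    · filter_upwards [hbound] with x hx
      filter_upwards [hx, hfg] with a h1 h2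
      refine pow_le_pow_left' ?_ 2
      rw [two_mul]
      refine (enorm_sub_le).trans (add_le_add ?_ ?_)
      · exact enorm_le_iff_norm_le.2 (h1.trans (le_abs_self _))
      · exact enorm_le_iff_norm_le.2 (h2.trans (le_abs_self _))
    · simp only [mul_pow]
      rw [lintegral_const_mul' _ _ (by simp)]
      refine ENNReal.mul_ne_top (by simp) ?_
      have h1 : ∫⁻ a, ‖g a‖ₑ ^ 2 ∂ν = ∫⁻ a, ‖hg.toLp g a‖ₑ ^ 2 ∂ν :=
        lintegral_congr_ae (hg.coeFn_toLp.mono fun a ha => by simp only [ha])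
      rw [h1, lintegral_enorm_sq_eq]
      exact ENNReal.pow_ne_top enorm_ne_top
    · filter_upwards [hlim] with a ha
      have h1 : Tendsto (fun x => ‖F x a - f a‖ₑ) l (𝓝 0) := by
        have := (ha.sub_const (f a)).enorm
        simpa using this
      simpa using h1.ennrpow_const 2
  simp only [lintegral_zero] at key
  have h2 : ∀ x, eLpNorm (F x - f) 2 ν = (∫⁻ a, ‖F x a - f a‖ₑ ^ 2 ∂ν) ^ (1 / 2 : ℝ) := fun x => by
    rw [eLpNorm_eq_lintegral_rpow_enorm_toReal (by simp) (by simp)]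
    simp
  simp only [h2]
  have := key.ennrpow_const (1 / 2 : ℝ)
  simpa using this

variable [NormedSpace ℂ E]

lemma memLp_unimodular_smul {c : α → ℂ} (hc : AEStronglyMeasurable c ν) (h1 : ∀ x, ‖c x‖ = 1)
    (w : Lp E 2 ν) : MemLp (fun x => c x • w x) 2 ν :=
  (Lp.memLp w).of_le (hc.smul (Lp.aestronglyMeasurable w))
    (ae_of_all _ fun x => by rw [norm_smul, h1, one_mul])

/-- Multiplication by a measurable function with values in the unit circle. -/
def unimodularMul (c : α → ℂ) (hc : AEStronglyMeasurable c ν) (h1 : ∀ x, ‖c x‖ = 1) :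
    Lp E 2 ν →ₗᵢ[ℂ] Lp E 2 ν where
  toFun w := (memLp_unimodular_smul hc h1 w).toLp _
  map_add' v w := by
    rw [← MemLp.toLp_add]
    refine MemLp.toLp_congr _ _ ?_
    filter_upwards [Lp.coeFn_add v w] with x hx
    rw [hx, Pi.add_apply, Pi.add_apply, smul_add]
  map_smul' a w := by
    rw [RingHom.id_apply, ← MemLp.toLp_const_smul]
    refine MemLp.toLp_congr _ _ ?_
    filter_upwards [Lp.coeFn_smul a w] with x hx
    rw [hx, Pi.smul_apply, Pi.smul_apply, smul_comm]
  norm_map' w := by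
    change ‖(memLp_unimodular_smul hc h1 w).toLp _‖ = _
    rw [Lp.norm_toLp, Lp.norm_def]
    congr 1
    exact eLpNorm_congr_norm_ae (ae_of_all _ fun x => by rw [norm_smul, h1, one_mul])

lemma coeFn_unimodularMul (c : α → ℂ) (hc : AEStronglyMeasurable c ν) (h1 : ∀ x, ‖c x‖ = 1)
    (w : Lp E 2 ν) : unimodularMul c hc h1 w =ᵐ[ν] fun x => c x • w x :=
  (memLp_unimodular_smul hc h1 w).coeFn_toLp

end LpAux

/-! ### Translations -/

section Translation

variable {d : ℕ}

namespace Crystal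

/-- Translations, as linear isometries. -/
def translateₗᵢ (ℓ : Pos d) : L2 d →ₗᵢ[ℂ] L2 d :=
  Lp.compMeasurePreservingₗᵢ ℂ (fun y => y - ℓ) (measurePreserving_sub_right volume ℓ)

@[simp] lemma translateₗᵢ_apply (ℓ : Pos d) (ψ : L2 d) : translateₗᵢ ℓ ψ = translate ℓ ψ := rfl

lemma coeFn_translate (ℓ : Pos d) (ψ : L2 d) : translate ℓ ψ =ᵐ[volume] fun y => ψ (y - ℓ) :=
  Lp.coeFn_compMeasurePreserving ψ (measurePreserving_sub_right volume ℓ)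

lemma ae_comp_sub {p : Pos d → Prop} (h : ∀ᵐ y : Pos d, p y) (ℓ : Pos d) :
    ∀ᵐ y : Pos d, p (y - ℓ) :=
  (measurePreserving_sub_right volume ℓ).quasiMeasurePreserving.ae h

lemma ae_comp_add {p : Pos d → Prop} (h : ∀ᵐ y : Pos d, p y) (ℓ : Pos d) :
    ∀ᵐ y : Pos d, p (y + ℓ) :=
  (measurePreserving_add_right volume ℓ).quasiMeasurePreserving.ae h

lemma translate_translate (ℓ m : Pos d) (ψ : L2 d) :
    translate ℓ (translate m ψ) = translate (ℓ + m) ψ := by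
  refine Lp.ext ?_
  filter_upwards [coeFn_translate ℓ (translate m ψ), coeFn_translate (ℓ + m) ψ,
    ae_comp_sub (coeFn_translate m ψ) ℓ] with y h1 h2 h3
  rw [h1, h2, h3, sub_sub]

lemma translate_zero (ψ : L2 d) : translate 0 ψ = ψ := by
  refine Lp.ext ?_
  filter_upwards [coeFn_translate 0 ψ] with y h1
  rw [h1, sub_zero]

lemma inner_translate_left (ℓ : Pos d) (φ ψ : L2 d) :
    ⟪translate ℓ φ, ψ⟫_ℂ = ⟪φ, translate (-ℓ) ψ⟫_ℂ := by
  have h := (translateₗᵢ (d := d) ℓ).inner_map_map φ (translate (-ℓ) ψ)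
  simp only [translateₗᵢ_apply, translate_translate, add_neg_cancel, translate_zero] at h
  exact h

end Crystal

end Translation

/-! ### Decomposition of `L²(ℝ^d)` over the cells of the lattice -/

namespace Crystal

variable {d : ℕ} (C : Crystal d)

lemma memLp_cell_indicator (w : L2per C.Γ) : MemLp (C.Γ.indicator w) 2 :=
  (memLp_indicator_iff_restrict C.unitCell.measurableSet).2 (Lp.memLp w)

lemma cell_indicator_ae_eq {v w : Pos d → ℂ} (h : v =ᵐ[volume.restrict C.Γ] w) :
    C.Γ.indicator v =ᵐ[volume] C.Γ.indicator w := by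
  filter_upwards [(ae_restrict_iff' C.unitCell.measurableSet).1 h] with x hx
  by_cases hxΓ : x ∈ C.Γ
  · rw [Set.indicator_of_mem hxΓ, Set.indicator_of_mem hxΓ, hx hxΓ]
  · rw [Set.indicator_of_notMem hxΓ, Set.indicator_of_notMem hxΓ]

/-- Extension by zero from the unit cell. -/
def cellExtend : L2per C.Γ →ₗᵢ[ℂ] L2 d where
  toFun w := (C.memLp_cell_indicator w).toLp _
  map_add' v w := by
    rw [← MemLp.toLp_add]
    refine MemLp.toLp_congr _ _ ?_
    rw [← Set.indicator_add']
    exact C.cell_indicator_ae_eq (Lp.coeFn_add v w)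
  map_smul' a w := by
    rw [RingHom.id_apply, ← MemLp.toLp_const_smul]
    refine MemLp.toLp_congr _ _ ?_
    refine (C.cell_indicator_ae_eq (Lp.coeFn_smul a w)).trans (ae_of_all _ fun x => ?_)
    exact Set.indicator_const_smul_apply C.Γ a w x
  norm_map' w := by
    change ‖(C.memLp_cell_indicator w).toLp _‖ = _
    rw [Lp.norm_toLp, Lp.norm_def, eLpNorm_indicator_eq_eLpNorm_restrict C.unitCell.measurableSet]

lemma coeFn_cellExtend (w : L2per C.Γ) : C.cellExtend w =ᵐ[volume] C.Γ.indicator w :=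
  (C.memLp_cell_indicator w).coeFn_toLp

/-- Restriction to the unit cell. -/
def cellRestrict : L2 d →L[ℂ] L2per C.Γ := LpToLpRestrictCLM (Pos d) ℂ ℂ volume 2 C.Γ

lemma coeFn_cellRestrict (u : L2 d) : C.cellRestrict u =ᵐ[volume.restrict C.Γ] u :=
  LpToLpRestrictCLM_coeFn ℂ C.Γ u

lemma inner_cellExtend_left (w : L2per C.Γ) (u : L2 d) :
    ⟪C.cellExtend w, u⟫_ℂ = ⟪w, C.cellRestrict u⟫_ℂ := by
  rw [L2.inner_def, L2.inner_def]
  rw [← integral_indicator C.unitCell.measurableSet]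
  have h1 : ∀ᵐ x : Pos d, x ∈ C.Γ → C.cellRestrict u x = u x :=
    (ae_restrict_iff' C.unitCell.measurableSet).1 (C.coeFn_cellRestrict u)
  refine integral_congr_ae ?_
  filter_upwards [C.coeFn_cellExtend w, h1] with x hx1 hx2
  rw [hx1]
  by_cases hx : x ∈ C.Γ
  · rw [Set.indicator_of_mem hx, Set.indicator_of_mem hx, hx2 hx]
  · rw [Set.indicator_of_notMem hx, Set.indicator_of_notMem hx, inner_zero_left]

/-- The restriction of `u(· + ℓ)` to the unit cell. -/
def cellAt (ℓ : Pos d) : L2 d →L[ℂ] L2per C.Γ :=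
  C.cellRestrict.comp (translateₗᵢ (-ℓ)).toContinuousLinearMap

lemma cellAt_apply (ℓ : Pos d) (u : L2 d) : C.cellAt ℓ u = C.cellRestrict (translate (-ℓ) u) := rfl

lemma coeFn_cellAt (ℓ : Pos d) (u : L2 d) :
    C.cellAt ℓ u =ᵐ[volume.restrict C.Γ] fun x => u (x + ℓ) := by
  filter_upwards [C.coeFn_cellRestrict (translate (-ℓ) u),
    ae_restrict_of_ae (coeFn_translate (-ℓ) u)] with x h1 h2
  rw [cellAt_apply, h1, h2, sub_neg_eq_add]

lemma cellAt_translate (ℓ m : Pos d) (u : L2 d) :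
    C.cellAt ℓ (translate m u) = C.cellAt (ℓ - m) u := by
  rw [cellAt_apply, translate_translate, cellAt_apply]
  congr 2
  abel

/-- The function supported in the cell `Γ + ℓ` with prescribed values. -/
def cellEmbed (ℓ : Pos d) : L2per C.Γ →ₗᵢ[ℂ] L2 d := (translateₗᵢ ℓ).comp C.cellExtend

lemma cellEmbed_apply (ℓ : Pos d) (w : L2per C.Γ) :
    C.cellEmbed ℓ w = translate ℓ (C.cellExtend w) := rfl

lemma inner_cellEmbed_left (ℓ : Pos d) (w : L2per C.Γ) (u : L2 d) :
    ⟪C.cellEmbed ℓ w, u⟫_ℂ = ⟪w, C.cellAt ℓ u⟫_ℂ := by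
  rw [cellEmbed_apply, inner_translate_left, inner_cellExtend_left, cellAt_apply]

lemma cellAt_cellEmbed (ℓ m : C.L) (w : L2per C.Γ) :
    C.cellAt ℓ (C.cellEmbed m w) = if ℓ = m then w else 0 := by
  rw [cellEmbed_apply, cellAt_translate]
  refine Lp.ext ?_
  have h1 : ∀ᵐ x ∂(volume.restrict C.Γ), C.cellExtend w (x + (ℓ - m : Pos d)) =
      C.Γ.indicator w (x + (ℓ - m : Pos d)) :=
    ae_restrict_of_ae (ae_comp_add (C.coeFn_cellExtend w) _)
  filter_upwards [C.coeFn_cellAt (ℓ - m) (C.cellExtend w), h1,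
    ae_restrict_mem C.unitCell.measurableSet,
    Lp.coeFn_zero ℂ 2 ((volume : Measure (Pos d)).restrict C.Γ)] with x h2 h3 hx h0
  rw [h2, h3]
  split_ifs with h
  · rw [h, sub_self, add_zero, Set.indicator_of_mem hx]
  · rw [h0, Pi.zero_apply, Set.indicator_of_notMem]
    intro hx'
    refine h (Subtype.ext ?_)
    have := C.unitCell.eq_of_sub_mem hx' hx
      (by rw [add_sub_cancel_left]; exact C.L.sub_mem ℓ.2 m.2)
    rwa [add_eq_left, sub_eq_zero] at this

lemma eq_zero_of_cellAt {u : L2 d} (h : ∀ ℓ : C.L, C.cellAt ℓ u = 0) : u = 0 := by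
  have h1 : ∫⁻ x, ‖u x‖ₑ ^ 2 = 0 := by
    rw [C.unitCell.setLIntegral_eq_of_periodic, ENNReal.tsum_eq_zero]
    intro ℓ
    have h2 := lintegral_enorm_sq_eq (C.cellAt ℓ u)
    rw [h ℓ, enorm_zero, ← h ℓ] at h2
    have h3 : ∫⁻ x in C.Γ, ‖u (x + ℓ)‖ₑ ^ 2 = ∫⁻ x in C.Γ, ‖C.cellAt ℓ u x‖ₑ ^ 2 :=
      lintegral_congr_ae ((C.coeFn_cellAt ℓ u).mono fun a ha => by simp only [ha])
    rw [h3, h2]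
    simp
  rw [lintegral_enorm_sq_eq] at h1
  simpa using h1

/-- Distinct cells are disjoint, and a function orthogonal to everything supported in one cell
vanishes on each cell. -/
lemma isHilbertSum_cellEmbed :
    IsHilbertSum ℂ (fun _ : C.L => L2per C.Γ) fun ℓ => C.cellEmbed (ℓ : Pos d) := by
  refine IsHilbertSum.mk ?_ ?_
  · intro ℓ m hℓm v w
    rw [inner_cellEmbed_left, cellAt_cellEmbed, if_neg hℓm, inner_zero_right]
  · rw [top_le_iff, Submodule.topologicalClosure_eq_top_iff, Submodule.eq_bot_iff]
    intro u hu
    refine C.eq_zero_of_cellAt fun ℓ => ?_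
    rw [← inner_self_eq_zero (𝕜 := ℂ), ← inner_cellEmbed_left]
    refine (Submodule.mem_orthogonal _ _).1 hu _ ?_
    exact Submodule.mem_iSup_of_mem ℓ ⟨_, rfl⟩

lemma linearIsometryEquiv_cellEmbed_apply (u : L2 d) :
    ∀ ℓ : C.L, (C.isHilbertSum_cellEmbed.linearIsometryEquiv u : C.L → L2per C.Γ) ℓ
      = C.cellAt ℓ u := by
  intro ℓ
  have h := C.isHilbertSum_cellEmbed.hasSum_linearIsometryEquiv_symm
    (C.isHilbertSum_cellEmbed.linearIsometryEquiv u)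
  rw [LinearIsometryEquiv.symm_apply_apply] at h
  have h2 := h.mapL (C.cellAt ℓ)
  simp only [cellAt_cellEmbed] at h2
  refine (h2.unique ?_).symm
  convert hasSum_ite_eq ℓ ((C.isHilbertSum_cellEmbed.linearIsometryEquiv u : C.L → L2per C.Γ) ℓ)
    using 2 with m
  by_cases hm : m = ℓ
  · subst hm; simp
  · rw [if_neg hm, if_neg (Ne.symm hm)]

end Crystal


/-! ### The Bloch transform as a unitary operator -/

namespace Crystal

variable {d : ℕ} (C : Crystal d)

/-- The Hilbert space of square integrable fields of periodic functions over the zone. -/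
abbrev Fiber : Type := Lp (L2per C.Γ) 2 C.zoneMeasure

/-- Multiplication by the plane wave `e^{-i k·x}`. -/
def waveMul (k : Pos d) : L2per C.Γ →ₗᵢ[ℂ] L2per C.Γ :=
  unimodularMul (planeWave k) (continuous_planeWave_right k).aestronglyMeasurable
    (norm_planeWave k)

lemma coeFn_waveMul (k : Pos d) (w : L2per C.Γ) :
    C.waveMul k w =ᵐ[volume.restrict C.Γ] fun x => planeWave k x * w x :=
  coeFn_unimodularMul _ _ _ w

lemma inner_waveMul_left (k : Pos d) (v w : L2per C.Γ) :
    ⟪C.waveMul k v, w⟫_ℂ = ⟪v, C.waveMul (-k) w⟫_ℂ := by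
  rw [L2.inner_def, L2.inner_def]
  refine integral_congr_ae ?_
  filter_upwards [C.coeFn_waveMul k v, C.coeFn_waveMul (-k) w] with x h1 h2
  have h3 : planeWave (-k) x = conj (planeWave k x) := by
    rw [conj_planeWave, planeWave, planeWave, inner_neg_left, inner_neg_right]
  rw [h1, h2, h3]
  simp only [RCLike.inner_apply, map_mul]
  ring

lemma continuous_waveMul (w : L2per C.Γ) : Continuous fun k => C.waveMul k w := by
  rw [continuous_iff_continuousAt]
  intro k₀
  refine tendsto_toLp_of_dominated (g := fun x => ‖w x‖)
    (fun k => memLp_unimodular_smul (continuous_planeWave_right k).aestronglyMeasurable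
      (norm_planeWave k) w)
    (memLp_unimodular_smul (continuous_planeWave_right k₀).aestronglyMeasurable
      (norm_planeWave k₀) w) (Lp.memLp w).norm ?_ ?_ ?_
  · exact Eventually.of_forall fun k => ae_of_all _ fun x => by
      rw [norm_smul, norm_planeWave, one_mul]
  · exact ae_of_all _ fun x => by rw [norm_smul, norm_planeWave, one_mul]
  · exact ae_of_all _ fun x =>
      ((continuous_planeWave_left x).tendsto k₀).smul tendsto_const_nhds

lemma memLp_waveMul (w : L2per C.Γ) : MemLp (fun k => C.waveMul k w) 2 C.zoneMeasure :=
  MemLp.of_bound (C.continuous_waveMul w).aestronglyMeasurable ‖w‖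
    (ae_of_all _ fun k => ((C.waveMul k).norm_map w).le)

/-- The field `k ↦ e^{-i k·x} w(x)`. -/
def fiberBase : L2per C.Γ →ₗᵢ[ℂ] C.Fiber where
  toFun w := (C.memLp_waveMul w).toLp _
  map_add' v w := by
    rw [← MemLp.toLp_add]
    exact MemLp.toLp_congr _ _ (ae_of_all _ fun k => by simp)
  map_smul' a w := by
    rw [RingHom.id_apply, ← MemLp.toLp_const_smul]
    exact MemLp.toLp_congr _ _ (ae_of_all _ fun k => by simp)
  norm_map' w := by
    change ‖(C.memLp_waveMul w).toLp _‖ = _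
    rw [Lp.norm_toLp, eLpNorm_congr_norm_ae (g := fun _ => w)
      (ae_of_all _ fun k => (C.waveMul k).norm_map w), eLpNorm_const _ (by simp)
      (IsProbabilityMeasure.ne_zero _)]
    simp

lemma coeFn_fiberBase (w : L2per C.Γ) :
    C.fiberBase w =ᵐ[C.zoneMeasure] fun k => C.waveMul k w :=
  (C.memLp_waveMul w).coeFn_toLp

/-- Multiplication of fields by the character `k ↦ e^{-i k·m}`. -/
def charMul (m : Pos d) : C.Fiber →ₗᵢ[ℂ] C.Fiber :=
  unimodularMul (fun k => planeWave k m) (continuous_planeWave_left m).aestronglyMeasurable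
    (fun k => norm_planeWave k m)

lemma coeFn_charMul (m : Pos d) (F : C.Fiber) :
    C.charMul m F =ᵐ[C.zoneMeasure] fun k => planeWave k m • F k :=
  coeFn_unimodularMul _ _ _ F

lemma charMul_charMul (ℓ m : Pos d) (F : C.Fiber) :
    C.charMul ℓ (C.charMul m F) = C.charMul (ℓ + m) F := by
  refine Lp.ext ?_
  filter_upwards [C.coeFn_charMul ℓ (C.charMul m F), C.coeFn_charMul m F,
    C.coeFn_charMul (ℓ + m) F] with k h1 h2 h3
  rw [h1, h2, h3, planeWave_add, smul_smul]

/-- The field `k ↦ e^{-i k·(x + ℓ)} w(x)`. -/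
def fiberEmbed (ℓ : Pos d) : L2per C.Γ →ₗᵢ[ℂ] C.Fiber := (C.charMul ℓ).comp C.fiberBase

lemma fiberEmbed_apply (ℓ : Pos d) (w : L2per C.Γ) :
    C.fiberEmbed ℓ w = C.charMul ℓ (C.fiberBase w) := rfl

lemma coeFn_fiberEmbed (ℓ : Pos d) (w : L2per C.Γ) :
    C.fiberEmbed ℓ w =ᵐ[C.zoneMeasure] fun k => planeWave k ℓ • C.waveMul k w := by
  filter_upwards [C.coeFn_charMul ℓ (C.fiberBase w), C.coeFn_fiberBase w] with k h1 h2
  rw [fiberEmbed_apply, h1, h2]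

/-- Orthogonality comes from the vanishing zone averages of nontrivial characters. For completeness,
if `F` is orthogonal to all summands then, for fixed `w`, the function `k ↦ ⟨w, e^{ik·x} F_k⟩` has
no Fourier coefficients and vanishes almost everywhere; `ae_eq_zero_of_forall_inner` makes the null
set independent of `w`. -/
lemma isHilbertSum_fiberEmbed :
    IsHilbertSum ℂ (fun _ : C.L => L2per C.Γ) fun ℓ => C.fiberEmbed (ℓ : Pos d) := by
  refine IsHilbertSum.mk ?_ ?_
  · intro ℓ m hℓm v w
    rw [L2.inner_def]
    have h : ∀ᵐ k ∂C.zoneMeasure, ⟪C.fiberEmbed ℓ v k, C.fiberEmbed m w k⟫_ℂ =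
        planeWave k (m - ℓ) * ⟪v, w⟫_ℂ := by
      filter_upwards [C.coeFn_fiberEmbed ℓ v, C.coeFn_fiberEmbed m w] with k h1 h2
      rw [h1, h2, inner_smul_left, inner_smul_right, (C.waveMul k).inner_map_map, conj_planeWave,
        ← mul_assoc, ← planeWave_add, neg_add_eq_sub]
    rw [integral_congr_ae h, integral_mul_const,
      C.integral_planeWave_of_ne_zero (C.L.sub_mem m.2 ℓ.2), zero_mul]
    rw [sub_ne_zero]
    exact fun h => hℓm (Subtype.ext h.symm)
  · rw [top_le_iff, Submodule.topologicalClosure_eq_top_iff, Submodule.eq_bot_iff]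
    intro F hF
    have h1 : ∀ (m : C.L) (w : L2per C.Γ), ⟪C.fiberEmbed m w, F⟫_ℂ = 0 := fun m w =>
      (Submodule.mem_orthogonal _ _).1 hF _ (Submodule.mem_iSup_of_mem m ⟨_, rfl⟩)
    have h2 : ∀ w : L2per C.Γ, (fun k => ⟪w, C.waveMul (-k) (F k)⟫_ℂ) =ᵐ[C.zoneMeasure] 0 := by
      intro w
      have hmem : MemLp (fun k => ⟪C.waveMul k w, F k⟫_ℂ) 2 C.zoneMeasure := by
        refine (Lp.memLp F).of_le_mul (c := ‖w‖)
          ((C.continuous_waveMul w).aestronglyMeasurable.inner (Lp.aestronglyMeasurable F))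
          (ae_of_all _ fun k => ?_)
        refine (norm_inner_le_norm _ _).trans ?_
        rw [(C.waveMul k).norm_map]
      have := C.ae_eq_zero_of_fourier hmem fun m hm => by
        rw [← h1 ⟨m, hm⟩ w, L2.inner_def]
        refine integral_congr_ae ?_
        filter_upwards [C.coeFn_fiberEmbed m w] with k hk
        rw [hk, inner_smul_left]
      filter_upwards [this] with k hk
      rw [← inner_waveMul_left, hk]
    have : Fact ((2 : ℝ≥0∞) ≠ ⊤) := ⟨by simp⟩
    have h3 := ae_eq_zero_of_forall_inner h2
    rw [Lp.eq_zero_iff_ae_eq_zero]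
    filter_upwards [h3] with k hk
    rw [Pi.zero_apply] at hk ⊢
    rw [← norm_eq_zero, ← (C.waveMul (-k)).norm_map, hk, norm_zero]

/-- The Bloch transform. -/
def bloch : L2 d ≃ₗᵢ[ℂ] C.Fiber :=
  C.isHilbertSum_cellEmbed.linearIsometryEquiv.trans
    C.isHilbertSum_fiberEmbed.linearIsometryEquiv.symm

/-- The unitary `bloch` matches two Hilbert sums indexed by the lattice, one over cells and one over
characters; written out, it is the series defining the Bloch transform. -/
lemma hasSum_bloch (u : L2 d) :
    HasSum (fun ℓ : C.L => C.fiberEmbed ℓ (C.cellAt ℓ u)) (C.bloch u) := by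
  have h := C.isHilbertSum_fiberEmbed.hasSum_linearIsometryEquiv_symm
    (C.isHilbertSum_cellEmbed.linearIsometryEquiv u)
  simp only [linearIsometryEquiv_cellEmbed_apply] at h
  exact h

lemma bloch_translate {m : Pos d} (hm : m ∈ C.L) (u : L2 d) :
    C.bloch (translate m u) = C.charMul m (C.bloch u) := by
  have h1 := (C.hasSum_bloch u).mapL (C.charMul m).toContinuousLinearMap
  have h2 := C.hasSum_bloch (translate m u)
  rw [← (Equiv.addRight (⟨m, hm⟩ : C.L)).hasSum_iff] at h2
  refine h2.unique ?_
  refine h1.congr_fun fun ℓ => ?_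
  simp only [Function.comp_apply, Equiv.coe_addRight, Submodule.coe_add, cellAt_translate,
    add_sub_cancel_right, LinearIsometry.coe_toContinuousLinearMap, fiberEmbed_apply,
    charMul_charMul, add_comm m]

/-- The partial sums of the Bloch transform. -/
def blochSum (u : L2 d) (F : Finset C.L) : C.Fiber :=
  ∑ ℓ ∈ F, C.fiberEmbed ℓ (C.cellAt ℓ u)

lemma coeFn_blochSum (u : L2 d) (F : Finset C.L) :
    ∀ᵐ k ∂C.zoneMeasure, C.blochSum u F k =ᵐ[volume.restrict C.Γ] fun x =>
      ∑ ℓ ∈ F, u (x + (ℓ : Pos d)) * planeWave k (x + (ℓ : Pos d)) := by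
  have h1 : ∀ᵐ k ∂C.zoneMeasure, ∀ ℓ : C.L, C.fiberEmbed ℓ (C.cellAt ℓ u) k =
      planeWave k ℓ • C.waveMul k (C.cellAt ℓ u) := ae_all_iff.2 fun ℓ => C.coeFn_fiberEmbed _ _
  filter_upwards [Lp.coeFn_finset_sum F fun ℓ : C.L => C.fiberEmbed ℓ (C.cellAt ℓ u), h1]
    with k hk h1k
  have h2 : ∀ᵐ x ∂(volume.restrict C.Γ), ∀ ℓ : C.L,
      (C.fiberEmbed ℓ (C.cellAt ℓ u) k) x = u (x + ℓ) * planeWave k (x + ℓ) := by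
    refine ae_all_iff.2 fun ℓ => ?_
    rw [h1k ℓ]
    filter_upwards [Lp.coeFn_smul (planeWave k ℓ) (C.waveMul k (C.cellAt ℓ u)),
      C.coeFn_waveMul k (C.cellAt ℓ u), C.coeFn_cellAt ℓ u] with x hx1 hx2 hx3
    rw [hx1, Pi.smul_apply, hx2, hx3, planeWave_add, smul_eq_mul]
    ring
  filter_upwards [Lp.coeFn_finset_sum F fun ℓ : C.L => C.fiberEmbed ℓ (C.cellAt ℓ u) k, h2]
    with x hx1 hx2
  rw [blochSum, hk, hx1]
  exact Finset.sum_congr rfl fun ℓ _ => hx2 ℓ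

/-- The inner integral is the squared norm in the fibre, and normalizing the zone measure only
divides by the volume of `Γ*`, which is finite and nonzero. -/
lemma isBlochTransform_iff_tendsto (u : L2 d) (v : Pos d → L2per C.Γ) :
    C.IsBlochTransform u v ↔ AEStronglyMeasurable v C.zoneMeasure ∧
      Tendsto (fun F : Finset C.L => ∫⁻ k, ‖v k - C.blochSum u F k‖ₑ ^ 2 ∂C.zoneMeasure)
        atTop (𝓝 0) := by
  have hm : AEStronglyMeasurable v (volume.restrict C.Γs) ↔
      AEStronglyMeasurable v C.zoneMeasure :=
    ⟨fun h => h.mono_ac C.zoneMeasure_ac, fun h => h.mono_ac C.ac_zoneMeasure⟩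
  rw [IsBlochTransform, hm]
  refine and_congr_right fun _ => ?_
  have key : ∀ F : Finset C.L, ∫⁻ k in C.Γs, ∫⁻ x in C.Γ,
      ‖v k x - ∑ ℓ ∈ F, u (x + (ℓ : Pos d)) *
          Complex.exp (-Complex.I * (⟪k, x + (ℓ : Pos d)⟫_ℝ : ℝ))‖ₑ ^ 2 =
      volume C.Γs * ∫⁻ k, ‖v k - C.blochSum u F k‖ₑ ^ 2 ∂C.zoneMeasure := by
    intro F
    rw [restrict_eq_smul_zoneMeasure, lintegral_smul_measure, smul_eq_mul]
    congr 1
    refine lintegral_congr_ae ((C.coeFn_blochSum u F).mono fun k hk => ?_)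
    simp only
    rw [← lintegral_enorm_sq_eq]
    refine lintegral_congr_ae ?_
    filter_upwards [hk, Lp.coeFn_sub (v k) (C.blochSum u F k)] with x hx1 hx2
    rw [hx2, Pi.sub_apply, hx1]
    rfl
  simp only [key]
  constructor
  · intro h
    have := ENNReal.Tendsto.const_mul (a := (volume C.Γs)⁻¹) h
      (Or.inr (by simpa using C.unitCell_dual.volume_ne_zero))
    simpa only [mul_zero, ← mul_assoc, ENNReal.inv_mul_cancel C.unitCell_dual.volume_ne_zero
      C.unitCell_dual.volume_ne_top, one_mul] using this
  · intro h
    have := ENNReal.Tendsto.const_mul (a := volume C.Γs) h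
      (Or.inr C.unitCell_dual.volume_ne_top)
    simpa only [mul_zero] using this

lemma isBlochTransform_bloch (u : L2 d) : C.IsBlochTransform u (C.bloch u) := by
  rw [isBlochTransform_iff_tendsto]
  refine ⟨Lp.aestronglyMeasurable _, ?_⟩
  have h : Tendsto (fun F : Finset C.L => ‖C.bloch u - C.blochSum u F‖ₑ ^ 2) atTop (𝓝 0) := by
    have h1 : Tendsto (fun F => C.bloch u - C.blochSum u F) atTop (𝓝 (C.bloch u - C.bloch u)) :=
      tendsto_const_nhds.sub (C.hasSum_bloch u)
    rw [sub_self] at h1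
    have h2 := h1.enorm
    rw [enorm_zero] at h2
    simpa using h2.ennrpow_const 2
  refine h.congr fun F => ?_
  rw [← lintegral_enorm_sq_eq]
  refine lintegral_congr_ae ((Lp.coeFn_sub (C.bloch u) (C.blochSum u F)).mono fun k hk => ?_)
  simp only [hk, Pi.sub_apply]

/-- Uniqueness of limits, argued with lower integrals because `v` is only known to be measurable and
not to be square integrable. -/
lemma IsBlochTransform.ae_eq {u : L2 d} {v : Pos d → L2per C.Γ} (h : C.IsBlochTransform u v) :
    v =ᵐ[C.zoneMeasure] C.bloch u := by
  obtain ⟨hv, h1⟩ := (C.isBlochTransform_iff_tendsto u v).1 h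
  obtain ⟨-, h2⟩ := (C.isBlochTransform_iff_tendsto u _).1 (C.isBlochTransform_bloch u)
  have hmeas : ∀ G : C.Fiber, AEMeasurable (fun k => ‖v k - G k‖ₑ ^ 2) C.zoneMeasure := fun G =>
    (hv.sub (Lp.aestronglyMeasurable G)).enorm.pow_const 2
  have hle : ∀ F : Finset C.L, ∫⁻ k, ‖v k - C.bloch u k‖ₑ ^ 2 ∂C.zoneMeasure ≤
      2 * ∫⁻ k, ‖v k - C.blochSum u F k‖ₑ ^ 2 ∂C.zoneMeasure +
      2 * ∫⁻ k, ‖C.bloch u k - C.blochSum u F k‖ₑ ^ 2 ∂C.zoneMeasure := by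
    intro F
    rw [← lintegral_const_mul' _ _ (by simp), ← lintegral_const_mul' _ _ (by simp),
      ← lintegral_add_left' ((hmeas (C.blochSum u F)).const_mul 2)]
    refine lintegral_mono fun k => ?_
    have : v k - C.bloch u k = (v k - C.blochSum u F k) - (C.bloch u k - C.blochSum u F k) := by
      abel
    rw [this, ← mul_add]
    refine (pow_le_pow_left' enorm_sub_le 2).trans ?_
    have h := ENNReal.rpow_add_le_mul_rpow_add_rpow ‖v k - C.blochSum u F k‖ₑ
      ‖C.bloch u k - C.blochSum u F k‖ₑ (p := 2) (by norm_num)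
    rw [show (2 : ℝ) - 1 = 1 by norm_num, ENNReal.rpow_one] at h
    simpa using h
  have hlim := (ENNReal.Tendsto.const_mul (a := 2) h1 (Or.inr (by simp))).add
    (ENNReal.Tendsto.const_mul (a := 2) h2 (Or.inr (by simp)))
  rw [mul_zero, add_zero] at hlim
  have h0 : ∫⁻ k, ‖v k - C.bloch u k‖ₑ ^ 2 ∂C.zoneMeasure = 0 :=
    le_antisymm (ge_of_tendsto' hlim hle) bot_le
  rw [lintegral_eq_zero_iff' (hmeas (C.bloch u))] at h0
  filter_upwards [h0] with k hk
  simpa [sub_eq_zero] using hk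

end Crystal


/-! ### Bounded Bloch fields -/

lemma Lp.ae_norm_le_of_top {α E : Type*} [MeasurableSpace α] {ν : Measure α}
    [NormedAddCommGroup E] (f : Lp E ⊤ ν) : ∀ᵐ x ∂ν, ‖f x‖ ≤ ‖f‖ := by
  have h := ae_le_eLpNormEssSup (f := f) (μ := ν)
  filter_upwards [h] with x hx
  rw [← eLpNorm_exponent_top, ← Lp.enorm_def] at hx
  exact enorm_le_iff_norm_le.1 hx

namespace Crystal

variable {d : ℕ} (C : Crystal d)

/-- `u` belongs to the Wiener amalgam space `W(L², ℓ¹)` over the lattice. -/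
def IsAmalgam (u : L2 d) : Prop := Summable fun ℓ : C.L => ‖C.cellAt ℓ u‖

variable {C}

/-- The terms of the Bloch series have norms `‖cellAt ℓ u‖`, independent of `k`, so their
summability gives absolute convergence in every fibre and, below, a bound uniform in `k`. -/
lemma IsAmalgam.ae_hasSum {u : L2 d} (hu : C.IsAmalgam u) : ∀ᵐ k ∂C.zoneMeasure,
    HasSum (fun ℓ : C.L => planeWave k ℓ • C.waveMul k (C.cellAt ℓ u)) (C.bloch u k) := by
  have hn : ∀ k (ℓ : C.L), ‖planeWave k ℓ • C.waveMul k (C.cellAt ℓ u)‖ = ‖C.cellAt ℓ u‖ :=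
    fun k ℓ => by rw [norm_smul, norm_planeWave, one_mul, (C.waveMul k).norm_map]
  have hs : ∀ k, Summable fun ℓ : C.L => planeWave k ℓ • C.waveMul k (C.cellAt ℓ u) := fun k =>
    Summable.of_norm (by simp only [hn]; exact hu)
  have h1 : ∀ᵐ k ∂C.zoneMeasure, ∀ ℓ : C.L, C.fiberEmbed ℓ (C.cellAt ℓ u) k =
      planeWave k ℓ • C.waveMul k (C.cellAt ℓ u) := ae_all_iff.2 fun ℓ => C.coeFn_fiberEmbed _ _
  have h2 := ae_eq_of_hasSum (C.hasSum_bloch u)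
    (g := fun k => ∑' ℓ : C.L, planeWave k ℓ • C.waveMul k (C.cellAt ℓ u))
    (h1.mono fun k hk => by simpa only [hk] using (hs k).hasSum)
  filter_upwards [h2] with k hk
  rw [hk]
  exact (hs k).hasSum

lemma IsAmalgam.ae_norm_le {u : L2 d} (hu : C.IsAmalgam u) :
    ∀ᵐ k ∂C.zoneMeasure, ‖C.bloch u k‖ ≤ ∑' ℓ : C.L, ‖C.cellAt ℓ u‖ := by
  filter_upwards [hu.ae_hasSum] with k hk
  refine hk.norm_le_of_bounded hu.hasSum fun ℓ => ?_
  rw [norm_smul, norm_planeWave, one_mul, (C.waveMul k).norm_map]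

lemma IsAmalgam.memLp_top {u : L2 d} (hu : C.IsAmalgam u) :
    MemLp (C.bloch u) ⊤ C.zoneMeasure :=
  memLp_top_of_bound (Lp.aestronglyMeasurable _) _ hu.ae_norm_le

lemma IsAmalgam.sub {u v : L2 d} (hu : C.IsAmalgam u) (hv : C.IsAmalgam v) :
    C.IsAmalgam (u - v) := by
  refine Summable.of_nonneg_of_le (fun _ => norm_nonneg _) (fun ℓ => ?_) (hu.add hv)
  rw [map_sub]
  exact norm_sub_le _ _

variable (C)

/-- The bounded fields of periodic functions over the zone. -/
abbrev BddFiber : Type := Lp (L2per C.Γ) ⊤ C.zoneMeasure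

variable {C}

/-- The Bloch transform of a function of the amalgam space, as a bounded field. -/
def IsAmalgam.field {u : L2 d} (hu : C.IsAmalgam u) : C.BddFiber := hu.memLp_top.toLp _

lemma IsAmalgam.coeFn_field {u : L2 d} (hu : C.IsAmalgam u) :
    hu.field =ᵐ[C.zoneMeasure] C.bloch u := hu.memLp_top.coeFn_toLp

lemma IsAmalgam.norm_field_sub_le {u v : L2 d} (hu : C.IsAmalgam u) (hv : C.IsAmalgam v) :
    ‖hu.field - hv.field‖ ≤ ∑' ℓ : C.L, ‖C.cellAt ℓ (u - v)‖ := by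
  have h0 : 0 ≤ ∑' ℓ : C.L, ‖C.cellAt ℓ (u - v)‖ := tsum_nonneg fun _ => norm_nonneg _
  refine (Lp.norm_le_of_ae_bound (f := hu.field - hv.field) h0 ?_).trans ?_
  · filter_upwards [(hu.sub hv).ae_norm_le, hu.coeFn_field, hv.coeFn_field,
      Lp.coeFn_sub hu.field hv.field, Lp.coeFn_sub (C.bloch u) (C.bloch v)] with k h1 h2 h3 h4 h5
    rw [h4, Pi.sub_apply, h2, h3, ← Pi.sub_apply, ← h5, ← map_sub]
    exact h1
  · simp

/-- The supremum norm over `k` is controlled by the sum of the cell norms, to which dominated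
convergence over the lattice applies. Continuity in `L²` gives only the convergence of each term. -/
lemma continuousAt_field {X : Type*} [TopologicalSpace X] {u : X → L2 d}
    (hu : ∀ x, C.IsAmalgam (u x)) {x₀ : X} (hc : ContinuousAt u x₀) {b : C.L → ℝ}
    (hb : Summable b) (hle : ∀ᶠ x in 𝓝 x₀, ∀ ℓ : C.L, ‖C.cellAt ℓ (u x)‖ ≤ b ℓ) :
    ContinuousAt (fun x => (hu x).field) x₀ := by
  rw [ContinuousAt, tendsto_iff_norm_sub_tendsto_zero]
  have h0 : ∀ ℓ : C.L, ‖C.cellAt ℓ (u x₀)‖ ≤ b ℓ := hle.self_of_nhds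
  refine squeeze_zero (fun _ => norm_nonneg _) (fun x => (hu x).norm_field_sub_le (hu x₀)) ?_
  have := tendsto_tsum_of_dominated_convergence (𝓕 := 𝓝 x₀)
    (f := fun x (ℓ : C.L) => ‖C.cellAt ℓ (u x - u x₀)‖) (g := fun _ => 0)
    (bound := fun ℓ => b ℓ + b ℓ) (hb.add hb) (fun ℓ => ?_) ?_
  · simpa using this
  · have h1 : ContinuousAt (fun x => ‖C.cellAt ℓ (u x - u x₀)‖) x₀ :=
      ((C.cellAt ℓ).continuous.continuousAt.comp (hc.sub continuousAt_const)).norm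
    simpa [ContinuousAt] using h1
  · filter_upwards [hle] with x hx ℓ
    rw [norm_norm, map_sub]
    exact (norm_sub_le _ _).trans (add_le_add (hx ℓ) (h0 ℓ))

/-! ### Decaying functions belong to the amalgam space -/

variable (C)

/-- Almost every point of `Γ` has norm at most the covering radius, so on `Γ + ℓ` the weight is
comparable with its value at `ℓ`. -/
lemma exists_cellAt_bound : ∃ B : ℝ, 0 ≤ B ∧ ∀ (u : L2 d) (M : ℝ),
    (∀ᵐ y : Pos d, ‖u y‖ ≤ M * decayWeight y) → ∀ ℓ : C.L, ‖C.cellAt ℓ u‖ ≤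
      B * M * decayWeight (ℓ : Pos d) := by
  obtain ⟨ρ, hρ, hρL⟩ := exists_covering_radius C.L
  refine ⟨(measureUnivNNReal ((volume : Measure (Pos d)).restrict C.Γ)) ^ ((2 : ℝ≥0∞).toReal⁻¹) *
    (1 + ρ) ^ (d + 1), by positivity, fun u M hM ℓ => ?_⟩
  have hM0 : 0 ≤ M := by
    obtain ⟨y, hy⟩ := hM.exists
    exact nonneg_of_mul_nonneg_left ((norm_nonneg _).trans hy) (decayWeight_pos y)
  have h := Lp.norm_le_of_ae_bound (f := C.cellAt ℓ u)
    (C := (1 + ρ) ^ (d + 1) * M * decayWeight (ℓ : Pos d))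
    (mul_nonneg (by positivity) (decayWeight_pos _).le) ?_
  · refine h.trans (le_of_eq ?_)
    ring
  · filter_upwards [C.coeFn_cellAt ℓ u, ae_restrict_of_ae (ae_comp_add hM (ℓ : Pos d)),
      C.unitCell.ae_norm_le hρL] with x h1 h2 h3
    rw [h1]
    refine h2.trans ?_
    calc M * decayWeight (x + (ℓ : Pos d)) ≤ M * ((1 + ‖x‖) ^ (d + 1) * decayWeight (ℓ : Pos d)) := by
          gcongr
          exact decayWeight_add_le x (ℓ : Pos d)
      _ ≤ M * ((1 + ρ) ^ (d + 1) * decayWeight (ℓ : Pos d)) := by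
          gcongr
          exact (decayWeight_pos _).le
      _ = _ := by ring

lemma isAmalgam_of_decay {u : L2 d} {M : ℝ} (hM : ∀ᵐ y : Pos d, ‖u y‖ ≤ M * decayWeight y) :
    C.IsAmalgam u := by
  obtain ⟨B, -, hB⟩ := C.exists_cellAt_bound
  exact Summable.of_nonneg_of_le (fun _ => norm_nonneg _) (hB u M hM)
    ((summable_decayWeight C.L).mul_left _)

/-- The Bloch transform of a decaying function is given by the pointwise series. -/
lemma ae_bloch_eq_tsum {u : L2 d} {M : ℝ} {a : Pos d → ℂ} (hua : u =ᵐ[volume] a)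
    (hM : ∀ y : Pos d, ‖a y‖ ≤ M * decayWeight y) :
    ∀ᵐ k ∂C.zoneMeasure, C.bloch u k =ᵐ[volume.restrict C.Γ] fun x =>
      ∑' ℓ : C.L, a (x + ℓ) * planeWave k (x + ℓ) := by
  have hu : C.IsAmalgam u := C.isAmalgam_of_decay (hua.mono fun y hy => by rw [hy]; exact hM y)
  have hM0 : 0 ≤ M := nonneg_of_mul_nonneg_left ((norm_nonneg _).trans (hM 0)) (decayWeight_pos 0)
  filter_upwards [hu.ae_hasSum] with k hk
  refine ae_eq_of_hasSum hk ?_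
  have h2 : ∀ᵐ x ∂(volume.restrict C.Γ), ∀ ℓ : C.L,
      (planeWave k ℓ • C.waveMul k (C.cellAt ℓ u)) x = a (x + ℓ) * planeWave k (x + ℓ) := by
    refine ae_all_iff.2 fun ℓ => ?_
    filter_upwards [Lp.coeFn_smul (planeWave k ℓ) (C.waveMul k (C.cellAt ℓ u)),
      C.coeFn_waveMul k (C.cellAt ℓ u), C.coeFn_cellAt ℓ u,
      ae_restrict_of_ae (ae_comp_add hua (ℓ : Pos d))] with x hx1 hx2 hx3 hx4
    rw [hx1, Pi.smul_apply, hx2, hx3, hx4, planeWave_add, smul_eq_mul]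
    ring
  filter_upwards [h2] with x hx
  simp only [hx]
  refine Summable.hasSum (Summable.of_norm_bounded
    (((summable_decayWeight C.L).mul_left ((1 + ‖x‖) ^ (d + 1))).mul_left M) fun ℓ => ?_)
  rw [norm_mul, norm_planeWave, mul_one]
  refine (hM _).trans ?_
  gcongr
  exact decayWeight_add_le x (ℓ : Pos d)

/-! ### Operators acting fiberwise -/

/-- The plane wave `k ↦ e^{-i k·m}` as an element of `L²` over the zone. -/
def zoneChar (m : Pos d) : Lp ℂ 2 C.zoneMeasure :=
  MemLp.toLp (fun k => planeWave k m) (MemLp.of_bound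
    (continuous_planeWave_left m).aestronglyMeasurable 1
    (ae_of_all _ fun k => (norm_planeWave k m).le))

lemma coeFn_zoneChar (m : Pos d) : C.zoneChar m =ᵐ[C.zoneMeasure] fun k => planeWave k m :=
  MemLp.coeFn_toLp _

lemma inner_zoneChar_left (m : Pos d) (h : Lp ℂ 2 C.zoneMeasure) :
    ⟪C.zoneChar m, h⟫_ℂ = ∫ k, conj (planeWave k m) * h k ∂C.zoneMeasure := by
  rw [L2.inner_def]
  refine integral_congr_ae ?_
  filter_upwards [C.coeFn_zoneChar m] with k hk
  rw [hk, RCLike.inner_apply, mul_comm]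

lemma span_zoneChar_closure_eq_top :
    (Submodule.span ℂ (Set.range fun m : C.L => C.zoneChar m)).topologicalClosure = ⊤ := by
  rw [Submodule.topologicalClosure_eq_top_iff, Submodule.eq_bot_iff]
  intro h hh
  rw [Lp.eq_zero_iff_ae_eq_zero]
  refine C.ae_eq_zero_of_fourier (Lp.memLp h) fun m hm => ?_
  rw [← inner_zoneChar_left]
  exact (Submodule.mem_orthogonal _ _).1 hh _ (Submodule.subset_span ⟨⟨m, hm⟩, rfl⟩)

lemma ext_zoneChar {F : Type*} [NormedAddCommGroup F] [NormedSpace ℂ F]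
    {A B : Lp ℂ 2 C.zoneMeasure →L[ℂ] F} (h : ∀ m : C.L, A (C.zoneChar m) = B (C.zoneChar m)) :
    A = B :=
  ContinuousLinearMap.ext_on (s := Set.range fun m : C.L => C.zoneChar m)
    (Submodule.dense_iff_topologicalClosure_eq_top.2 C.span_zoneChar_closure_eq_top)
    (by rintro _ ⟨m, rfl⟩; exact h m)

/-- `β ↦ u`, where `u` has the Bloch transform `k ↦ β(k) a(k)`; depends linearly on the bounded
field `a`. -/
def synth : C.BddFiber →L[ℂ] (Lp ℂ 2 C.zoneMeasure →L[ℂ] L2 d) :=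
  (ContinuousLinearMap.compL ℂ (Lp ℂ 2 C.zoneMeasure) C.Fiber (L2 d)
    (C.bloch.symm.toContinuousLinearEquiv : C.Fiber →L[ℂ] L2 d)).comp
  ((ContinuousLinearMap.lsmul ℂ ℂ).holderL C.zoneMeasure 2 ⊤ 2).flip

lemma bloch_synth (a : C.BddFiber) (β : Lp ℂ 2 C.zoneMeasure) :
    C.bloch (C.synth a β) =ᵐ[C.zoneMeasure] fun k => β k • a k := by
  have : C.bloch (C.synth a β) = (ContinuousLinearMap.lsmul ℂ ℂ).holder 2 β a := by
    simp [synth]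
  rw [this]
  exact ContinuousLinearMap.coeFn_holder _ β a

lemma coeFn_adjoint_synth (a : C.BddFiber) (φ : L2 d) :
    (C.synth a).adjoint φ =ᵐ[C.zoneMeasure] fun k => ⟪a k, C.bloch φ k⟫_ℂ := by
  have hmem : MemLp (fun k => ⟪a k, C.bloch φ k⟫_ℂ) 2 C.zoneMeasure := by
    refine (Lp.memLp (C.bloch φ)).of_le_mul (c := ‖a‖)
      ((Lp.aestronglyMeasurable a).inner (Lp.aestronglyMeasurable _)) ?_
    filter_upwards [Lp.ae_norm_le_of_top a] with k hk
    exact (norm_inner_le_norm _ _).trans (mul_le_mul_of_nonneg_right hk (norm_nonneg _))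
  have : (C.synth a).adjoint φ = hmem.toLp _ := by
    refine ext_inner_left ℂ fun β => ?_
    rw [ContinuousLinearMap.adjoint_inner_right, ← C.bloch.inner_map_map, L2.inner_def,
      L2.inner_def]
    refine integral_congr_ae ?_
    filter_upwards [C.bloch_synth a β, hmem.coeFn_toLp] with k h1 h2
    rw [h1, h2, inner_smul_left, RCLike.inner_apply, mul_comm]
  rw [this]
  exact hmem.coeFn_toLp

/-- The operator with the Bloch fibers `|a(k)⟩⟨b(k)|`. -/
def fiberOp (a b : C.BddFiber) : L2 d →L[ℂ] L2 d := (C.synth a).comp (C.synth b).adjoint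

lemma bloch_fiberOp (a b : C.BddFiber) (φ : L2 d) :
    C.bloch (C.fiberOp a b φ) =ᵐ[C.zoneMeasure] fun k => ⟪b k, C.bloch φ k⟫_ℂ • a k := by
  filter_upwards [C.bloch_synth a ((C.synth b).adjoint φ), C.coeFn_adjoint_synth b φ] with k h1 h2
  rw [fiberOp, ContinuousLinearMap.comp_apply, h1, h2]

lemma continuous_fiberOp_self : Continuous fun a : C.BddFiber => C.fiberOp a a := by
  unfold fiberOp
  fun_prop

lemma isSelfAdjoint_fiberOp (a : C.BddFiber) : IsSelfAdjoint (C.fiberOp a a) := by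
  rw [ContinuousLinearMap.isSelfAdjoint_iff', fiberOp, ContinuousLinearMap.adjoint_comp,
    ContinuousLinearMap.adjoint_adjoint]

lemma inner_fiberOp_self (a : C.BddFiber) (φ : L2 d) :
    ⟪φ, C.fiberOp a a φ⟫_ℂ = ‖(C.synth a).adjoint φ‖ ^ 2 := by
  rw [fiberOp, ContinuousLinearMap.comp_apply, ← ContinuousLinearMap.adjoint_inner_left,
    inner_self_eq_norm_sq_to_K]
  rfl

lemma re_inner_fiberOp_self (a : C.BddFiber) (φ : L2 d) :
    (⟪φ, C.fiberOp a a φ⟫_ℂ).re = ‖(C.synth a).adjoint φ‖ ^ 2 := by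
  rw [inner_fiberOp_self]
  norm_cast

/-- A lattice translation multiplies each fibre by a scalar, which commutes with any operator acting
fibrewise. -/
lemma fiberOp_translate (a b : C.BddFiber) {m : Pos d} (hm : m ∈ C.L) (φ : L2 d) :
    C.fiberOp a b (translate m φ) = translate m (C.fiberOp a b φ) := by
  refine C.bloch.injective (Lp.ext ?_)
  rw [C.bloch_translate hm]
  have h0 := C.bloch_fiberOp a b (translate m φ)
  rw [C.bloch_translate hm] at h0
  filter_upwards [h0, C.coeFn_charMul m (C.bloch (C.fiberOp a b φ)), C.coeFn_charMul m (C.bloch φ),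
    C.bloch_fiberOp a b φ] with k h1 h2 h3 h4
  rw [h1, h2, h3, h4, inner_smul_right, smul_smul]

lemma totalPMap_mem_SPlus {B : L2 d →L[ℂ] L2 d} (hB : IsSelfAdjoint B)
    (hpos : ∀ φ, 0 ≤ (⟪φ, B φ⟫_ℂ).re)
    (hcomm : ∀ m ∈ C.L, ∀ φ, B (translate m φ) = translate m (B φ)) :
    totalPMap B ∈ C.SPlus := by
  refine ⟨isSelfAdjoint_totalPMap hB, opNonneg_totalPMap hpos, fun m hm φ g h => ?_⟩
  rw [mem_graph_totalPMap] at h ⊢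
  rw [h, hcomm m hm]

lemma fiberOp_mem_SPlus (a : C.BddFiber) : totalPMap (C.fiberOp a a) ∈ C.SPlus :=
  C.totalPMap_mem_SPlus (C.isSelfAdjoint_fiberOp a)
    (fun φ => by rw [re_inner_fiberOp_self]; positivity)
    fun _ hm φ => C.fiberOp_translate a a hm φ

lemma hasPeriodicTrace_fiberOp (a : C.BddFiber) :
    C.HasPeriodicTrace (totalPMap (C.fiberOp a a))
      (∫⁻ k, ENNReal.ofReal (‖a k‖ ^ 2) ∂C.zoneMeasure) := by
  refine ⟨C.fiberOp_mem_SPlus a, fun k => totalPMap (rankOneSelf (a k)), ⟨?_, fun φ => ?_⟩, ?_⟩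
  · exact fun k _ => isSelfAdjoint_totalPMap (isSelfAdjoint_rankOneSelf _)
  · refine ⟨C.bloch φ, C.bloch (C.fiberOp a a φ), C.isBlochTransform_bloch _,
      C.isBlochTransform_bloch _, ?_⟩
    refine C.ac_zoneMeasure.ae_le ?_
    filter_upwards [C.bloch_fiberOp a a φ] with k hk
    rw [mem_graph_totalPMap, hk, rankOneSelf_apply]
  · simp only [opTrace_rankOneSelf]
    simp only [laverage, zoneMeasure, Measure.restrict_apply_univ]

end Crystal


/-! ### Functions with polynomial decay -/

section HasDecay

variable {d : ℕ}

/-- Measurable functions bounded by a multiple of `(1 + |y|)^{-(d+1)}`. -/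
def HasDecay (a : Pos d → ℂ) : Prop :=
  AEStronglyMeasurable a volume ∧ ∃ M : ℝ, ∀ᵐ y : Pos d, ‖a y‖ ≤ M * decayWeight y

lemma HasDecay.memLp {a : Pos d → ℂ} (h : HasDecay a) : MemLp a 2 := by
  obtain ⟨hm, M, hM⟩ := h
  refine memLp_decayWeight.of_le_mul (c := M) hm (hM.mono fun y hy => ?_)
  rwa [Real.norm_of_nonneg (decayWeight_pos y).le]

lemma HasDecay.integrable {a : Pos d → ℂ} (h : HasDecay a) : Integrable a := by
  obtain ⟨hm, M, hM⟩ := h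
  exact (integrable_decayWeight.const_mul M).mono' hm hM

/-- A decaying function as an element of `L²`. -/
def HasDecay.toL2 {a : Pos d → ℂ} (h : HasDecay a) : L2 d := h.memLp.toLp a

lemma HasDecay.coeFn_toL2 {a : Pos d → ℂ} (h : HasDecay a) : h.toL2 =ᵐ[volume] a :=
  h.memLp.coeFn_toLp

lemma HasDecay.isAmalgam {a : Pos d → ℂ} (h : HasDecay a) (C : Crystal d) :
    C.IsAmalgam h.toL2 := by
  obtain ⟨M, hM⟩ := h.2
  refine C.isAmalgam_of_decay (M := M) ?_
  filter_upwards [h.coeFn_toL2, hM] with y h1 h2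
  rwa [h1]

lemma HasDecay.inner_toL2 {a b : Pos d → ℂ} (ha : HasDecay a) (hb : HasDecay b) :
    ⟪ha.toL2, hb.toL2⟫_ℂ = ∫ y, conj (a y) * b y := by
  rw [L2.inner_def]
  refine integral_congr_ae ?_
  filter_upwards [ha.coeFn_toL2, hb.coeFn_toL2] with y h1 h2
  rw [h1, h2, RCLike.inner_apply, mul_comm]

end HasDecay

/-! ### Coherent states -/

namespace Crystal

variable {d : ℕ} {ħ : ℝ}

lemma continuous_coherent : Continuous fun w : (Pos d × Pos d) × Pos d =>
    coherent ħ w.1.1 w.1.2 w.2 := by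
  unfold coherent
  fun_prop

lemma continuous_coherent_right (q p : Pos d) : Continuous (coherent ħ q p) := by
  unfold coherent
  fun_prop

lemma norm_coherent (hħ : 0 < ħ) (q p y : Pos d) : ‖coherent ħ q p y‖ =
    (Real.pi * ħ) ^ (-(d : ℝ) / 4) * Real.exp (-‖y - q‖ ^ 2 / (2 * ħ)) := by
  have : 0 < Real.pi * ħ := mul_pos Real.pi_pos hħ
  rw [coherent, norm_mul, Complex.norm_exp_I_mul_ofReal, mul_one, Complex.norm_real,
    Real.norm_of_nonneg (by positivity)]

lemma coherent_add (q p m y : Pos d) : coherent ħ (q + m) p y =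
    Complex.exp (Complex.I * ((⟪p, m⟫_ℝ / ħ : ℝ) : ℂ)) * coherent ħ q p (y - m) := by
  have h1 : y - (q + m) = y - m - q := by abel
  have h2 : Complex.exp (Complex.I * ((⟪p, y⟫_ℝ / ħ : ℝ) : ℂ)) =
      Complex.exp (Complex.I * ((⟪p, m⟫_ℝ / ħ : ℝ) : ℂ)) *
        Complex.exp (Complex.I * ((⟪p, y - m⟫_ℝ / ħ : ℝ) : ℂ)) := by
    rw [← Complex.exp_add, ← mul_add, ← Complex.ofReal_add, ← add_div, ← inner_add_right,
      add_sub_cancel]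
  rw [coherent, coherent, h1, h2]
  ring

/-- Hence the periodic coherent state of momentum `p - ħk` is the Bloch fibre over `k` of the state
of momentum `p`. -/
lemma coherent_sub_smul (hħ : 0 < ħ) (q p k y : Pos d) :
    coherent ħ q (p - ħ • k) y = coherent ħ q p y * planeWave k y := by
  have hħ' : (ħ : ℂ) ≠ 0 := by exact_mod_cast hħ.ne'
  rw [coherent, coherent, planeWave, mul_assoc, ← Complex.exp_add, inner_sub_left,
    real_inner_smul_left]
  congr 2
  push_cast
  field_simp
  ring

/-- A Gaussian beats every polynomial. The extra factor `1 + ‖y - q‖²` leaves room for the potential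
and for two momentum operators, which all grow at most quadratically. -/
lemma exists_coherent_decay (hħ : 0 < ħ) : ∃ K : ℝ, 0 ≤ K ∧ ∀ q p y : Pos d,
    (1 + ‖y - q‖ ^ 2) * ‖coherent ħ q p y‖ ≤ K * (1 + ‖q‖) ^ (d + 1) * decayWeight y := by
  have hpos : 0 < Real.pi * ħ := mul_pos Real.pi_pos hħ
  -- The constant comes from `1 + t ≤ 2(1 + t²)` and from `x^n/n! ≤ e^x` with `n = d + 2` and `x =
  -- (1 + t²)/(2ħ)`; one of the `d + 2` powers pays for the factor `1 + t²`.
  set K₀ : ℝ := 2 ^ (d + 1) * ((2 * ħ) ^ (d + 2) * (d + 2).factorial * Real.exp (1 / (2 * ħ)))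
  have hK₀ : 0 ≤ K₀ := by positivity
  have key : ∀ t : ℝ, 0 ≤ t →
      (1 + t ^ 2) * Real.exp (-t ^ 2 / (2 * ħ)) ≤ K₀ * ((1 + t) ^ (d + 1))⁻¹ := by
    intro t ht
    rw [← div_eq_mul_inv, le_div_iff₀ (by positivity)]
    have h1 : (1 + t) ^ (d + 1) ≤ 2 ^ (d + 1) * (1 + t ^ 2) ^ (d + 1) := by
      rw [← mul_pow]
      exact pow_le_pow_left₀ (by positivity) (by nlinarith [sq_nonneg (t - 1)]) _
    have h2 : (1 + t ^ 2) ^ (d + 2) ≤ (2 * ħ) ^ (d + 2) * (d + 2).factorial *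
        Real.exp (1 / (2 * ħ)) * Real.exp (t ^ 2 / (2 * ħ)) := by
      have := Real.pow_div_factorial_le_exp (x := (1 + t ^ 2) / (2 * ħ)) (by positivity) (d + 2)
      rw [div_le_iff₀ (by positivity), div_pow, div_le_iff₀ (by positivity), add_div,
        Real.exp_add] at this
      linarith
    have h3 : Real.exp (t ^ 2 / (2 * ħ)) * Real.exp (-t ^ 2 / (2 * ħ)) = 1 := by
      rw [← Real.exp_add, ← add_div, add_neg_cancel, zero_div, Real.exp_zero]
    calc (1 + t ^ 2) * Real.exp (-t ^ 2 / (2 * ħ)) * (1 + t) ^ (d + 1)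
        ≤ (1 + t ^ 2) * Real.exp (-t ^ 2 / (2 * ħ)) * (2 ^ (d + 1) * (1 + t ^ 2) ^ (d + 1)) := by
          gcongr
      _ = 2 ^ (d + 1) * (1 + t ^ 2) ^ (d + 2) * Real.exp (-t ^ 2 / (2 * ħ)) := by ring
      _ ≤ 2 ^ (d + 1) * ((2 * ħ) ^ (d + 2) * (d + 2).factorial *
        Real.exp (1 / (2 * ħ)) * Real.exp (t ^ 2 / (2 * ħ))) * Real.exp (-t ^ 2 / (2 * ħ)) := by
          gcongr
      _ = K₀ * (Real.exp (t ^ 2 / (2 * ħ)) * Real.exp (-t ^ 2 / (2 * ħ))) := by ring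
      _ = K₀ := by rw [h3, mul_one]
  refine ⟨(Real.pi * ħ) ^ (-(d : ℝ) / 4) * K₀, by positivity, fun q p y => ?_⟩
  rw [norm_coherent hħ]
  calc (1 + ‖y - q‖ ^ 2) * ((Real.pi * ħ) ^ (-(d : ℝ) / 4) * Real.exp (-‖y - q‖ ^ 2 / (2 * ħ)))
      = (Real.pi * ħ) ^ (-(d : ℝ) / 4) *
        ((1 + ‖y - q‖ ^ 2) * Real.exp (-‖y - q‖ ^ 2 / (2 * ħ))) := by ring
    _ ≤ (Real.pi * ħ) ^ (-(d : ℝ) / 4) * (K₀ * decayWeight (y - q)) := by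
        exact mul_le_mul_of_nonneg_left (key ‖y - q‖ (norm_nonneg _)) (by positivity)
    _ ≤ (Real.pi * ħ) ^ (-(d : ℝ) / 4) * (K₀ * ((1 + ‖q‖) ^ (d + 1) * decayWeight y)) := by
        gcongr
        have := decayWeight_add_le (-q) y
        rwa [norm_neg, neg_add_eq_sub] at this
    _ = _ := by ring

lemma hasDecay_mul_coherent (hħ : 0 < ħ) (q p : Pos d) {g : Pos d → ℂ}
    (hg : AEStronglyMeasurable g volume) {M : ℝ} (hM : ∀ᵐ y, ‖g y‖ ≤ M * (1 + ‖y - q‖ ^ 2)) :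
    HasDecay fun y => g y * coherent ħ q p y := by
  refine ⟨hg.mul (continuous_coherent_right q p).aestronglyMeasurable, ?_⟩
  obtain ⟨K, hK, h⟩ := exists_coherent_decay (d := d) hħ
  refine ⟨M * (K * (1 + ‖q‖) ^ (d + 1)), ?_⟩
  have hM0 : 0 ≤ M := by
    obtain ⟨y, hy⟩ := hM.exists
    exact nonneg_of_mul_nonneg_left ((norm_nonneg _).trans hy) (by positivity)
  filter_upwards [hM] with y hy
  rw [norm_mul]
  calc ‖g y‖ * ‖coherent ħ q p y‖ ≤ M * (1 + ‖y - q‖ ^ 2) * ‖coherent ħ q p y‖ := by gcongr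
    _ = M * ((1 + ‖y - q‖ ^ 2) * ‖coherent ħ q p y‖) := by ring
    _ ≤ M * (K * (1 + ‖q‖) ^ (d + 1) * decayWeight y) := by
        exact mul_le_mul_of_nonneg_left (h q p y) hM0
    _ = _ := by ring

lemma norm_coherent_le {K : ℝ} {q p y : Pos d}
    (h : (1 + ‖y - q‖ ^ 2) * ‖coherent ħ q p y‖ ≤ K * (1 + ‖q‖) ^ (d + 1) * decayWeight y) :
    ‖coherent ħ q p y‖ ≤ K * (1 + ‖q‖) ^ (d + 1) * decayWeight y := by
  refine le_trans ?_ h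
  nlinarith [norm_nonneg (coherent ħ q p y), sq_nonneg ‖y - q‖,
    mul_nonneg (sq_nonneg ‖y - q‖) (norm_nonneg (coherent ħ q p y))]

lemma hasDecay_coherent (hħ : 0 < ħ) (q p : Pos d) : HasDecay (coherent ħ q p) := by
  obtain ⟨K, hK, h⟩ := exists_coherent_decay (d := d) hħ
  exact ⟨(continuous_coherent_right q p).aestronglyMeasurable, _,
    ae_of_all _ fun y => norm_coherent_le (h q p y)⟩

/-- The coherent state as an element of `L²`. -/
def cohL2 (hħ : 0 < ħ) (z : Pos d × Pos d) : L2 d := (hasDecay_coherent hħ z.1 z.2).toL2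

lemma coeFn_cohL2 (hħ : 0 < ħ) (z : Pos d × Pos d) :
    cohL2 hħ z =ᵐ[volume] coherent ħ z.1 z.2 := HasDecay.coeFn_toL2 _

/-- A decay estimate of the coherent states which is locally uniform in phase space. -/
lemma exists_coherent_decay_nhds (hħ : 0 < ħ) (z₀ : Pos d × Pos d) : ∃ M : ℝ,
    ∀ᶠ z : Pos d × Pos d in 𝓝 z₀, ∀ y, ‖coherent ħ z.1 z.2 y‖ ≤ M * decayWeight y := by
  obtain ⟨K, hK, h⟩ := exists_coherent_decay (d := d) hħ
  refine ⟨K * (1 + (‖z₀.1‖ + 1)) ^ (d + 1), ?_⟩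
  have h1 : ∀ᶠ z : Pos d × Pos d in 𝓝 z₀, ‖z.1‖ < ‖z₀.1‖ + 1 :=
    (continuous_fst.norm.tendsto z₀).eventually_lt_const (by linarith)
  filter_upwards [h1] with z hz y
  refine (norm_coherent_le (h z.1 z.2 y)).trans ?_
  have := (decayWeight_pos y).le
  gcongr

lemma continuous_cohL2 (hħ : 0 < ħ) : Continuous (cohL2 (d := d) hħ) := by
  rw [continuous_iff_continuousAt]
  intro z₀
  obtain ⟨M, hM⟩ := exists_coherent_decay_nhds hħ z₀
  have hz₀ : ∀ y, ‖coherent ħ z₀.1 z₀.2 y‖ ≤ M * decayWeight y := hM.self_of_nhds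
  have hlim : ∀ y, Tendsto (fun z : Pos d × Pos d => coherent ħ z.1 z.2 y) (𝓝 z₀)
      (𝓝 (coherent ħ z₀.1 z₀.2 y)) := fun y =>
    Continuous.tendsto (continuous_coherent.comp (Continuous.prodMk_left y)) z₀
  exact tendsto_toLp_of_dominated (F := fun z : Pos d × Pos d => coherent ħ z.1 z.2)
    (g := fun y => M * decayWeight y)
    (fun z => (hasDecay_coherent hħ z.1 z.2).memLp) (hasDecay_coherent hħ z₀.1 z₀.2).memLp
    (memLp_decayWeight.const_mul M) (hM.mono fun z hz => ae_of_all _ hz) (ae_of_all _ hz₀)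
    (ae_of_all _ hlim)

/-! ### Bloch fibres of coherent states -/

lemma isAmalgam_cohL2 (C : Crystal d) (hħ : 0 < ħ) (z : Pos d × Pos d) :
    C.IsAmalgam (cohL2 hħ z) := HasDecay.isAmalgam _ C

/-- The bounded field of the Bloch transforms of a coherent state. -/
def cohField (C : Crystal d) (hħ : 0 < ħ) (z : Pos d × Pos d) : C.BddFiber :=
  (C.isAmalgam_cohL2 hħ z).field

lemma continuous_cohField (C : Crystal d) (hħ : 0 < ħ) : Continuous (C.cohField hħ) := by
  rw [continuous_iff_continuousAt]
  intro z₀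
  obtain ⟨M, hM⟩ := exists_coherent_decay_nhds hħ z₀
  obtain ⟨B, -, hB⟩ := C.exists_cellAt_bound
  refine continuousAt_field (fun z => C.isAmalgam_cohL2 hħ z) (continuous_cohL2 hħ).continuousAt
    ((summable_decayWeight C.L).mul_left (B * M)) ?_
  filter_upwards [hM] with z hz
  refine hB _ M ?_
  filter_upwards [coeFn_cohL2 hħ z] with y hy
  rw [hy]
  exact hz y

lemma norm_cohL2 (hħ : 0 < ħ) (z : Pos d × Pos d) : ‖cohL2 hħ z‖ = 1 := by
  have hpos : 0 < Real.pi * ħ := mul_pos Real.pi_pos hħ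
  have h : ∫ y, ‖coherent ħ z.1 z.2 y‖ ^ 2 = 1 := by
    have h1 : ∀ y, ‖coherent ħ z.1 z.2 y‖ ^ 2 =
        (Real.pi * ħ) ^ (-(d : ℝ) / 2) * Real.exp (-(1 / ħ) * ‖y - z.1‖ ^ 2) := fun y => by
      rw [norm_coherent hħ, mul_pow, ← Real.rpow_natCast, ← Real.rpow_mul hpos.le,
        ← Real.exp_nat_mul]
      congr 2
      · push_cast; ring
      · push_cast; field_simp
    simp only [h1]
    rw [integral_const_mul, integral_sub_right_eq_self fun y => Real.exp (-(1 / ħ) * ‖y‖ ^ 2),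
      GaussianFourier.integral_rexp_neg_mul_sq_norm (by positivity), finrank_euclideanSpace_fin,
      one_div, div_inv_eq_mul, neg_div, Real.rpow_neg hpos.le, inv_mul_cancel₀ (by positivity)]
  have h2 : (‖cohL2 hħ z‖ : ℂ) ^ 2 = 1 := by
    rw [← Complex.coe_algebraMap, ← inner_self_eq_norm_sq_to_K (𝕜 := ℂ), cohL2,
      HasDecay.inner_toL2]
    simp only [Complex.conj_mul']
    rw [← Complex.ofReal_one, ← h, ← integral_complex_ofReal]
    norm_cast
  have h3 : ‖cohL2 hħ z‖ ^ 2 = 1 := by exact_mod_cast h2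
  nlinarith [norm_nonneg (cohL2 hħ z)]

lemma translate_cohL2 (hħ : 0 < ħ) (z : Pos d × Pos d) (m : Pos d) :
    cohL2 hħ (z.1 + m, z.2) =
      Complex.exp (Complex.I * ((⟪z.2, m⟫_ℝ / ħ : ℝ) : ℂ)) • translate m (cohL2 hħ z) := by
  refine Lp.ext ?_
  filter_upwards [coeFn_cohL2 hħ (z.1 + m, z.2), coeFn_translate m (cohL2 hħ z),
    ae_comp_sub (coeFn_cohL2 hħ z) m,
    Lp.coeFn_smul (Complex.exp (Complex.I * ((⟪z.2, m⟫_ℝ / ħ : ℝ) : ℂ)))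
      (translate m (cohL2 hħ z))] with y h1 h2 h3 h4
  rw [h1, h4, Pi.smul_apply, h2, h3, coherent_add, smul_eq_mul]

variable (C : Crystal d)

lemma ae_bloch_cohL2_eq (hħ : 0 < ħ) (z : Pos d × Pos d) :
    ∀ᵐ k ∂C.zoneMeasure, C.bloch (cohL2 hħ z) k =ᵐ[volume.restrict C.Γ]
      C.perCoherent ħ z.1 (z.2 - ħ • k) := by
  obtain ⟨K, hK, h⟩ := exists_coherent_decay (d := d) hħ
  filter_upwards [C.ae_bloch_eq_tsum (coeFn_cohL2 hħ z) fun y => norm_coherent_le (h z.1 z.2 y)]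
    with k hk
  filter_upwards [hk] with x hx
  rw [hx, perCoherent]
  exact tsum_congr fun ℓ => (coherent_sub_smul hħ _ _ _ _).symm

/-- The Bloch fibers of a coherent state are bounded away from zero. -/
lemma exists_le_norm_bloch_cohL2 (hħ : 0 < ħ) (z : Pos d × Pos d) :
    ∃ δ : ℝ, 0 < δ ∧ ∀ᵐ k ∂C.zoneMeasure, δ ≤ ‖C.bloch (cohL2 hħ z) k‖ := by
  have hpos : 0 < Real.pi * ħ := mul_pos Real.pi_pos hħ
  obtain ⟨ρ, hρ, hρL⟩ := exists_covering_radius C.Ls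
  set c : ℝ := (Real.pi * ħ) ^ (-(d : ℝ) / 4) * (Real.pi * (2 * ħ)) ^ (d / 2 : ℝ) with hc
  have hcpos : 0 < c := by positivity
  -- The Fourier transform of a coherent state is, in modulus, a Gaussian centred at `p/ħ`; it never
  -- vanishes, and this is the source of the lower bound.
  have hFT : ∀ k : Pos d, ‖∫ y, coherent ħ z.1 z.2 y * planeWave k y‖ =
      c * Real.exp (-(‖ħ⁻¹ • z.2 - k‖ ^ 2 * (ħ / 2))) := by
    intro k
    have hħ' : (ħ : ℂ) ≠ 0 := by exact_mod_cast hħ.ne'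
    have h1 : ∀ y, coherent ħ z.1 z.2 (y + z.1) * planeWave k (y + z.1) =
        ((((Real.pi * ħ) ^ (-(d : ℝ) / 4) : ℝ) : ℂ) *
          Complex.exp (Complex.I * ((⟪ħ⁻¹ • z.2 - k, z.1⟫_ℝ : ℝ) : ℂ))) *
        Complex.exp (-((1 / (2 * ħ) : ℝ) : ℂ) * (‖y‖ : ℂ) ^ 2 +
          Complex.I * ((⟪ħ⁻¹ • z.2 - k, y⟫_ℝ : ℝ) : ℂ)) := by
      intro y
      rw [coherent, planeWave, add_sub_cancel_right, Complex.ofReal_mul, Complex.ofReal_exp,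
        mul_assoc, mul_assoc, mul_assoc, ← Complex.exp_add, ← Complex.exp_add, ← Complex.exp_add]
      congr 2
      simp only [inner_add_right, inner_sub_left, real_inner_smul_left]
      push_cast
      field_simp
      ring
    rw [← integral_add_right_eq_self (fun y => coherent ħ z.1 z.2 y * planeWave k y) z.1]
    simp only [h1]
    rw [integral_const_mul, GaussianFourier.integral_cexp_neg_mul_sq_norm_add
      (by rw [Complex.ofReal_re]; positivity), norm_mul, norm_mul, norm_mul,
      Complex.norm_exp_I_mul_ofReal, mul_one, Complex.norm_real,
      Real.norm_of_nonneg (by positivity), finrank_euclideanSpace_fin, hc, mul_assoc]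
    congr 1
    have h2 : ((Real.pi : ℂ) / ((1 / (2 * ħ) : ℝ) : ℂ)) ^ ((d : ℂ) / 2) =
        (((Real.pi * (2 * ħ)) ^ (d / 2 : ℝ) : ℝ) : ℂ) := by
      rw [Complex.ofReal_cpow (by positivity)]
      congr 1
      · push_cast; field_simp
      · push_cast; rfl
    have h3 : Complex.I ^ 2 * (‖ħ⁻¹ • z.2 - k‖ : ℂ) ^ 2 / (4 * ((1 / (2 * ħ) : ℝ) : ℂ)) =
        ((-(‖ħ⁻¹ • z.2 - k‖ ^ 2 * (ħ / 2)) : ℝ) : ℂ) := by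
      rw [Complex.I_sq]
      push_cast
      field_simp
      ring
    rw [h2, h3, Complex.norm_real, Real.norm_of_nonneg (by positivity), ← Complex.ofReal_exp,
      Complex.norm_real, Real.norm_of_nonneg (Real.exp_pos _).le]
  have hone : MemLp (fun _ : Pos d => (1 : ℂ)) 2 (volume.restrict C.Γ) := memLp_const 1
  set e : L2per C.Γ := hone.toLp _ with he
  -- A lower bound of that Gaussian over `‖k‖ ≤ ρ`, a ball containing almost all of the zone.
  set G : ℝ := c * Real.exp (-((‖ħ⁻¹ • z.2‖ + ρ) ^ 2 * (ħ / 2))) with hG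
  have hGpos : 0 < G := by positivity
  -- The `+ 1` keeps the denominator positive without showing that `e` is nonzero.
  refine ⟨G / (‖e‖ + 1), by positivity, ?_⟩
  have hbdd : ∀ᵐ k ∂C.zoneMeasure, ‖k‖ ≤ ρ := C.zoneMeasure_ac.ae_le (C.unitCell_dual.ae_norm_le hρL)
  filter_upwards [hbdd, (C.isAmalgam_cohL2 hħ z).ae_hasSum] with k hk hsum
  have hterm : ∀ ℓ : C.L, ⟪e, planeWave k ℓ • C.waveMul k (C.cellAt ℓ (cohL2 hħ z))⟫_ℂ =
      ∫ x in C.Γ, coherent ħ z.1 z.2 (x + ℓ) * planeWave k (x + ℓ) := by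
    intro ℓ
    rw [L2.inner_def]
    refine integral_congr_ae ?_
    filter_upwards [hone.coeFn_toLp,
      Lp.coeFn_smul (planeWave k ℓ) (C.waveMul k (C.cellAt ℓ (cohL2 hħ z))),
      C.coeFn_waveMul k (C.cellAt ℓ (cohL2 hħ z)), C.coeFn_cellAt ℓ (cohL2 hħ z),
      ae_restrict_of_ae (ae_comp_add (coeFn_cohL2 hħ z) (ℓ : Pos d))] with x hx0 hx1 hx2 hx3 hx4
    rw [he, hx0, hx1, Pi.smul_apply, hx2, hx3, hx4, planeWave_add, RCLike.inner_apply, map_one,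
      smul_eq_mul]
    ring
  have hint : Integrable fun y => coherent ħ z.1 z.2 y * planeWave k y :=
    (hasDecay_coherent hħ z.1 z.2).integrable.mul_bdd (c := 1)
      (continuous_planeWave_right k).aestronglyMeasurable
      (ae_of_all _ fun y => (norm_planeWave k y).le)
  -- Testing the fibre against the constant function unfolds the lattice sum into an integral over
  -- the whole space.
  have htot : ⟪e, C.bloch (cohL2 hħ z) k⟫_ℂ = ∫ y, coherent ħ z.1 z.2 y * planeWave k y := by
    have h1 := hsum.mapL (innerSL ℂ e)
    simp only [innerSL_apply_apply, hterm] at h1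
    rw [← h1.tsum_eq, C.unitCell.isAddFundamentalDomain.integral_eq_tsum'' _ hint]
    refine tsum_congr fun ℓ => integral_congr_ae (ae_of_all _ fun x => ?_)
    change _ = coherent ħ z.1 z.2 ((ℓ : Pos d) + x) * planeWave k ((ℓ : Pos d) + x)
    simp only [add_comm]
  have hlow : G ≤ ‖e‖ * ‖C.bloch (cohL2 hħ z) k‖ := by
    refine le_trans ?_ (norm_inner_le_norm (𝕜 := ℂ) e _)
    rw [htot, hFT, hG]
    have : ‖ħ⁻¹ • z.2 - k‖ ≤ ‖ħ⁻¹ • z.2‖ + ρ := (norm_sub_le _ _).trans (by gcongr)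
    gcongr
  rw [div_le_iff₀ (by positivity)]
  nlinarith [norm_nonneg (C.bloch (cohL2 hħ z) k)]

end Crystal


/-! ### The momentum operator -/

namespace Crystal

variable {d : ℕ} {ħ : ℝ}

lemma fderiv_conj_apply {Φ : Pos d → ℂ} {y : Pos d} (h : DifferentiableAt ℝ Φ y) (v : Pos d) :
    fderiv ℝ (fun x => conj (Φ x)) y v = conj (fderiv ℝ Φ y v) := by
  have := (Complex.conjCLE.toContinuousLinearMap.hasFDerivAt.comp y h.hasFDerivAt).fderiv
  have h2 : (fun x => conj (Φ x)) = Complex.conjCLE.toContinuousLinearMap ∘ Φ := rfl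
  rw [h2, this]
  rfl

/-- The momentum operator is formally self-adjoint. -/
lemma integral_conj_mul_momentum (ξ : Pos d) (j : Fin d) {Φ η : Pos d → ℂ}
    (hΦ : Differentiable ℝ Φ) (hη : Differentiable ℝ η)
    (h0 : Integrable fun y => conj (Φ y) * η y)
    (h1 : Integrable fun y => conj (Φ y) * fderiv ℝ η y (EuclideanSpace.single j 1))
    (h2 : Integrable fun y => conj (fderiv ℝ Φ y (EuclideanSpace.single j 1)) * η y) :
    ∫ y, conj (Φ y) * momentum ħ ξ j η y = ∫ y, conj (momentum ħ ξ j Φ y) * η y := by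
  have hfd : ∀ y, fderiv ℝ (fun x => conj (Φ x)) y (EuclideanSpace.single j 1) =
      conj (fderiv ℝ Φ y (EuclideanSpace.single j 1)) := fun y => fderiv_conj_apply (hΦ y) _
  have hparts := integral_mul_fderiv_eq_neg_fderiv_mul_of_integrable (μ := volume)
    (f := fun x => conj (Φ x)) (g := η) (v := EuclideanSpace.single j (1 : ℝ))
    (by simpa only [hfd] using h2) h1 h0
    (fun y _ => Complex.conjCLE.toContinuousLinearMap.differentiableAt.comp y (hΦ y))
    (fun y _ => hη y)
  simp only [hfd] at hparts
  have e1 : ∀ y, conj (Φ y) * momentum ħ ξ j η y = (ξ j : ℂ) * (conj (Φ y) * η y) +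
      Complex.I * ħ * (conj (Φ y) * fderiv ℝ η y (EuclideanSpace.single j 1)) := fun y => by
    rw [momentum]; ring
  have e2 : ∀ y, conj (momentum ħ ξ j Φ y) * η y = (ξ j : ℂ) * (conj (Φ y) * η y) -
      Complex.I * ħ * (conj (fderiv ℝ Φ y (EuclideanSpace.single j 1)) * η y) := fun y => by
    rw [momentum]
    simp only [map_add, map_mul, Complex.conj_ofReal, Complex.conj_I]
    ring
  simp only [e1, e2]
  rw [integral_add (h0.const_mul _) (h1.const_mul _), integral_sub (h0.const_mul _)
    (h2.const_mul _), integral_const_mul, integral_const_mul, integral_const_mul, hparts]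
  ring

lemma momentum_mul (ξ : Pos d) (j : Fin d) {g Φ : Pos d → ℂ} {y : Pos d}
    (hg : DifferentiableAt ℝ g y) (hΦ : DifferentiableAt ℝ Φ y) :
    momentum ħ ξ j (fun x => g x * Φ x) y = g y * momentum ħ ξ j Φ y +
      Complex.I * ħ * fderiv ℝ g y (EuclideanSpace.single j 1) * Φ y := by
  have : fderiv ℝ (fun x => g x * Φ x) y = g y • fderiv ℝ Φ y + Φ y • fderiv ℝ g y :=
    (hg.hasFDerivAt.mul hΦ.hasFDerivAt).fderiv
  rw [momentum, this, momentum]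
  simp only [add_apply, smul_apply, smul_eq_mul]
  ring

lemma hasFDerivAt_coherent (q p y : Pos d) : HasFDerivAt (coherent ħ q p)
    (coherent ħ q p y • ((-(1 / ħ) : ℂ) • (Complex.ofRealCLM.comp (innerSL ℝ (y - q))) +
      (Complex.I * (1 / ħ) : ℂ) • (Complex.ofRealCLM.comp (innerSL ℝ p)))) y := by
  have h1 : HasFDerivAt (fun x : Pos d => ‖x - q‖ ^ 2) (2 • innerSL ℝ (y - q)) y :=
    ((hasFDerivAt_id y).sub_const q).norm_sq.congr_fderiv (by ext; simp)
  have h1' : HasFDerivAt (fun x : Pos d => ((‖x - q‖ ^ 2 : ℝ) : ℂ))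
      (Complex.ofRealCLM.comp (2 • innerSL ℝ (y - q))) y :=
    Complex.ofRealCLM.hasFDerivAt.comp y h1
  have h2' : HasFDerivAt (fun x : Pos d => ((⟪p, x⟫_ℝ : ℝ) : ℂ))
      (Complex.ofRealCLM.comp (innerSL ℝ p)) y :=
    Complex.ofRealCLM.hasFDerivAt.comp y (innerSL ℝ p).hasFDerivAt
  have h3 := (((h1'.const_mul (-(1 / (2 * ħ)) : ℂ)).add
    (h2'.const_mul (Complex.I * (1 / ħ) : ℂ))).cexp).const_mul
      ((((Real.pi * ħ) ^ (-(d : ℝ) / 4) : ℝ) : ℂ))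
  have hfun : ∀ x, coherent ħ q p x = (((Real.pi * ħ) ^ (-(d : ℝ) / 4) : ℝ) : ℂ) *
      Complex.exp (-(1 / (2 * ħ)) * ((‖x - q‖ ^ 2 : ℝ) : ℂ) +
        Complex.I * (1 / ħ) * ((⟪p, x⟫_ℝ : ℝ) : ℂ)) := by
    intro x
    rw [coherent, Complex.ofReal_mul, Complex.ofReal_exp, mul_assoc, ← Complex.exp_add]
    congr 2
    push_cast
    ring
  refine (h3.congr_of_eventuallyEq (.of_forall hfun)).congr_fderiv ?_
  ext v
  rw [hfun y]
  simp only [smul_apply, add_apply,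
    ContinuousLinearMap.comp_apply, Complex.ofRealCLM_apply, smul_eq_mul, innerSL_apply_apply,
    nsmul_eq_mul, Pi.add_apply]
  push_cast
  ring

lemma differentiable_coherent (q p : Pos d) : Differentiable ℝ (coherent ħ q p) :=
  fun y => (hasFDerivAt_coherent q p y).differentiableAt

lemma fderiv_coherent_single (q p y : Pos d) (j : Fin d) :
    fderiv ℝ (coherent ħ q p) y (EuclideanSpace.single j 1) =
      (-((y j - q j : ℝ) : ℂ) + Complex.I * (p j : ℂ)) / ħ * coherent ħ q p y := by
  rw [(hasFDerivAt_coherent q p y).fderiv]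
  simp only [smul_apply, add_apply,
    ContinuousLinearMap.comp_apply, Complex.ofRealCLM_apply, smul_eq_mul, innerSL_apply_apply,
    EuclideanSpace.inner_single_right]
  simp
  ring

/-- Applied to the phase `e^{ip·y/ħ}`, `iħ∂_j` gives `-p_j`, which cancels `ξ_j = p_j`; only the
derivative of the Gaussian remains. -/
lemma momentum_coherent (hħ : 0 < ħ) (q p : Pos d) (j : Fin d) :
    momentum ħ p j (coherent ħ q p) =
      fun y => (-Complex.I * ((y j - q j : ℝ) : ℂ)) * coherent ħ q p y := by
  have hħ' : (ħ : ℂ) ≠ 0 := by exact_mod_cast hħ.ne'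
  funext y
  rw [momentum, fderiv_coherent_single]
  field_simp
  linear_combination (p j : ℂ) * coherent ħ q p y * Complex.I_sq

lemma hasFDerivAt_coord (q y : Pos d) (j : Fin d) :
    HasFDerivAt (fun x : Pos d => -Complex.I * ((x j - q j : ℝ) : ℂ))
      ((-Complex.I) • Complex.ofRealCLM.comp (EuclideanSpace.proj j : Pos d →L[ℝ] ℝ)) y := by
  have h : HasFDerivAt (fun x : Pos d => x j - q j) (EuclideanSpace.proj j : Pos d →L[ℝ] ℝ) y :=
    (EuclideanSpace.proj j : Pos d →L[ℝ] ℝ).hasFDerivAt.sub_const (q j)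
  exact (Complex.ofRealCLM.hasFDerivAt.comp y h).const_mul (-Complex.I)

lemma differentiable_momentum_coherent (hħ : 0 < ħ) (q p : Pos d) (j : Fin d) :
    Differentiable ℝ (momentum ħ p j (coherent ħ q p)) := by
  rw [momentum_coherent hħ]
  exact fun y => (hasFDerivAt_coord q y j).differentiableAt.mul (differentiable_coherent q p y)

/-- The second application gives `(-i(y_j - q_j))²` plus the commutator term `iħ·(-i) = ħ`. -/
lemma momentum_momentum_coherent (hħ : 0 < ħ) (q p : Pos d) (j : Fin d) :
    momentum ħ p j (momentum ħ p j (coherent ħ q p)) =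
      fun y => ((ħ - (y j - q j) ^ 2 : ℝ) : ℂ) * coherent ħ q p y := by
  funext y
  have h1 := momentum_mul (ħ := ħ) p j (hasFDerivAt_coord q y j).differentiableAt
    (differentiable_coherent (ħ := ħ) q p y)
  rw [momentum_coherent hħ, h1, (hasFDerivAt_coord q y j).fderiv, momentum_coherent hħ]
  simp only [smul_apply, ContinuousLinearMap.comp_apply,
    Complex.ofRealCLM_apply, smul_eq_mul]
  simp
  linear_combination (((y j : ℂ) - q j) ^ 2 - ħ) * coherent ħ q p y * Complex.I_sq

/-! ### Regularity of test functions -/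

lemma contDiff_momentum (ξ : Pos d) (j : Fin d) {Φ : Pos d → ℂ} (hΦ : ContDiff ℝ ∞ Φ) :
    ContDiff ℝ ∞ (momentum ħ ξ j Φ) := by
  have h1 : ContDiff ℝ ∞ fun y => fderiv ℝ Φ y (EuclideanSpace.single j 1) :=
    (hΦ.fderiv_right (m := ∞) (by simp)).clm_apply contDiff_const
  unfold momentum
  exact (contDiff_const.mul hΦ).add (contDiff_const.mul h1)

lemma hasCompactSupport_momentum (ξ : Pos d) (j : Fin d) {Φ : Pos d → ℂ}
    (hΦ : HasCompactSupport Φ) : HasCompactSupport (momentum ħ ξ j Φ) := by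
  have h1 : HasCompactSupport fun y => fderiv ℝ Φ y (EuclideanSpace.single j 1) :=
    hΦ.fderiv_apply (𝕜 := ℝ) _
  have h2 : HasCompactSupport fun y => (ξ j : ℂ) * Φ y := hΦ.mul_left (f := fun _ => (ξ j : ℂ))
  have h3 : HasCompactSupport fun y =>
      Complex.I * (ħ : ℂ) * fderiv ℝ Φ y (EuclideanSpace.single j 1) :=
    h1.mul_left (f := fun _ => Complex.I * (ħ : ℂ))
  exact h2.add h3

lemma hasDecay_of_hasCompactSupport {a : Pos d → ℂ} (hc : Continuous a)
    (hs : HasCompactSupport a) : HasDecay a := by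
  refine ⟨hc.aestronglyMeasurable, ?_⟩
  have h1 : Continuous fun y => ((decayWeight y)⁻¹ : ℝ) • a y :=
    (continuous_decayWeight.inv₀ fun y => (decayWeight_pos y).ne').smul hc
  have h2 : HasCompactSupport fun y => ((decayWeight y)⁻¹ : ℝ) • a y :=
    hs.mono fun y hy h0 => hy (by simp only [h0, smul_zero])
  obtain ⟨M, hM⟩ := h2.exists_bound_of_continuous h1
  refine ⟨M, ae_of_all _ fun y => ?_⟩
  have := hM y
  rwa [norm_smul, norm_inv, Real.norm_of_nonneg (decayWeight_pos y).le,
    inv_mul_le_iff₀ (decayWeight_pos y), mul_comm] at this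

end Crystal


/-! ### Algebra of decaying functions -/

section HasDecay

variable {d : ℕ} {a b : Pos d → ℂ}

lemma HasDecay.add (ha : HasDecay a) (hb : HasDecay b) : HasDecay fun y => a y + b y := by
  obtain ⟨h1, M, hM⟩ := ha
  obtain ⟨h2, N, hN⟩ := hb
  refine ⟨h1.add h2, M + N, ?_⟩
  filter_upwards [hM, hN] with y h3 h4
  rw [add_mul]
  exact (norm_add_le _ _).trans (add_le_add h3 h4)

lemma HasDecay.sum {ι : Type*} {s : Finset ι} {a : ι → Pos d → ℂ}
    (h : ∀ i ∈ s, HasDecay (a i)) : HasDecay fun y => ∑ i ∈ s, a i y := by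
  classical
  induction s using Finset.induction_on with
  | empty => exact ⟨by simpa using aestronglyMeasurable_const, 0, by simp⟩
  | insert i s hi ih =>
    simp only [Finset.sum_insert hi]
    exact (h i (Finset.mem_insert_self i s)).add
      (ih fun j hj => h j (Finset.mem_insert_of_mem hj))

lemma HasDecay.const_mul (ha : HasDecay a) (c : ℂ) : HasDecay fun y => c * a y := by
  obtain ⟨h1, M, hM⟩ := ha
  refine ⟨h1.const_mul c, ‖c‖ * M, ?_⟩
  filter_upwards [hM] with y h3
  rw [norm_mul, mul_assoc]
  exact mul_le_mul_of_nonneg_left h3 (norm_nonneg c)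

lemma HasDecay.integrable_conj_mul (ha : HasDecay a) (hb : HasDecay b) :
    Integrable fun y => conj (a y) * b y := by
  refine (L2.integrable_inner ha.toL2 hb.toL2).congr ?_
  filter_upwards [ha.coeFn_toL2, hb.coeFn_toL2] with y h1 h2
  rw [h1, h2, RCLike.inner_apply, mul_comm]

lemma HasDecay.inner_toL2_left (ha : HasDecay a) (u : L2 d) :
    ⟪ha.toL2, u⟫_ℂ = ∫ y, conj (a y) * u y := by
  rw [L2.inner_def]
  refine integral_congr_ae ?_
  filter_upwards [ha.coeFn_toL2] with y h1
  rw [h1, RCLike.inner_apply, mul_comm]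

lemma HasDecay.norm_toL2_sq (ha : HasDecay a) : ‖ha.toL2‖ ^ 2 = ∫ y, ‖a y‖ ^ 2 := by
  have h := ha.inner_toL2 ha
  rw [inner_self_eq_norm_sq_to_K] at h
  simp only [Complex.conj_mul'] at h
  have h2 : ∫ y, (‖a y‖ : ℂ) ^ 2 = ((∫ y, ‖a y‖ ^ 2 : ℝ) : ℂ) := by
    rw [← integral_complex_ofReal]
    simp only [Complex.ofReal_pow]
  rw [h2] at h
  refine Complex.ofReal_injective ?_
  rw [← h, Complex.ofReal_pow]
  rfl

lemma HasDecay.integrable_norm_sq (ha : HasDecay a) : Integrable fun y => ‖a y‖ ^ 2 :=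
  (memLp_two_iff_integrable_sq_norm ha.1).1 ha.memLp

end HasDecay

/-! ### The potential -/

namespace Crystal

variable {d : ℕ} (C : Crystal d)

lemma proj_spec (z : Pos d) : C.proj z ∈ C.Γ ∧ z - C.proj z ∈ C.L := by
  obtain ⟨ℓ, ⟨hℓ, hz⟩, -⟩ := C.unitCell.partition z
  exact Classical.epsilon_spec (p := fun w => w ∈ C.Γ ∧ z - w ∈ C.L)
    ⟨z - ℓ, hz, by rwa [sub_sub_cancel]⟩

variable {C} in
lemma proj_eq {z w : Pos d} (hw : w ∈ C.Γ) (hzw : z - w ∈ C.L) : C.proj z = w := by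
  obtain ⟨h1, h2⟩ := C.proj_spec z
  obtain ⟨ℓ, -, hu⟩ := C.unitCell.partition z
  have e1 := hu (z - w) ⟨hzw, by rwa [sub_sub_cancel]⟩
  have e2 := hu (z - C.proj z) ⟨h2, by rwa [sub_sub_cancel]⟩
  have e3 := e2.trans e1.symm
  exact sub_right_injective e3

lemma proj_add {m : Pos d} (hm : m ∈ C.L) (z : Pos d) : C.proj (z + m) = C.proj z := by
  obtain ⟨h1, h2⟩ := C.proj_spec z
  refine proj_eq h1 ?_
  rw [add_sub_right_comm]
  exact C.L.add_mem h2 hm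

lemma measurable_proj : Measurable C.proj := by
  intro s hs
  have : C.proj ⁻¹' s = ⋃ ℓ : C.L, (fun z => z - (ℓ : Pos d)) ⁻¹' (C.Γ ∩ s) := by
    ext z
    simp only [Set.mem_preimage, Set.mem_iUnion, Set.mem_inter_iff]
    constructor
    · intro h
      obtain ⟨h1, h2⟩ := C.proj_spec z
      exact ⟨⟨_, h2⟩, by simpa using h1, by simpa using h⟩
    · rintro ⟨ℓ, h1, h2⟩
      rwa [proj_eq h1 (by simp)]
  rw [this]
  exact MeasurableSet.iUnion fun ℓ =>
    (measurable_id.sub_const _) (C.unitCell.measurableSet.inter hs)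

/-- Almost surely the representative lies in the Wigner-Seitz cell, so it is at least as short as
every other point of `z + L`, in particular `z`. -/
lemma ae_norm_proj_le : ∀ᵐ z : Pos d, ‖C.proj z‖ ≤ ‖z‖ := by
  filter_upwards [C.unitCell.ae_forall_mem_wignerSeitz] with z hz
  obtain ⟨h1, h2⟩ := C.proj_spec z
  have h3 := hz _ h1 h2 (C.proj z - z) (by rw [← neg_sub]; exact C.L.neg_mem h2)
  rwa [sub_sub_cancel] at h3

lemma gammaMinus_nonneg : 0 ≤ C.gammaMinus := by
  refine Real.sInf_nonneg ?_
  rintro _ ⟨z, -, rfl⟩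
  exact norm_nonneg z

lemma continuous_Theta_integrand : Continuous fun s : ℝ => max (1 - s / C.gammaMinus) 0 := by
  fun_prop

lemma continuous_Theta : Continuous C.Theta :=
  intervalIntegral.continuous_primitive
    (fun _ _ => C.continuous_Theta_integrand.intervalIntegrable _ _) 0

lemma Theta_nonneg {r : ℝ} (hr : 0 ≤ r) : 0 ≤ C.Theta r :=
  intervalIntegral.integral_nonneg hr fun _ _ => le_max_right _ _

/-- The integrand is at most `1` since `γ_- ≥ 0`. The value `γ_- = 0` is harmless: division by zero
then makes the integrand equal to `1`. -/
lemma Theta_le {r : ℝ} (hr : 0 ≤ r) : C.Theta r ≤ r := by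
  have h : C.Theta r ≤ ∫ _ in (0 : ℝ)..r, (1 : ℝ) := by
    refine intervalIntegral.integral_mono_on hr
      (C.continuous_Theta_integrand.intervalIntegrable _ _)
      (continuous_const.intervalIntegrable _ _) fun s hs => ?_
    have := div_nonneg hs.1 C.gammaMinus_nonneg
    exact max_le (by linarith) zero_le_one
  simpa using h

/-- The potential `y ↦ Θ(|P_Γ(x - y)|²)`. -/
def potential (x y : Pos d) : ℝ := C.Theta (‖C.proj (x - y)‖ ^ 2)

lemma measurable_potential (x : Pos d) : Measurable (C.potential x) :=
  C.continuous_Theta.measurable.comp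
    ((C.measurable_proj.comp (measurable_const.sub measurable_id)).norm.pow_const 2)

lemma potential_nonneg (x y : Pos d) : 0 ≤ C.potential x y := C.Theta_nonneg (by positivity)

lemma ae_potential_le (x : Pos d) : ∀ᵐ y : Pos d, C.potential x y ≤ ‖y - x‖ ^ 2 := by
  have h := (Measure.measurePreserving_sub_left (volume : Measure (Pos d)) x).quasiMeasurePreserving.ae
    C.ae_norm_proj_le
  filter_upwards [h] with y hy
  refine (C.Theta_le (by positivity)).trans ?_
  rw [norm_sub_rev y x]
  gcongr

lemma potential_sub_lattice {m : Pos d} (hm : m ∈ C.L) (x y : Pos d) :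
    C.potential x (y - m) = C.potential x y := by
  rw [potential, sub_sub_eq_add_sub, add_sub_right_comm, C.proj_add hm, potential]

lemma potential_add_add (x y v : Pos d) : C.potential (x + v) (y + v) = C.potential x y := by
  rw [potential, add_sub_add_right_eq_sub, potential]

lemma costExpr_eq (ħ lam : ℝ) (z : Pos d × Pos d) (Φ : Pos d → ℂ) (y : Pos d) :
    C.costExpr ħ lam z Φ y = ((lam ^ 2 : ℝ) : ℂ) * ((C.potential z.1 y : ℂ) * Φ y) +
      ∑ j, momentum ħ z.2 j (momentum ħ z.2 j Φ) y := by
  rw [costExpr, potential]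
  push_cast
  ring

variable {ħ lam : ℝ}

lemma ae_norm_potential_le (x q : Pos d) : ∀ᵐ y : Pos d,
    ‖(C.potential x y : ℂ)‖ ≤ (2 + 2 * ‖q - x‖ ^ 2) * (1 + ‖y - q‖ ^ 2) := by
  filter_upwards [C.ae_potential_le x] with y hy
  rw [Complex.norm_real, Real.norm_of_nonneg (C.potential_nonneg x y)]
  have h1 : ‖y - x‖ ≤ ‖y - q‖ + ‖q - x‖ := norm_sub_le_norm_sub_add_norm_sub y q x
  have h2 : ‖y - x‖ ^ 2 ≤ (‖y - q‖ + ‖q - x‖) ^ 2 := by gcongr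
  nlinarith [sq_nonneg (‖y - q‖ - ‖q - x‖), mul_nonneg (sq_nonneg ‖q - x‖) (sq_nonneg ‖y - q‖)]

lemma hasDecay_costExpr_of_hasCompactSupport (z : Pos d × Pos d) {Φ : Pos d → ℂ}
    (hΦ : ContDiff ℝ ∞ Φ) (hs : HasCompactSupport Φ) : HasDecay (C.costExpr ħ lam z Φ) := by
  -- The potential is only measurable, so its product with a test function is dominated by the
  -- continuous function `‖y - x‖² Φ`.
  have h1 : HasDecay fun y => (C.potential z.1 y : ℂ) * Φ y := by
    have h2 : HasDecay fun y => ((‖y - z.1‖ ^ 2 : ℝ) : ℂ) * Φ y := by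
      refine hasDecay_of_hasCompactSupport ?_ ?_
      · have := hΦ.continuous
        fun_prop
      · exact hs.mul_left (f := fun y => ((‖y - z.1‖ ^ 2 : ℝ) : ℂ))
    obtain ⟨-, M, hM⟩ := h2
    refine ⟨(Complex.measurable_ofReal.comp (C.measurable_potential z.1)).aestronglyMeasurable.mul
      hΦ.continuous.aestronglyMeasurable, M, ?_⟩
    filter_upwards [hM, C.ae_potential_le z.1] with y hy hy2
    refine le_trans ?_ hy
    rw [norm_mul, norm_mul, Complex.norm_real, Complex.norm_real,
      Real.norm_of_nonneg (C.potential_nonneg _ y), Real.norm_of_nonneg (sq_nonneg _)]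
    gcongr
  have h2 : HasDecay fun y => ∑ j, momentum ħ z.2 j (momentum ħ z.2 j Φ) y :=
    HasDecay.sum fun j _ => hasDecay_of_hasCompactSupport
      (contDiff_momentum z.2 j (contDiff_momentum z.2 j hΦ)).continuous
      (hasCompactSupport_momentum z.2 j (hasCompactSupport_momentum z.2 j hs))
  have h3 := (h1.const_mul ((lam ^ 2 : ℝ) : ℂ)).add h2
  simp only [← C.costExpr_eq] at h3
  exact h3

lemma L2_eq_zero_of_test {u : L2 d} (h : ∀ Φ : Pos d → ℂ, ContDiff ℝ ∞ Φ → HasCompactSupport Φ →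
    ∫ y, conj (Φ y) * u y = 0) : u = 0 := by
  rw [Lp.eq_zero_iff_ae_eq_zero]
  refine ae_eq_zero_of_integral_contDiff_smul_eq_zero
    ((Lp.memLp u).locallyIntegrable (by norm_num)) fun g hg hgs => ?_
  have := h (fun y => (g y : ℂ)) (Complex.ofRealCLM.contDiff.comp hg)
    (hgs.comp_left (g := fun t : ℝ => (t : ℂ)) Complex.ofReal_zero)
  simpa only [Complex.conj_ofReal, ← Complex.real_smul] using this

/-- The weak identity is linear in the pair, and test functions separate `L²`, so `g` is determined
by `ψ` and the span in `opOfRel` adds nothing. -/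
lemma mem_graph_cost (z : Pos d × Pos d) (ψ g : L2 d) :
    (ψ, g) ∈ (C.cost ħ lam z).graph ↔ ∀ Φ : Pos d → ℂ, ContDiff ℝ ∞ Φ → HasCompactSupport Φ →
      ∫ y, conj (Φ y) * g y = ∫ y, conj (C.costExpr ħ lam z Φ y) * ψ y := by
  have e1 : ∀ (Φ : Pos d → ℂ) (hΦ : ContDiff ℝ ∞ Φ) (hs : HasCompactSupport Φ) (u : L2 d),
      ∫ y, conj (Φ y) * u y = ⟪(hasDecay_of_hasCompactSupport hΦ.continuous hs).toL2, u⟫_ℂ :=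
    fun Φ hΦ hs u => (HasDecay.inner_toL2_left _ u).symm
  have e2 : ∀ (Φ : Pos d → ℂ) (hΦ : ContDiff ℝ ∞ Φ) (hs : HasCompactSupport Φ) (u : L2 d),
      ∫ y, conj (C.costExpr ħ lam z Φ y) * u y =
        ⟪(C.hasDecay_costExpr_of_hasCompactSupport (ħ := ħ) (lam := lam) z hΦ hs).toL2, u⟫_ℂ :=
    fun Φ hΦ hs u => (HasDecay.inner_toL2_left _ u).symm
  let S : Submodule ℂ (L2 d × L2 d) :=
    { carrier := {p | ∀ Φ : Pos d → ℂ, ContDiff ℝ ∞ Φ → HasCompactSupport Φ →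
        ∫ y, conj (Φ y) * p.2 y = ∫ y, conj (C.costExpr ħ lam z Φ y) * p.1 y}
      add_mem' := fun {p p'} h h' Φ hΦ hs => by
        have h1 := h Φ hΦ hs
        have h2 := h' Φ hΦ hs
        rw [e1 Φ hΦ hs, e2 Φ hΦ hs] at h1 h2 ⊢
        rw [Prod.fst_add, Prod.snd_add, inner_add_right, inner_add_right, h1, h2]
      zero_mem' := fun Φ hΦ hs => by
        rw [e1 Φ hΦ hs, e2 Φ hΦ hs]
        simp
      smul_mem' := fun c p h Φ hΦ hs => by
        have h1 := h Φ hΦ hs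
        rw [e1 Φ hΦ hs, e2 Φ hΦ hs] at h1 ⊢
        rw [Prod.smul_fst, Prod.smul_snd, inner_smul_right, inner_smul_right, h1] }
  have h : (C.cost ħ lam z).graph = S := by
    refine graph_opOfRel S (fun _ _ => Iff.rfl) fun g hg => L2_eq_zero_of_test fun Φ hΦ hs => ?_
    rw [hg Φ hΦ hs, e2 Φ hΦ hs, inner_zero_right]
  rw [h]
  exact Iff.rfl

/-! ### The cost of a coherent state -/

lemma HasDecay.fderiv_of_momentum (hħ : 0 < ħ) {ξ : Pos d} {j : Fin d} {η : Pos d → ℂ}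
    (h0 : HasDecay η) (h1 : HasDecay (momentum ħ ξ j η)) :
    HasDecay fun y => fderiv ℝ η y (EuclideanSpace.single j 1) := by
  have hħ' : (ħ : ℂ) ≠ 0 := by exact_mod_cast hħ.ne'
  have h2 := (h1.const_mul (-Complex.I / ħ)).add (h0.const_mul (Complex.I / ħ * ξ j))
  have h3 : ∀ y, fderiv ℝ η y (EuclideanSpace.single j 1) =
      -Complex.I / ħ * momentum ħ ξ j η y + Complex.I / ħ * ξ j * η y := fun y => by
    rw [momentum]
    field_simp
    linear_combination (ħ : ℂ) * fderiv ℝ η y (EuclideanSpace.single j 1) * Complex.I_sq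
  simpa only [h3] using h2

lemma integral_conj_mul_momentum_of_hasDecay (hħ : 0 < ħ) {ξ : Pos d} {j : Fin d}
    {Φ η : Pos d → ℂ} (hΦ : Differentiable ℝ Φ) (hη : Differentiable ℝ η)
    (h1 : HasDecay Φ) (h2 : HasDecay η) (h3 : HasDecay (momentum ħ ξ j Φ))
    (h4 : HasDecay (momentum ħ ξ j η)) :
    ∫ y, conj (Φ y) * momentum ħ ξ j η y = ∫ y, conj (momentum ħ ξ j Φ y) * η y :=
  integral_conj_mul_momentum ξ j hΦ hη (h1.integrable_conj_mul h2)
    (h1.integrable_conj_mul (HasDecay.fderiv_of_momentum hħ h2 h4))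
    ((HasDecay.fderiv_of_momentum hħ h1 h3).integrable_conj_mul h2)

lemma abs_coord_sub_le (y q : Pos d) (j : Fin d) : |y j - q j| ≤ ‖y - q‖ := by
  have := PiLp.norm_apply_le (y - q) j
  rwa [PiLp.sub_apply, Real.norm_eq_abs] at this

lemma hasDecay_momentum_coherent (hħ : 0 < ħ) (q p : Pos d) (j : Fin d) :
    HasDecay (momentum ħ p j (coherent ħ q p)) := by
  rw [momentum_coherent hħ]
  refine hasDecay_mul_coherent hħ q p (M := 1) (Continuous.aestronglyMeasurable (by fun_prop))
    (ae_of_all _ fun y => ?_)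
  rw [norm_mul, norm_neg, Complex.norm_I, one_mul, one_mul, Complex.norm_real, Real.norm_eq_abs]
  have := abs_coord_sub_le y q j
  nlinarith [sq_nonneg (‖y - q‖ - 1)]

lemma hasDecay_momentum_momentum_coherent (hħ : 0 < ħ) (q p : Pos d) (j : Fin d) :
    HasDecay (momentum ħ p j (momentum ħ p j (coherent ħ q p))) := by
  rw [momentum_momentum_coherent hħ]
  refine hasDecay_mul_coherent hħ q p (M := ħ + 1) (Continuous.aestronglyMeasurable (by fun_prop))
    (ae_of_all _ fun y => ?_)
  rw [Complex.norm_real, Real.norm_eq_abs]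
  have h1 := abs_coord_sub_le y q j
  have h2 : (y j - q j) ^ 2 ≤ ‖y - q‖ ^ 2 := by
    rw [← sq_abs]
    gcongr
  rw [abs_le]
  constructor <;> nlinarith [sq_nonneg (y j - q j), sq_nonneg ‖y - q‖]

lemma hasDecay_potential_mul_coherent (hħ : 0 < ħ) (x q p : Pos d) :
    HasDecay fun y => (C.potential x y : ℂ) * coherent ħ q p y :=
  hasDecay_mul_coherent hħ q p
    (Complex.measurable_ofReal.comp (C.measurable_potential x)).aestronglyMeasurable
    (C.ae_norm_potential_le x q)

lemma hasDecay_sqrt_potential_mul_coherent (hħ : 0 < ħ) (x q p : Pos d) :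
    HasDecay fun y => ((√(C.potential x y) : ℝ) : ℂ) * coherent ħ q p y := by
  refine hasDecay_mul_coherent hħ q p (M := 1 + (2 + 2 * ‖q - x‖ ^ 2))
    (Complex.measurable_ofReal.comp (C.measurable_potential x).sqrt).aestronglyMeasurable ?_
  filter_upwards [C.ae_norm_potential_le x q] with y hy
  rw [Complex.norm_real, Real.norm_of_nonneg (C.potential_nonneg x y)] at hy
  rw [Complex.norm_real, Real.norm_of_nonneg (Real.sqrt_nonneg _)]
  have h1 : √(C.potential x y) ≤ 1 + C.potential x y := by
    rw [Real.sqrt_le_left (by linarith [C.potential_nonneg x y])]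
    nlinarith [C.potential_nonneg x y]
  nlinarith [sq_nonneg ‖y - q‖]

lemma hasDecay_costExpr_coherent (hħ : 0 < ħ) (z : Pos d × Pos d) (q : Pos d) :
    HasDecay (C.costExpr ħ lam z (coherent ħ q z.2)) := by
  have h := ((C.hasDecay_potential_mul_coherent hħ z.1 q z.2).const_mul ((lam ^ 2 : ℝ) : ℂ)).add
    (HasDecay.sum (s := Finset.univ) fun j _ => hasDecay_momentum_momentum_coherent hħ q z.2 j)
  simpa only [← C.costExpr_eq] using h

lemma integral_conj_mul_costExpr (z : Pos d × Pos d) {Φ η : Pos d → ℂ}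
    (hV : Integrable fun y => conj (Φ y) * ((C.potential z.1 y : ℂ) * η y))
    (h : ∀ j, Integrable fun y => conj (Φ y) * momentum ħ z.2 j (momentum ħ z.2 j η) y) :
    ∫ y, conj (Φ y) * C.costExpr ħ lam z η y =
      ((lam ^ 2 : ℝ) : ℂ) * (∫ y, conj (Φ y) * ((C.potential z.1 y : ℂ) * η y)) +
      ∑ j, ∫ y, conj (Φ y) * momentum ħ z.2 j (momentum ħ z.2 j η) y := by
  have e : ∀ y, conj (Φ y) * C.costExpr ħ lam z η y =
      ((lam ^ 2 : ℝ) : ℂ) * (conj (Φ y) * ((C.potential z.1 y : ℂ) * η y)) +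
      ∑ j, conj (Φ y) * momentum ħ z.2 j (momentum ħ z.2 j η) y := fun y => by
    rw [costExpr_eq, mul_add, Finset.mul_sum]
    ring
  simp only [e]
  rw [integral_add (hV.const_mul _) (integrable_finsetSum _ fun j _ => h j), integral_const_mul,
    integral_finsetSum _ fun j _ => h j]

/-- The cost expression of coherent states, in the weak sense. -/
lemma integral_conj_mul_costExpr_coherent (hħ : 0 < ħ) (z : Pos d × Pos d) (q : Pos d)
    {Φ : Pos d → ℂ} (hΦ : ContDiff ℝ ∞ Φ) (hs : HasCompactSupport Φ) :
    ∫ y, conj (Φ y) * C.costExpr ħ lam z (coherent ħ q z.2) y =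
      ∫ y, conj (C.costExpr ħ lam z Φ y) * coherent ħ q z.2 y := by
  have hd := hasDecay_of_hasCompactSupport hΦ.continuous hs
  have hΦ1 := fun j => contDiff_momentum (ħ := ħ) z.2 j hΦ
  have hs1 := fun j => hasCompactSupport_momentum (ħ := ħ) z.2 j hs
  have hd1 := fun j => hasDecay_of_hasCompactSupport (hΦ1 j).continuous (hs1 j)
  have hd2 := fun j => hasDecay_of_hasCompactSupport
    (contDiff_momentum (ħ := ħ) z.2 j (hΦ1 j)).continuous
    (hasCompactSupport_momentum (ħ := ħ) z.2 j (hs1 j))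
  have hc := hasDecay_coherent hħ q z.2
  have hI : ∀ j, Integrable fun y =>
      conj (momentum ħ z.2 j (momentum ħ z.2 j Φ) y) * coherent ħ q z.2 y :=
    fun j => (hd2 j).integrable_conj_mul hc
  have hV := hd.integrable_conj_mul (C.hasDecay_potential_mul_coherent hħ z.1 q z.2)
  rw [C.integral_conj_mul_costExpr z hV
    fun j => hd.integrable_conj_mul (hasDecay_momentum_momentum_coherent hħ q z.2 j)]
  have e : ∀ y, conj (C.costExpr ħ lam z Φ y) * coherent ħ q z.2 y =
      ((lam ^ 2 : ℝ) : ℂ) * (conj (Φ y) * ((C.potential z.1 y : ℂ) * coherent ħ q z.2 y)) +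
      ∑ j, conj (momentum ħ z.2 j (momentum ħ z.2 j Φ) y) * coherent ħ q z.2 y := fun y => by
    rw [costExpr_eq, map_add, map_mul, map_mul, Complex.conj_ofReal, Complex.conj_ofReal, map_sum,
      add_mul, Finset.sum_mul]
    ring
  simp only [e]
  rw [integral_add (hV.const_mul _) (integrable_finsetSum _ fun j _ => hI j), integral_const_mul,
    integral_finsetSum _ fun j _ => hI j]
  congr 1
  refine Finset.sum_congr rfl fun j _ => ?_
  -- Two integrations by parts, moving one momentum factor at a time onto the test function.
  rw [integral_conj_mul_momentum_of_hasDecay hħ (hΦ.differentiable (by simp))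
    (differentiable_momentum_coherent hħ q z.2 j) hd (hasDecay_momentum_coherent hħ q z.2 j)
    (hd1 j) (hasDecay_momentum_momentum_coherent hħ q z.2 j),
    integral_conj_mul_momentum_of_hasDecay hħ ((hΦ1 j).differentiable (by simp))
    (differentiable_coherent q z.2) (hd1 j) hc (hd2 j) (hasDecay_momentum_coherent hħ q z.2 j)]

end Crystal


/-! ### The cost of a coherent state in the Bloch representation -/

section HasDecay

variable {d : ℕ} {a b : Pos d → ℂ}

lemma HasDecay.toL2_eq_smul_translate (ha : HasDecay a) (hb : HasDecay b) {θ : ℂ} {m : Pos d}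
    (h : ∀ y, b y = θ * a (y - m)) : hb.toL2 = θ • Crystal.translate m ha.toL2 := by
  refine Lp.ext ?_
  filter_upwards [hb.coeFn_toL2, Crystal.coeFn_translate m ha.toL2,
    Crystal.ae_comp_sub ha.coeFn_toL2 m, Lp.coeFn_smul θ (Crystal.translate m ha.toL2)]
    with y h1 h2 h3 h4
  rw [h1, h4, Pi.smul_apply, h2, h3, h, smul_eq_mul]

end HasDecay

namespace Crystal

variable {d : ℕ} {ħ lam : ℝ}

/-- The phase by which a coherent state is multiplied under a translation. -/
def transPhase (ħ : ℝ) (p m : Pos d) : ℂ := Complex.exp (Complex.I * ((⟪p, m⟫_ℝ / ħ : ℝ) : ℂ))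

lemma transPhase_ne_zero (p m : Pos d) : transPhase ħ p m ≠ 0 := Complex.exp_ne_zero _

lemma coherent_add_eq (q p m y : Pos d) :
    coherent ħ (q + m) p y = transPhase ħ p m * coherent ħ q p (y - m) := coherent_add q p m y

lemma momentum_coherent_add (hħ : 0 < ħ) (q p m y : Pos d) (j : Fin d) :
    momentum ħ p j (coherent ħ (q + m) p) y =
      transPhase ħ p m * momentum ħ p j (coherent ħ q p) (y - m) := by
  rw [momentum_coherent hħ, momentum_coherent hħ]
  simp only [coherent_add_eq, PiLp.add_apply, PiLp.sub_apply]
  push_cast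
  ring

lemma momentum_momentum_coherent_add (hħ : 0 < ħ) (q p m y : Pos d) (j : Fin d) :
    momentum ħ p j (momentum ħ p j (coherent ħ (q + m) p)) y =
      transPhase ħ p m * momentum ħ p j (momentum ħ p j (coherent ħ q p)) (y - m) := by
  rw [momentum_momentum_coherent hħ, momentum_momentum_coherent hħ]
  simp only [coherent_add_eq, PiLp.add_apply, PiLp.sub_apply]
  push_cast
  ring

variable (C : Crystal d)

/-- The potential is periodic in `y`, and the momentum is unchanged because moving the centre by `m`
keeps `p`; only the phase appears. -/
lemma costExpr_coherent_add (hħ : 0 < ħ) (z : Pos d × Pos d) (q : Pos d) {m : Pos d}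
    (hm : m ∈ C.L) (y : Pos d) : C.costExpr ħ lam z (coherent ħ (q + m) z.2) y =
      transPhase ħ z.2 m * C.costExpr ħ lam z (coherent ħ q z.2) (y - m) := by
  rw [costExpr_eq, costExpr_eq, C.potential_sub_lattice hm, coherent_add_eq]
  simp only [momentum_momentum_coherent_add hħ]
  rw [← Finset.mul_sum]
  ring

/-- The components of the gradient of the transportation cost, applied to a coherent state. -/
def costGrad (ħ lam : ℝ) (x q p : Pos d) : Option (Fin d) → Pos d → ℂ
  | none => fun y => (lam : ℂ) * (((√(C.potential x y) : ℝ) : ℂ) * coherent ħ q p y)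
  | some j => momentum ħ p j (coherent ħ q p)

lemma hasDecay_costGrad (hħ : 0 < ħ) (x q p : Pos d) (i : Option (Fin d)) :
    HasDecay (C.costGrad ħ lam x q p i) := by
  cases i with
  | none => exact (C.hasDecay_sqrt_potential_mul_coherent hħ x q p).const_mul _
  | some j => exact hasDecay_momentum_coherent hħ q p j

lemma costGrad_add (hħ : 0 < ħ) (x q p : Pos d) {m : Pos d} (hm : m ∈ C.L)
    (i : Option (Fin d)) (y : Pos d) : C.costGrad ħ lam x (q + m) p i y =
      transPhase ħ p m * C.costGrad ħ lam x q p i (y - m) := by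
  cases i with
  | none =>
    simp only [costGrad, C.potential_sub_lattice hm, coherent_add_eq]
    ring
  | some j => exact momentum_coherent_add hħ q p m y j

/-- The gradient of the cost at a coherent state, as elements of `L²`. -/
def gradL2 (hħ : 0 < ħ) (lam : ℝ) (z : Pos d × Pos d) (i : Option (Fin d)) : L2 d :=
  (C.hasDecay_costGrad (lam := lam) hħ z.1 z.1 z.2 i).toL2

/-- The cost operator applied to a coherent state. -/
def costL2 (hħ : 0 < ħ) (lam : ℝ) (z : Pos d × Pos d) : L2 d :=
  (C.hasDecay_costExpr_coherent (lam := lam) hħ z z.1).toL2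

lemma isAmalgam_costL2 (hħ : 0 < ħ) (lam : ℝ) (z : Pos d × Pos d) :
    C.IsAmalgam (C.costL2 hħ lam z) := HasDecay.isAmalgam _ C

lemma isAmalgam_gradL2 (hħ : 0 < ħ) (lam : ℝ) (z : Pos d × Pos d) (i : Option (Fin d)) :
    C.IsAmalgam (C.gradL2 hħ lam z i) := HasDecay.isAmalgam _ C

/-- The bounded field of the Bloch transforms of the cost operator at a coherent state. -/
def costField (hħ : 0 < ħ) (lam : ℝ) (z : Pos d × Pos d) : C.BddFiber :=
  (C.isAmalgam_costL2 hħ lam z).field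

/-- Up to a nonzero phase, the translate is the coherent state centred at `z.1 + m`, for which the
weak identity holds with the same cost; the phase cancels since the graph is linear. -/
lemma translate_mem_graph_cost (hħ : 0 < ħ) (z : Pos d × Pos d) {m : Pos d} (hm : m ∈ C.L) :
    (translate m (cohL2 hħ z), translate m (C.costL2 hħ lam z)) ∈ (C.cost ħ lam z).graph := by
  have h1 := (C.hasDecay_costExpr_coherent (lam := lam) hħ z z.1).toL2_eq_smul_translate
    (C.hasDecay_costExpr_coherent (lam := lam) hħ z (z.1 + m))
    (C.costExpr_coherent_add hħ z z.1 hm)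
  have h2 := (hasDecay_coherent hħ z.1 z.2).toL2_eq_smul_translate
    (hasDecay_coherent hħ (z.1 + m) z.2) (coherent_add_eq z.1 z.2 m)
  have h3 : ((hasDecay_coherent hħ (z.1 + m) z.2).toL2,
      (C.hasDecay_costExpr_coherent (lam := lam) hħ z (z.1 + m)).toL2) ∈
      (C.cost ħ lam z).graph := by
    rw [mem_graph_cost]
    intro Φ hΦ hs
    have e1 : ∫ y, conj (Φ y) * (C.hasDecay_costExpr_coherent (lam := lam) hħ z (z.1 + m)).toL2 y =
        ∫ y, conj (Φ y) * C.costExpr ħ lam z (coherent ħ (z.1 + m) z.2) y := by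
      refine integral_congr_ae ?_
      filter_upwards [(C.hasDecay_costExpr_coherent (lam := lam) hħ z (z.1 + m)).coeFn_toL2]
        with y hy
      rw [hy]
    have e2 : ∫ y, conj (C.costExpr ħ lam z Φ y) * (hasDecay_coherent hħ (z.1 + m) z.2).toL2 y =
        ∫ y, conj (C.costExpr ħ lam z Φ y) * coherent ħ (z.1 + m) z.2 y := by
      refine integral_congr_ae ?_
      filter_upwards [(hasDecay_coherent hħ (z.1 + m) z.2).coeFn_toL2] with y hy
      rw [hy]
    rw [e1, e2]
    exact C.integral_conj_mul_costExpr_coherent hħ z (z.1 + m) hΦ hs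
  rw [h1, h2] at h3
  have h4 := (C.cost ħ lam z).graph.smul_mem (transPhase ħ z.2 m)⁻¹ h3
  rwa [Prod.smul_mk, inv_smul_smul₀ (transPhase_ne_zero _ _),
    inv_smul_smul₀ (transPhase_ne_zero _ _)] at h4

-- Multiplying fibres by a character is translating. So `synth` forms superpositions of the
-- translates of `u`, each character giving a single translate.
variable {C} in
lemma synth_field_zoneChar {u : L2 d} (hu : C.IsAmalgam u) {m : Pos d} (hm : m ∈ C.L) :
    C.synth hu.field (C.zoneChar m) = translate m u := by
  refine C.bloch.injective (Lp.ext ?_)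
  rw [C.bloch_translate hm]
  filter_upwards [C.bloch_synth hu.field (C.zoneChar m), C.coeFn_charMul m (C.bloch u),
    C.coeFn_zoneChar m, hu.coeFn_field] with k h1 h2 h3 h4
  rw [h1, h2, h3, h4]

/-- The cost operator acts on packets of translated coherent states. -/
lemma synth_mem_graph_cost (hħ : 0 < ħ) (z : Pos d × Pos d) (β : Lp ℂ 2 C.zoneMeasure) :
    (C.synth (C.cohField hħ z) β, C.synth (C.costField hħ lam z) β) ∈ (C.cost ħ lam z).graph := by
  rw [mem_graph_cost]
  intro Φ hΦ hs
  rw [← HasDecay.inner_toL2_left (hasDecay_of_hasCompactSupport hΦ.continuous hs),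
    ← HasDecay.inner_toL2_left (C.hasDecay_costExpr_of_hasCompactSupport z hΦ hs)]
  -- For a fixed test function both sides are continuous and linear in `β`, so characters suffice,
  -- for which the packet is one translated coherent state.
  have h : (innerSL ℂ (hasDecay_of_hasCompactSupport hΦ.continuous hs).toL2).comp
      (C.synth (C.costField hħ lam z)) = (innerSL ℂ (C.hasDecay_costExpr_of_hasCompactSupport
        (ħ := ħ) (lam := lam) z hΦ hs).toL2).comp (C.synth (C.cohField hħ z)) := by
    refine C.ext_zoneChar fun m => ?_
    simp only [ContinuousLinearMap.comp_apply, innerSL_apply_apply]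
    rw [costField, cohField, synth_field_zoneChar _ m.2, synth_field_zoneChar _ m.2,
      HasDecay.inner_toL2_left, HasDecay.inner_toL2_left]
    exact (C.mem_graph_cost z _ _).1 (C.translate_mem_graph_cost hħ z m.2) Φ hΦ hs
  simpa using congrArg (fun T => T β) h

lemma inner_translate_eq_integral {m : Pos d} (hm : m ∈ C.L) (u v : L2 d) :
    ⟪translate m u, v⟫_ℂ =
      ∫ k, conj (planeWave k m) * ⟪C.bloch u k, C.bloch v k⟫_ℂ ∂C.zoneMeasure := by
  rw [← C.bloch.inner_map_map, C.bloch_translate hm, L2.inner_def]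
  refine integral_congr_ae ?_
  filter_upwards [C.coeFn_charMul m (C.bloch u)] with k hk
  rw [hk, inner_smul_left]

variable {C} in
lemma IsAmalgam.memLp_inner {u : L2 d} (hu : C.IsAmalgam u) (v : L2 d) :
    MemLp (fun k => ⟪C.bloch u k, C.bloch v k⟫_ℂ) 2 C.zoneMeasure := by
  refine (Lp.memLp (C.bloch v)).of_le_mul (c := ∑' ℓ : C.L, ‖C.cellAt ℓ u‖)
    ((Lp.aestronglyMeasurable _).inner (Lp.aestronglyMeasurable _)) ?_
  filter_upwards [hu.ae_norm_le] with k hk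
  exact (norm_inner_le_norm _ _).trans (mul_le_mul_of_nonneg_right hk (norm_nonneg _))

-- The Fourier coefficient at `m` of `k ↦ ⟨u_k, v_k⟩` is `⟨τ_m u, v⟩`. Identities between inner
-- products with all lattice translates thus become identities in almost every fibre.
variable {C} in
lemma ae_inner_bloch_eq_sum {ι : Type*} [Fintype ι] {u v : L2 d} {w : ι → L2 d}
    (hu : C.IsAmalgam u) (hw : ∀ i, C.IsAmalgam (w i))
    (h : ∀ m ∈ C.L, ⟪translate m u, v⟫_ℂ = ∑ i, ⟪translate m (w i), w i⟫_ℂ) :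
    ∀ᵐ k ∂C.zoneMeasure, ⟪C.bloch u k, C.bloch v k⟫_ℂ =
      ((∑ i, ‖C.bloch (w i) k‖ ^ 2 : ℝ) : ℂ) := by
  have hsum : MemLp (fun k => ∑ i, ⟪C.bloch (w i) k, C.bloch (w i) k⟫_ℂ) 2 C.zoneMeasure :=
    memLp_finsetSum _ fun i _ => (hw i).memLp_inner (w i)
  have hzero := C.ae_eq_zero_of_fourier ((hu.memLp_inner v).sub hsum) fun m hm => ?_
  · filter_upwards [hzero] with k hk
    rw [Pi.sub_apply, Pi.zero_apply, sub_eq_zero] at hk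
    rw [hk, Complex.ofReal_sum]
    refine Finset.sum_congr rfl fun i _ => ?_
    rw [inner_self_eq_norm_sq_to_K, Complex.ofReal_pow]
    rfl
  · have hI : ∀ {F : Pos d → ℂ}, MemLp F 2 C.zoneMeasure →
        Integrable (fun k => conj (planeWave k m) * F k) C.zoneMeasure := fun {F} hF => by
      refine (hF.integrable one_le_two).bdd_mul (c := 1)
        (Complex.continuous_conj.comp (continuous_planeWave_left m)).aestronglyMeasurable ?_
      exact ae_of_all _ fun k => by rw [RCLike.norm_conj, norm_planeWave]
    simp only [Pi.sub_apply, mul_sub, Finset.mul_sum]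
    rw [integral_sub (hI (hu.memLp_inner v))
      (integrable_finsetSum _ fun i _ => hI ((hw i).memLp_inner (w i))),
      integral_finsetSum _ fun i _ => hI ((hw i).memLp_inner (w i)),
      ← C.inner_translate_eq_integral hm, h m hm, sub_eq_zero]
    exact Finset.sum_congr rfl fun i _ => C.inner_translate_eq_integral hm _ _

/-- The cost is `∑ G_i* G_i` with `G_none` the multiplication by `λ√Θ` and the other `G_i` the
momenta. Up to the same phase on both sides, the translated state is the coherent state centred at
`q + m`, onto which one factor is moved by parts. -/
lemma inner_translate_cohL2_costL2 (hħ : 0 < ħ) (z : Pos d × Pos d) {m : Pos d} (hm : m ∈ C.L) :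
    ⟪translate m (cohL2 hħ z), C.costL2 hħ lam z⟫_ℂ =
      ∑ i, ⟪translate m (C.gradL2 hħ lam z i), C.gradL2 hħ lam z i⟫_ℂ := by
  have h2 := (hasDecay_coherent hħ z.1 z.2).toL2_eq_smul_translate
    (hasDecay_coherent hħ (z.1 + m) z.2) (coherent_add_eq z.1 z.2 m)
  have h1 := fun i => (C.hasDecay_costGrad (lam := lam) hħ z.1 z.1 z.2 i).toL2_eq_smul_translate
    (C.hasDecay_costGrad hħ z.1 (z.1 + m) z.2 i) (C.costGrad_add hħ z.1 z.1 z.2 hm i)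
  have hθ : conj (transPhase ħ z.2 m) ≠ 0 :=
    (map_ne_zero (starRingEnd ℂ)).2 (transPhase_ne_zero z.2 m)
  refine mul_left_cancel₀ hθ ?_
  rw [Finset.mul_sum]
  simp only [← inner_smul_left]
  simp only [gradL2, ← h1]
  rw [cohL2, ← h2, costL2, HasDecay.inner_toL2, C.integral_conj_mul_costExpr z
    ((hasDecay_coherent hħ (z.1 + m) z.2).integrable_conj_mul
      (C.hasDecay_potential_mul_coherent hħ z.1 z.1 z.2))
    fun j => (hasDecay_coherent hħ (z.1 + m) z.2).integrable_conj_mul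
      (hasDecay_momentum_momentum_coherent hħ z.1 z.2 j), Fintype.sum_option]
  simp only [HasDecay.inner_toL2]
  congr 1
  · rw [← integral_const_mul]
    refine integral_congr_ae (ae_of_all _ fun y => ?_)
    have hs : ((√(C.potential z.1 y) : ℝ) : ℂ) * ((√(C.potential z.1 y) : ℝ) : ℂ) =
        (C.potential z.1 y : ℂ) := by
      rw [← Complex.ofReal_mul, Real.mul_self_sqrt (C.potential_nonneg _ _)]
    simp only [costGrad, map_mul, Complex.conj_ofReal]
    rw [← hs]
    push_cast
    ring
  · refine Finset.sum_congr rfl fun j _ => ?_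
    simp only [costGrad]
    exact integral_conj_mul_momentum_of_hasDecay hħ (differentiable_coherent _ z.2)
      (differentiable_momentum_coherent hħ z.1 z.2 j) (hasDecay_coherent hħ _ z.2)
      (hasDecay_momentum_coherent hħ z.1 z.2 j) (hasDecay_momentum_coherent hħ _ z.2 j)
      (hasDecay_momentum_momentum_coherent hħ z.1 z.2 j)

/-- The fiberwise expectation of the cost. -/
lemma ae_inner_bloch_costL2 (hħ : 0 < ħ) (z : Pos d × Pos d) : ∀ᵐ k ∂C.zoneMeasure,
    ⟪C.bloch (cohL2 hħ z) k, C.bloch (C.costL2 hħ lam z) k⟫_ℂ =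
      ((∑ i, ‖C.bloch (C.gradL2 hħ lam z i) k‖ ^ 2 : ℝ) : ℂ) :=
  ae_inner_bloch_eq_sum (C.isAmalgam_cohL2 hħ z)
    (C.isAmalgam_gradL2 hħ lam z) fun _ hm => C.inner_translate_cohL2_costL2 hħ z hm

/-! ### The total cost of a coherent state -/

lemma norm_costGrad_add (hħ : 0 < ħ) (x p y : Pos d) (i : Option (Fin d)) :
    ‖C.costGrad ħ lam x x p i (y + x)‖ = ‖C.costGrad ħ lam 0 0 0 i y‖ := by
  have h : ‖coherent ħ x p (y + x)‖ = ‖coherent ħ 0 0 y‖ := by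
    rw [norm_coherent hħ, norm_coherent hħ, add_sub_cancel_right, sub_zero]
  cases i with
  | none =>
    have := C.potential_add_add 0 y x
    rw [zero_add] at this
    simp only [costGrad, norm_mul, h, this]
  | some j => simp [costGrad, momentum_coherent hħ, h]

/-- The potential and the Gaussian move together and `p` enters only through a phase. Hence the cost
density is `f` times a constant, and its measurability is that of `f`. -/
lemma norm_gradL2_sq_eq (hħ : 0 < ħ) (z : Pos d × Pos d) (i : Option (Fin d)) :
    ‖C.gradL2 hħ lam z i‖ ^ 2 = ‖C.gradL2 hħ lam 0 i‖ ^ 2 := by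
  rw [gradL2, gradL2, HasDecay.norm_toL2_sq, HasDecay.norm_toL2_sq,
    ← integral_add_right_eq_self (fun y => ‖C.costGrad ħ lam z.1 z.1 z.2 i y‖ ^ 2) z.1]
  simp only [C.norm_costGrad_add hħ]
  rfl

/-- With `ψ` the coherent state and `P` its momentum operator, `P²ψ = (ħ - (y_j - q_j)²)ψ` and `|Pψ|
= |y_j - q_j||ψ|`. So `‖Pψ‖² = ⟨ψ, P²ψ⟩ = ħ - ‖Pψ‖²`, which gives `ħ/2` without computing a Gaussian
moment. -/
lemma integral_norm_momentum_coherent_sq (hħ : 0 < ħ) (z : Pos d × Pos d) (j : Fin d) :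
    ∫ y, ‖momentum ħ z.2 j (coherent ħ z.1 z.2) y‖ ^ 2 = ħ / 2 := by
  have h1 := integral_conj_mul_momentum_of_hasDecay hħ (differentiable_coherent z.1 z.2)
    (differentiable_momentum_coherent hħ z.1 z.2 j) (hasDecay_coherent hħ z.1 z.2)
    (hasDecay_momentum_coherent hħ z.1 z.2 j) (hasDecay_momentum_coherent hħ z.1 z.2 j)
    (hasDecay_momentum_momentum_coherent hħ z.1 z.2 j)
  have e1 : ∀ y, conj (coherent ħ z.1 z.2 y) *
      momentum ħ z.2 j (momentum ħ z.2 j (coherent ħ z.1 z.2)) y =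
      ((ħ * ‖coherent ħ z.1 z.2 y‖ ^ 2 - ‖momentum ħ z.2 j (coherent ħ z.1 z.2) y‖ ^ 2 : ℝ) : ℂ) :=
    fun y => by
      rw [momentum_momentum_coherent hħ, momentum_coherent hħ, norm_mul, norm_mul, norm_neg,
        Complex.norm_I, one_mul, Complex.norm_real, Real.norm_eq_abs, mul_pow, sq_abs]
      push_cast
      rw [← Complex.conj_mul']
      ring
  simp only [e1, Complex.conj_mul'] at h1
  have e2 : ∀ y, (‖momentum ħ z.2 j (coherent ħ z.1 z.2) y‖ : ℂ) ^ 2 =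
      ((‖momentum ħ z.2 j (coherent ħ z.1 z.2) y‖ ^ 2 : ℝ) : ℂ) := fun y => by push_cast; rfl
  simp only [e2] at h1
  rw [integral_complex_ofReal, integral_complex_ofReal] at h1
  have h2 := Complex.ofReal_injective h1
  have hn := (hasDecay_coherent hħ z.1 z.2).norm_toL2_sq
  have hn2 : ‖(hasDecay_coherent hħ z.1 z.2).toL2‖ = 1 := norm_cohL2 hħ z
  rw [hn2, one_pow] at hn
  rw [integral_sub ((hasDecay_coherent hħ z.1 z.2).integrable_norm_sq.const_mul ħ)
    (hasDecay_momentum_coherent hħ z.1 z.2 j).integrable_norm_sq, integral_const_mul, ← hn] at h2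
  linarith

/-- The potential is at most `‖y - q‖²` almost everywhere, and `‖y - q‖²|ψ|²` is the sum of the
squared momentum components. Thus the potential term is at most `λ²` times the momentum term `dħ/2`.
-/
lemma sum_norm_gradL2_sq_le (hħ : 0 < ħ) (z : Pos d × Pos d) :
    ∑ i, ‖C.gradL2 hħ lam z i‖ ^ 2 ≤ (1 + lam ^ 2) / 2 * d * ħ := by
  have hsome : ∀ j, ‖C.gradL2 hħ lam z (some j)‖ ^ 2 = ħ / 2 := fun j => by
    rw [gradL2, HasDecay.norm_toL2_sq]
    exact integral_norm_momentum_coherent_sq hħ z j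
  have hnone : ‖C.gradL2 hħ lam z none‖ ^ 2 ≤ lam ^ 2 * (d * (ħ / 2)) := by
    have e : (d * (ħ / 2) : ℝ) =
        ∫ y, ∑ j, ‖momentum ħ z.2 j (coherent ħ z.1 z.2) y‖ ^ 2 := by
      rw [integral_finsetSum _ fun j _ => (hasDecay_momentum_coherent hħ z.1 z.2 j).integrable_norm_sq]
      simp [integral_norm_momentum_coherent_sq hħ]
    rw [gradL2, HasDecay.norm_toL2_sq, e, ← integral_const_mul]
    refine integral_mono_ae (C.hasDecay_costGrad hħ z.1 z.1 z.2 none).integrable_norm_sq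
      ((integrable_finsetSum _ fun j _ =>
        (hasDecay_momentum_coherent hħ z.1 z.2 j).integrable_norm_sq).const_mul _) ?_
    filter_upwards [C.ae_potential_le z.1] with y hy
    have e1 : ∑ j, ‖momentum ħ z.2 j (coherent ħ z.1 z.2) y‖ ^ 2 =
        ‖y - z.1‖ ^ 2 * ‖coherent ħ z.1 z.2 y‖ ^ 2 := by
      simp only [momentum_coherent hħ, norm_mul, norm_neg, Complex.norm_I, one_mul,
        Complex.norm_real, mul_pow]
      rw [← Finset.sum_mul, EuclideanSpace.norm_sq_eq]
      rfl
    have e2 : ‖C.costGrad ħ lam z.1 z.1 z.2 none y‖ ^ 2 =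
        lam ^ 2 * (C.potential z.1 y * ‖coherent ħ z.1 z.2 y‖ ^ 2) := by
      simp only [costGrad, norm_mul, Complex.norm_real, mul_pow, Real.norm_eq_abs, sq_abs,
        Real.sq_sqrt (C.potential_nonneg z.1 y)]
    rw [e1, e2]
    gcongr
  rw [Fintype.sum_option]
  simp only [hsome, Finset.sum_const, Finset.card_univ, Fintype.card_fin, nsmul_eq_mul]
  linarith

end Crystal


/-! ### Cost of fibered operators -/

namespace Crystal

variable {d : ℕ} (C : Crystal d)

lemma lintegral_norm_bloch_sq (u : L2 d) :
    ∫⁻ k, ENNReal.ofReal (‖C.bloch u k‖ ^ 2) ∂C.zoneMeasure = ENNReal.ofReal (‖u‖ ^ 2) := by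
  have h := lintegral_enorm_sq_eq (C.bloch u)
  rw [← ofReal_norm, ← ENNReal.ofReal_pow (norm_nonneg _), C.bloch.norm_map] at h
  rw [← h]
  refine lintegral_congr fun k => ?_
  rw [← ofReal_norm, ENNReal.ofReal_pow (norm_nonneg _)]

lemma fiberOp_ext {A B : L2 d →L[ℂ] L2 d}
    (h : ∀ φ, C.bloch (A φ) =ᵐ[C.zoneMeasure] C.bloch (B φ)) : A = B :=
  ContinuousLinearMap.ext fun φ => C.bloch.injective (Lp.ext (h φ))

lemma fiberOp_smul_smul (c : ℂ) (a b : C.BddFiber) :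
    C.fiberOp (c • a) (c • b) = ((‖c‖ ^ 2 : ℝ) : ℂ) • C.fiberOp a b := by
  rw [fiberOp, map_smul, map_smul, map_smulₛₗ, ContinuousLinearMap.comp_smulₛₗ,
    ContinuousLinearMap.smul_comp, smul_smul, ← fiberOp, Complex.ofReal_pow, ← Complex.conj_mul']
  rfl

lemma hasPeriodicTrace_smul_fiberOp {s : ℝ} (hs : 0 ≤ s) (a : C.BddFiber) :
    C.HasPeriodicTrace (totalPMap ((s : ℂ) • C.fiberOp a a))
      (ENNReal.ofReal s * ∫⁻ k, ENNReal.ofReal (‖a k‖ ^ 2) ∂C.zoneMeasure) := by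
  have h := C.hasPeriodicTrace_fiberOp (((√s : ℝ) : ℂ) • a)
  have hn : ‖((√s : ℝ) : ℂ)‖ ^ 2 = s := by
    rw [Complex.norm_real, Real.norm_of_nonneg (Real.sqrt_nonneg s), Real.sq_sqrt hs]
  rw [fiberOp_smul_smul, hn] at h
  convert h using 1
  rw [← lintegral_const_mul' _ _ ENNReal.ofReal_ne_top]
  refine lintegral_congr_ae ?_
  filter_upwards [Lp.coeFn_smul ((√s : ℝ) : ℂ) a] with k hk
  rw [hk, Pi.smul_apply, norm_smul, mul_pow, hn, ENNReal.ofReal_mul hs]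

variable {C}

/-- Product of a bounded field with a bounded function. -/
lemma exists_field_smul {r : Pos d → ℝ} (hr : AEStronglyMeasurable r C.zoneMeasure) {B : ℝ}
    (hB : ∀ᵐ k ∂C.zoneMeasure, |r k| ≤ B) (a : C.BddFiber) :
    ∃ a' : C.BddFiber, a' =ᵐ[C.zoneMeasure] fun k => (r k : ℂ) • a k := by
  have hm : MemLp (fun k => (r k : ℂ) • a k) ⊤ C.zoneMeasure := by
    refine memLp_top_of_bound ((Complex.continuous_ofReal.comp_aestronglyMeasurable hr).smul
      (Lp.aestronglyMeasurable a)) (B * ‖a‖) ?_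
    filter_upwards [hB, Lp.ae_norm_le_of_top a] with k h1 h2
    rw [norm_smul, Complex.norm_real]
    exact mul_le_mul h1 h2 (norm_nonneg _) ((abs_nonneg _).trans h1)
  exact ⟨hm.toLp _, hm.coeFn_toLp⟩

lemma exists_L2_smul {r : Pos d → ℝ} (hr : AEStronglyMeasurable r C.zoneMeasure) {B : ℝ}
    (hB : ∀ᵐ k ∂C.zoneMeasure, |r k| ≤ B) (β : Lp ℂ 2 C.zoneMeasure) :
    ∃ β' : Lp ℂ 2 C.zoneMeasure, β' =ᵐ[C.zoneMeasure] fun k => (r k : ℂ) * β k := by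
  have hm : MemLp (fun k => (r k : ℂ) * β k) 2 C.zoneMeasure := by
    refine (Lp.memLp β).of_le_mul (c := B)
      ((Complex.continuous_ofReal.comp_aestronglyMeasurable hr).mul
      (Lp.aestronglyMeasurable β)) ?_
    filter_upwards [hB] with k h1
    rw [norm_mul, Complex.norm_real]
    exact mul_le_mul_of_nonneg_right h1 (norm_nonneg _)
  exact ⟨hm.toLp _, hm.coeFn_toLp⟩

/-- The square root of a fiberwise rank one operator, and the sandwiched cost. -/
lemma exists_sqrt_fiberOp {A : L2 d →ₗ.[ℂ] L2 d} {c g : C.BddFiber}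
    (hA : ∀ β, (C.synth c β, C.synth g β) ∈ A.graph) {δ : ℝ} (hδ : 0 < δ)
    (hc : ∀ᵐ k ∂C.zoneMeasure, δ ≤ ‖c k‖) {D : Pos d → ℝ} (hD0 : ∀ k, 0 ≤ D k)
    (hDm : AEStronglyMeasurable D C.zoneMeasure) {B : ℝ} (hDB : ∀ᵐ k ∂C.zoneMeasure, D k ≤ B)
    (hD : ∀ᵐ k ∂C.zoneMeasure, ⟪c k, g k⟫_ℂ = D k) {s : ℝ} (hs : 0 ≤ s) :
    ∃ S, IsOpSqrt (totalPMap ((s : ℂ) • C.fiberOp c c)) S ∧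
      C.HasPeriodicTrace (opMul S (opMul A S))
        (ENNReal.ofReal s * ∫⁻ k, ENNReal.ofReal (D k) ∂C.zoneMeasure) := by
  have hcm : AEStronglyMeasurable (fun k => ‖c k‖) C.zoneMeasure := (Lp.aestronglyMeasurable c).norm
  -- The square root of `s|c⟩⟨c|` is `√s ‖c‖⁻¹ |c⟩⟨c| = |a⟩⟨a|` with `a = r c` and `r² = √s/‖c‖`.
  set r : Pos d → ℝ := fun k => √(√s / ‖c k‖) with hr
  have hr2 : ∀ k, r k * r k = √s / ‖c k‖ := fun k => Real.mul_self_sqrt (by positivity)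
  have hrm : AEStronglyMeasurable r C.zoneMeasure :=
    (((hcm.aemeasurable.const_div _)).sqrt).aestronglyMeasurable
  have hrB : ∀ᵐ k ∂C.zoneMeasure, |r k| ≤ √(√s / δ) := by
    filter_upwards [hc] with k hk
    rw [hr, abs_of_nonneg (Real.sqrt_nonneg _)]
    gcongr
  have htm : AEStronglyMeasurable (fun k => √s / ‖c k‖ * √(D k)) C.zoneMeasure :=
    ((hcm.aemeasurable.const_div _).mul hDm.aemeasurable.sqrt).aestronglyMeasurable
  have htB : ∀ᵐ k ∂C.zoneMeasure, |√s / ‖c k‖ * √(D k)| ≤ √s / δ * √B := by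
    filter_upwards [hc, hDB] with k hk hk2
    rw [abs_of_nonneg (by positivity)]
    gcongr
  -- Here `b = r g` plays the role of `A` applied to `a`; the lower bound on `‖c‖` keeps `r`, and so
  -- `b`, bounded. The sandwich has fibres `⟨a,b⟩|a⟩⟨a| = |t⟩⟨t|`, and `‖t‖² = sD`.
  obtain ⟨a, ha⟩ := exists_field_smul hrm hrB c
  obtain ⟨b, hb⟩ := exists_field_smul hrm hrB g
  obtain ⟨t, ht⟩ := exists_field_smul htm htB c
  have hSS : (C.fiberOp a a).comp (C.fiberOp a a) = (s : ℂ) • C.fiberOp c c := by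
    refine C.fiberOp_ext fun φ => ?_
    rw [ContinuousLinearMap.comp_apply, _root_.smul_apply, map_smul]
    filter_upwards [C.bloch_fiberOp a a (C.fiberOp a a φ), C.bloch_fiberOp a a φ,
      C.bloch_fiberOp c c φ, Lp.coeFn_smul (s : ℂ) (C.bloch (C.fiberOp c c φ)), ha, hc]
      with k h1 h2 h3 h4 h5 h6
    have hk : ‖c k‖ ≠ 0 := (hδ.trans_le h6).ne'
    have hself : ⟪c k, c k⟫_ℂ = ((‖c k‖ ^ 2 : ℝ) : ℂ) := by
      rw [inner_self_eq_norm_sq_to_K, Complex.ofReal_pow]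
      rfl
    rw [h1, h2, h4, Pi.smul_apply, h3, h5]
    simp only [inner_smul_left, inner_smul_right, smul_smul, Complex.conj_ofReal, hself]
    congr 1
    have e : (s : ℂ) = ((r k * r k) * (r k * r k) * (‖c k‖ ^ 2) : ℝ) := by
      rw [hr2, div_mul_div_comm, Real.mul_self_sqrt hs, ← sq, div_mul_cancel₀ _ (by positivity)]
    rw [e]
    push_cast
    ring
  have hK : (C.fiberOp a a).comp (C.fiberOp b a) = C.fiberOp t t := by
    refine C.fiberOp_ext fun φ => ?_
    rw [ContinuousLinearMap.comp_apply]
    filter_upwards [C.bloch_fiberOp a a (C.fiberOp b a φ), C.bloch_fiberOp b a φ,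
      C.bloch_fiberOp t t φ, ha, hb, ht, hD] with k h1 h2 h3 h4 h5 h6 h7
    rw [h1, h2, h3, h4, h5, h6]
    simp only [inner_smul_left, inner_smul_right, smul_smul, Complex.conj_ofReal, h7]
    congr 1
    have e : (D k : ℂ) = ((√(D k) * √(D k) : ℝ) : ℂ) := by rw [Real.mul_self_sqrt (hD0 k)]
    rw [← hr2, e]
    push_cast
    ring
  have hmul : opMul A (totalPMap (C.fiberOp a a)) = totalPMap (C.fiberOp b a) := by
    refine opMul_eq_totalPMap rfl fun φ => ?_
    -- The factor `r` is moved from the field to the coefficient: the image of `φ` becomes a packet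
    -- built on `c`, on which the action of `A` is given by `hA`.
    obtain ⟨β, hβ⟩ := exists_L2_smul hrm hrB ((C.synth a).adjoint φ)
    have e : ∀ v w : C.BddFiber, w =ᵐ[C.zoneMeasure] (fun k => (r k : ℂ) • v k) →
        C.fiberOp w a φ = C.synth v β := fun v w hw => by
      refine C.bloch.injective (Lp.ext ?_)
      rw [fiberOp, ContinuousLinearMap.comp_apply]
      filter_upwards [C.bloch_synth w ((C.synth a).adjoint φ), C.bloch_synth v β, hβ, hw]
        with k h1 h2 h3 h4
      rw [h1, h2, h3, h4, smul_smul, mul_comm]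
    rw [e c a ha, e g b hb]
    exact hA β
  refine ⟨totalPMap (C.fiberOp a a), ⟨?_, ?_, ?_⟩, ?_⟩
  · exact (C.fiberOp_mem_SPlus a).1
  · exact (C.fiberOp_mem_SPlus a).2.1
  · rw [opMul_totalPMap, hSS]
  · rw [hmul, opMul_totalPMap, hK]
    convert C.hasPeriodicTrace_fiberOp t using 1
    rw [← lintegral_const_mul' _ _ ENNReal.ofReal_ne_top]
    refine lintegral_congr_ae ?_
    filter_upwards [ht, hc] with k h1 h2
    have hk : ‖c k‖ ≠ 0 := (hδ.trans_le h2).ne'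
    rw [h1, norm_smul, Complex.norm_real, Real.norm_of_nonneg (by positivity), mul_pow, mul_pow,
      div_pow, Real.sq_sqrt hs, Real.sq_sqrt (hD0 k), ← ENNReal.ofReal_mul hs]
    congr 1
    field_simp

/-! ### The coupling with the Töplitz operator -/

variable (C) {ħ lam : ℝ}

/-- The periodization of the projection on a coherent state. -/
def cohOp (hħ : 0 < ħ) (z : Pos d × Pos d) : L2 d →L[ℂ] L2 d :=
  C.fiberOp (C.cohField hħ z) (C.cohField hħ z)

lemma continuous_cohOp (hħ : 0 < ħ) : Continuous (C.cohOp hħ) :=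
  C.continuous_fiberOp_self.comp (C.continuous_cohField hħ)

lemma re_inner_cohOp_nonneg (hħ : 0 < ħ) (z : Pos d × Pos d) (φ : L2 d) :
    0 ≤ (⟪φ, C.cohOp hħ z φ⟫_ℂ).re := by
  rw [cohOp, re_inner_fiberOp_self]
  positivity

/-- Moving the centre by a lattice vector multiplies each fibre by a number of modulus one, which
drops out of `|c⟩⟨c|`. -/
lemma cohOp_add (hħ : 0 < ħ) {m : Pos d} (hm : m ∈ C.L) (x ξ : Pos d) :
    C.cohOp hħ (x + m, ξ) = C.cohOp hħ (x, ξ) := by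
  refine C.fiberOp_ext fun φ => ?_
  have h := congrArg C.bloch (translate_cohL2 hħ (x, ξ) m)
  rw [map_smul, C.bloch_translate hm] at h
  change C.bloch (cohL2 hħ (x + m, ξ)) = transPhase ħ ξ m • _ at h
  have hθ : conj (transPhase ħ ξ m) * transPhase ħ ξ m = 1 := by
    rw [Complex.conj_mul', transPhase, Complex.norm_exp_I_mul_ofReal]
    norm_num
  filter_upwards [C.bloch_fiberOp (C.cohField hħ (x + m, ξ)) (C.cohField hħ (x + m, ξ)) φ,
    C.bloch_fiberOp (C.cohField hħ (x, ξ)) (C.cohField hħ (x, ξ)) φ,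
    (C.isAmalgam_cohL2 hħ (x + m, ξ)).coeFn_field, (C.isAmalgam_cohL2 hħ (x, ξ)).coeFn_field,
    Lp.coeFn_smul (transPhase ħ ξ m) (C.charMul m (C.bloch (cohL2 hħ (x, ξ)))),
    C.coeFn_charMul m (C.bloch (cohL2 hħ (x, ξ)))] with k h1 h2 h3 h4 h5 h6
  rw [cohOp, h1, cohOp, h2, cohField, h3, cohField, h4, h, h5, Pi.smul_apply, h6]
  simp only [inner_smul_left, smul_smul, map_mul]
  congr 1
  have hw : conj (planeWave k m) * planeWave k m = 1 := by
    rw [Complex.conj_mul', norm_planeWave]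
    norm_num
  linear_combination (⟪C.bloch (cohL2 hħ (x, ξ)) k, C.bloch φ k⟫_ℂ *
    (conj (planeWave k m) * planeWave k m)) * hθ + ⟪C.bloch (cohL2 hħ (x, ξ)) k, C.bloch φ k⟫_ℂ * hw

/-- The coupling of `f` with its Töplitz operator. -/
def cohCoupling (hħ : 0 < ħ) (f : Pos d × Pos d → ℝ) (z : Pos d × Pos d) : L2 d →ₗ.[ℂ] L2 d :=
  totalPMap ((f z : ℂ) • C.cohOp hħ z)

/-- By unitarity of the Bloch transform, the zone average of `‖c_k‖²` is the squared norm of the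
coherent state, that is `1`. -/
lemma hasPeriodicTrace_cohCoupling (hħ : 0 < ħ) {f : Pos d × Pos d → ℝ} {z : Pos d × Pos d}
    (hf : 0 ≤ f z) : C.HasPeriodicTrace (C.cohCoupling hħ f z) (ENNReal.ofReal (f z)) := by
  have h : ∫⁻ k, ENNReal.ofReal (‖C.cohField hħ z k‖ ^ 2) ∂C.zoneMeasure = 1 := by
    rw [← ENNReal.ofReal_one, ← one_pow 2, ← norm_cohL2 hħ z, ← lintegral_norm_bloch_sq]
    refine lintegral_congr_ae ?_
    filter_upwards [(C.isAmalgam_cohL2 hħ z).coeFn_field] with k hk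
    rw [cohField, hk]
  have := C.hasPeriodicTrace_smul_fiberOp hf (C.cohField hħ z)
  rwa [h, mul_one] at this

lemma exists_sqrt_cohCoupling (hħ : 0 < ħ) {f : Pos d × Pos d → ℝ} {z : Pos d × Pos d}
    (hf : 0 ≤ f z) : ∃ S, IsOpSqrt (C.cohCoupling hħ f z) S ∧
      C.HasPeriodicTrace (opMul S (opMul (C.cost ħ lam z) S))
        (ENNReal.ofReal (f z * ∑ i, ‖C.gradL2 hħ lam 0 i‖ ^ 2)) := by
  obtain ⟨δ, hδ, hδc⟩ := C.exists_le_norm_bloch_cohL2 hħ z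
  have hfield := (C.isAmalgam_cohL2 hħ z).coeFn_field
  have hbd : ∀ᵐ k ∂C.zoneMeasure, ∑ i, ‖C.bloch (C.gradL2 hħ lam z i) k‖ ^ 2 ≤
      ∑ i, (∑' ℓ : C.L, ‖C.cellAt ℓ (C.gradL2 hħ lam z i)‖) ^ 2 := by
    filter_upwards [ae_all_iff.2 fun i => (C.isAmalgam_gradL2 hħ lam z i).ae_norm_le] with k hk
    gcongr with i
    exact hk i
  obtain ⟨S, h1, h2⟩ := exists_sqrt_fiberOp (C := C) (c := C.cohField hħ z)
    (g := C.costField hħ lam z) (D := fun k => ∑ i, ‖C.bloch (C.gradL2 hħ lam z i) k‖ ^ 2)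
    (C.synth_mem_graph_cost hħ z) hδ
    (by
      filter_upwards [hfield, hδc] with k h1 h2
      rwa [cohField, h1])
    (fun k => by positivity)
    (Finset.aestronglyMeasurable_fun_sum _ fun i _ => (Lp.aestronglyMeasurable _).norm.pow 2) hbd
    (by
      filter_upwards [hfield, (C.isAmalgam_costL2 hħ lam z).coeFn_field,
        C.ae_inner_bloch_costL2 (lam := lam) hħ z] with k h1 h2 h3
      rw [cohField, h1, costField, h2, h3]) hf
  refine ⟨S, h1, ?_⟩
  convert h2 using 1
  rw [ENNReal.ofReal_mul hf, ENNReal.ofReal_sum_of_nonneg fun i _ => by positivity]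
  congr 1
  simp only [ENNReal.ofReal_sum_of_nonneg fun i _ => sq_nonneg _]
  rw [lintegral_finsetSum']
  · refine Finset.sum_congr rfl fun i _ => ?_
    rw [lintegral_norm_bloch_sq, C.norm_gradL2_sq_eq hħ z]
  · exact fun i _ => ((Lp.aestronglyMeasurable _).norm.pow 2).aemeasurable.ennreal_ofReal

-- The integral over the cell is `1`, whereas it would be `0` by convention if `f` were not
-- integrable.
variable {C} in
lemma IsPeriodicDensity.integrableOn {f : Pos d × Pos d → ℝ} (hf : C.IsPeriodicDensity f) :
    IntegrableOn f C.phaseCell := by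
  by_contra h
  have := hf.integral_eq_one
  rw [integral_undef h] at this
  exact zero_ne_one this

lemma hasCost_cohCoupling (hħ : 0 < ħ) {f : Pos d × Pos d → ℝ} (hf : C.IsPeriodicDensity f) :
    C.HasCost ħ lam (C.cohCoupling hħ f)
      (ENNReal.ofReal (∑ i, ‖C.gradL2 hħ lam 0 i‖ ^ 2)) := by
  have hI : 0 ≤ ∑ i, ‖C.gradL2 hħ lam 0 i‖ ^ 2 := by positivity
  have hint := hf.integrableOn
  have hm : AEMeasurable f (volume.restrict C.phaseCell) := hint.1.aemeasurable
  refine ⟨fun z => ENNReal.ofReal (f z * ∑ i, ‖C.gradL2 hħ lam 0 i‖ ^ 2),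
    (hm.mul_const _).ennreal_ofReal,
    ae_of_all _ fun z => C.exists_sqrt_cohCoupling hħ (hf.nonneg z), ?_⟩
  simp only [ENNReal.ofReal_mul (hf.nonneg _)]
  rw [lintegral_mul_const'' _ hm.ennreal_ofReal, ← ofReal_integral_eq_lintegral_ofReal hint
    (ae_of_all _ hf.nonneg), hf.integral_eq_one, ENNReal.ofReal_one, one_mul]

end Crystal


/-! ### The kernel of the Töplitz operator -/

namespace Crystal

variable {d : ℕ} (C : Crystal d)

lemma orthonormal_zoneChar : Orthonormal ℂ fun m : C.L => C.zoneChar m := by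
  classical
  rw [orthonormal_iff_ite]
  intro m n
  have h : ⟪C.zoneChar m, C.zoneChar n⟫_ℂ = ∫ k, planeWave k ((n : Pos d) - m) ∂C.zoneMeasure := by
    rw [inner_zoneChar_left]
    refine integral_congr_ae ?_
    filter_upwards [C.coeFn_zoneChar n] with k hk
    rw [hk, conj_planeWave, ← planeWave_add, neg_add_eq_sub]
  rw [h]
  split_ifs with hmn
  · subst hmn
    simp [planeWave_zero]
  · refine C.integral_planeWave_of_ne_zero (C.L.sub_mem n.2 m.2) ?_
    rw [sub_ne_zero]
    exact fun h => hmn (Subtype.ext h.symm)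

lemma hasSum_zoneChar (α : Lp ℂ 2 C.zoneMeasure) :
    HasSum (fun m : C.L => ⟪C.zoneChar m, α⟫_ℂ • C.zoneChar m) α := by
  have h := (HilbertBasis.mk C.orthonormal_zoneChar
    C.span_zoneChar_closure_eq_top.ge).hasSum_repr α
  simpa only [HilbertBasis.repr_apply_apply, HilbertBasis.coe_mk] using h

lemma norm_translate (m : Pos d) (u : L2 d) : ‖translate m u‖ = ‖u‖ :=
  (translateₗᵢ m).norm_map u

variable {ħ : ℝ} (hħ : 0 < ħ)

lemma inner_zoneChar_adjoint_synth (z : Pos d × Pos d) {m : Pos d} (hm : m ∈ C.L) (φ : L2 d) :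
    ⟪C.zoneChar m, (C.synth (C.cohField hħ z)).adjoint φ⟫_ℂ = ⟪translate m (cohL2 hħ z), φ⟫_ℂ := by
  rw [ContinuousLinearMap.adjoint_inner_right, cohField, synth_field_zoneChar _ hm]

/-- The adjoint of `synth` applied to `φ` is expanded in the orthonormal basis of characters, and
`synth` sends each character back to a translate. -/
lemma hasSum_cohOp (z : Pos d × Pos d) (φ : L2 d) :
    HasSum (fun m : C.L => ⟪translate m (cohL2 hħ z), φ⟫_ℂ • translate m (cohL2 hħ z))
      (C.cohOp hħ z φ) := by
  have h := (C.hasSum_zoneChar ((C.synth (C.cohField hħ z)).adjoint φ)).mapL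
    (C.synth (C.cohField hħ z))
  refine h.congr_fun fun m => ?_
  rw [map_smul, C.inner_zoneChar_adjoint_synth hħ z m.2, cohField, synth_field_zoneChar _ m.2]

/-- The pointwise value of the periodized projection on a coherent state. -/
def cohValue (φ : L2 d) (z : Pos d × Pos d) (y : Pos d) : ℂ :=
  ∑' m : C.L, ⟪translate m (cohL2 hħ z), φ⟫_ℂ * coherent ħ z.1 z.2 (y - m)

lemma decayWeight_neg (y : Pos d) : decayWeight (-y) = decayWeight y := by
  rw [decayWeight, norm_neg, decayWeight]

lemma exists_cohValue_term_le : ∃ K : ℝ, 0 ≤ K ∧ ∀ (φ : L2 d) (z : Pos d × Pos d) (y m : Pos d),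
    ‖⟪translate m (cohL2 hħ z), φ⟫_ℂ * coherent ħ z.1 z.2 (y - m)‖ ≤
      K * ‖φ‖ * (1 + ‖z.1‖) ^ (d + 1) * (1 + ‖y‖) ^ (d + 1) * decayWeight m := by
  obtain ⟨K, hK, h⟩ := exists_coherent_decay (d := d) hħ
  refine ⟨K, hK, fun φ z y m => ?_⟩
  rw [norm_mul]
  have h1 : ‖⟪translate m (cohL2 hħ z), φ⟫_ℂ‖ ≤ ‖φ‖ := by
    refine (norm_inner_le_norm _ _).trans ?_
    rw [norm_translate, norm_cohL2, one_mul]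
  have h2 := norm_coherent_le (h z.1 z.2 (y - m))
  have h3 := decayWeight_add_le y (-m)
  rw [decayWeight_neg, ← sub_eq_add_neg] at h3
  calc _ ≤ ‖φ‖ * (K * (1 + ‖z.1‖) ^ (d + 1) * ((1 + ‖y‖) ^ (d + 1) * decayWeight m)) := by
        refine mul_le_mul h1 (h2.trans ?_) (norm_nonneg _) (norm_nonneg _)
        exact mul_le_mul_of_nonneg_left h3 (by positivity)
    _ = _ := by ring

lemma summable_cohValue (φ : L2 d) (z : Pos d × Pos d) (y : Pos d) :
    Summable fun m : C.L => ⟪translate m (cohL2 hħ z), φ⟫_ℂ * coherent ħ z.1 z.2 (y - m) := by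
  obtain ⟨K, -, h⟩ := exists_cohValue_term_le (d := d) hħ
  exact Summable.of_norm_bounded ((summable_decayWeight C.L).mul_left _) fun m => h φ z y m

lemma exists_norm_cohValue_le : ∃ K : ℝ, 0 ≤ K ∧ ∀ (φ : L2 d) (z : Pos d × Pos d) (y : Pos d),
    ‖C.cohValue hħ φ z y‖ ≤ K * ‖φ‖ * (1 + ‖z.1‖) ^ (d + 1) * (1 + ‖y‖) ^ (d + 1) := by
  obtain ⟨K, hK, h⟩ := exists_cohValue_term_le (d := d) hħ
  refine ⟨K * ∑' m : C.L, decayWeight (m : Pos d),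
    mul_nonneg hK (tsum_nonneg fun m => (decayWeight_pos _).le), fun φ z y => ?_⟩
  have h1 := tsum_of_norm_bounded ((summable_decayWeight C.L).mul_left
    (K * ‖φ‖ * (1 + ‖z.1‖) ^ (d + 1) * (1 + ‖y‖) ^ (d + 1))).hasSum fun m : C.L => h φ z y m
  rw [tsum_mul_left] at h1
  refine h1.trans (le_of_eq ?_)
  ring

lemma coeFn_cohOp (z : Pos d × Pos d) (φ : L2 d) :
    C.cohOp hħ z φ =ᵐ[volume] C.cohValue hħ φ z := by
  refine ae_eq_of_hasSum (C.hasSum_cohOp hħ z φ) ?_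
  have h : ∀ᵐ y : Pos d, ∀ m : C.L,
      (⟪translate m (cohL2 hħ z), φ⟫_ℂ • translate m (cohL2 hħ z) : L2 d) y =
        ⟪translate m (cohL2 hħ z), φ⟫_ℂ * coherent ħ z.1 z.2 (y - m) := by
    refine ae_all_iff.2 fun m => ?_
    filter_upwards [Lp.coeFn_smul ⟪translate m (cohL2 hħ z), φ⟫_ℂ (translate m (cohL2 hħ z)),
      coeFn_translate m (cohL2 hħ z), ae_comp_sub (coeFn_cohL2 hħ z) (m : Pos d)] with y h1 h2 h3
    rw [h1, Pi.smul_apply, h2, h3, smul_eq_mul]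
  filter_upwards [h] with y hy
  simp only [hy]
  exact (C.summable_cohValue hħ φ z y).hasSum

lemma measurable_cohValue_term (φ : L2 d) (m : Pos d) :
    Measurable fun w : (Pos d × Pos d) × Pos d =>
      ⟪translate m (cohL2 hħ w.1), φ⟫_ℂ * coherent ħ w.1.1 w.1.2 (w.2 - m) := by
  have h1 : Continuous fun z : Pos d × Pos d => translate m (cohL2 hħ z) :=
    (translateₗᵢ m).continuous.comp (continuous_cohL2 hħ)
  have h2 : Continuous fun z : Pos d × Pos d => ⟪translate m (cohL2 hħ z), φ⟫_ℂ :=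
    h1.inner continuous_const
  have h3 : Measurable fun w : (Pos d × Pos d) × Pos d => coherent ħ w.1.1 w.1.2 w.2 :=
    continuous_coherent.measurable
  have h4 : Measurable fun w : (Pos d × Pos d) × Pos d => (w.1, w.2 - m) :=
    measurable_fst.prodMk (measurable_snd.sub_const m)
  have h0 : Measurable fun w : (Pos d × Pos d) × Pos d => w.1 := measurable_fst
  have h5 := h2.measurable.comp h0
  have h6 := h3.comp h4
  simp only [Function.comp_def] at h5 h6
  exact h5.mul h6

lemma measurable_cohValue (φ : L2 d) :
    Measurable fun w : (Pos d × Pos d) × Pos d => C.cohValue hħ φ w.1 w.2 := by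
  have hlim : ∀ w : (Pos d × Pos d) × Pos d, Tendsto (fun F : Finset C.L => ∑ m ∈ F,
      ⟪translate m (cohL2 hħ w.1), φ⟫_ℂ * coherent ħ w.1.1 w.1.2 (w.2 - m)) atTop
      (𝓝 (C.cohValue hħ φ w.1 w.2)) := fun w => by
    have h := (C.summable_cohValue hħ φ w.1 w.2).hasSum
    rw [HasSum, SummationFilter.unconditional_filter, ← cohValue] at h
    exact h
  exact measurable_of_tendsto_metrizable' atTop
    (fun F : Finset C.L => Finset.measurable_fun_sum F fun m _ => measurable_cohValue_term hħ φ m)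
    (tendsto_pi_nhds.2 hlim)

lemma exp_mul_perCoherent (hħ : 0 < ħ) (z : Pos d × Pos d) (k y : Pos d) :
    Complex.exp (Complex.I * (⟪k, y⟫_ℝ : ℝ)) * C.perCoherent ħ z.1 (z.2 - ħ • k) y =
      ∑' m : C.L, planeWave k m * coherent ħ z.1 z.2 (y + m) := by
  rw [perCoherent, ← tsum_mul_left]
  refine tsum_congr fun m => ?_
  rw [coherent_sub_smul hħ, planeWave_add, planeWave]
  have : Complex.exp (Complex.I * (⟪k, y⟫_ℝ : ℝ)) * Complex.exp (-Complex.I * (⟪k, y⟫_ℝ : ℝ)) = 1 := by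
    rw [← Complex.exp_add, neg_mul, add_neg_cancel, Complex.exp_zero]
  linear_combination (planeWave k m * coherent ħ z.1 z.2 (y + m)) * this

/-- The average over the zone in the definition of the Töplitz operator. -/
lemma setAverage_eq_cohValue {φ : L2 d} {u : Pos d → L2per C.Γ} (hu : C.IsBlochTransform φ u)
    (z : Pos d × Pos d) (y : Pos d) :
    (⨍ k in C.Γs, Complex.exp (Complex.I * (⟪k, y⟫_ℝ : ℝ)) *
      (∫ x in C.Γ, conj (C.perCoherent ħ z.1 (z.2 - ħ • k) x) * u k x) *
      C.perCoherent ħ z.1 (z.2 - ħ • k) y ∂volume) = C.cohValue hħ φ z y := by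
  have hav : ∀ F : Pos d → ℂ, (⨍ k in C.Γs, F k ∂volume) = ∫ k, F k ∂C.zoneMeasure := fun F => by
    rw [average, Measure.restrict_apply_univ, zoneMeasure]
  rw [hav]
  set α : Lp ℂ 2 C.zoneMeasure := (C.synth (C.cohField hħ z)).adjoint φ with hα
  have hint : ∀ᵐ k ∂C.zoneMeasure,
      ∫ x in C.Γ, conj (C.perCoherent ħ z.1 (z.2 - ħ • k) x) * u k x = α k := by
    filter_upwards [C.coeFn_adjoint_synth (C.cohField hħ z) φ, hu.ae_eq, C.ae_bloch_cohL2_eq hħ z,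
      (C.isAmalgam_cohL2 hħ z).coeFn_field] with k h1 h2 h3 h4
    rw [hα, h1, h2, cohField, h4, L2.inner_def]
    refine integral_congr_ae ?_
    filter_upwards [h3] with x hx
    rw [hx, RCLike.inner_apply, mul_comm]
  -- The wave `e^{ik·y}` turns the periodic coherent state into a Fourier series in `k` with
  -- coefficients `|q,p⟩(y + m)`. Integrating against `α` then selects the Fourier coefficients of
  -- `α`, and this is valid for every `y`.
  have h1 : ∫ k, Complex.exp (Complex.I * (⟪k, y⟫_ℝ : ℝ)) *
      (∫ x in C.Γ, conj (C.perCoherent ħ z.1 (z.2 - ħ • k) x) * u k x) *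
      C.perCoherent ħ z.1 (z.2 - ħ • k) y ∂C.zoneMeasure =
      ∫ k, ∑' m : C.L, α k * planeWave k m * coherent ħ z.1 z.2 (y + m) ∂C.zoneMeasure := by
    refine integral_congr_ae ?_
    filter_upwards [hint] with k hk
    rw [hk, mul_right_comm, C.exp_mul_perCoherent hħ, mul_comm, ← tsum_mul_left]
    simp only [mul_assoc]
  have hαi : Integrable α C.zoneMeasure := (Lp.memLp α).integrable one_le_two
  have hαw : ∀ m : Pos d, Integrable (fun k => α k * planeWave k m) C.zoneMeasure := fun m =>
    hαi.mul_bdd (c := 1) (continuous_planeWave_left m).aestronglyMeasurable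
      (ae_of_all _ fun k => (norm_planeWave k m).le)
  have hcoef : ∀ m : C.L, ∫ k, α k * planeWave k m * coherent ħ z.1 z.2 (y + m) ∂C.zoneMeasure =
      ⟪translate (-m : Pos d) (cohL2 hħ z), φ⟫_ℂ * coherent ħ z.1 z.2 (y - (-m : Pos d)) := by
    intro m
    rw [integral_mul_const, sub_neg_eq_add,
      ← C.inner_zoneChar_adjoint_synth hħ z (C.L.neg_mem m.2), inner_zoneChar_left]
    congr 2
    funext k
    rw [conj_planeWave, neg_neg, mul_comm]
  have hsum : Summable fun m : C.L =>
      ∫ k, ‖α k * planeWave k m * coherent ħ z.1 z.2 (y + m)‖ ∂C.zoneMeasure := by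
    have e : ∀ m : C.L, ∫ k, ‖α k * planeWave k m * coherent ħ z.1 z.2 (y + m)‖ ∂C.zoneMeasure =
        (∫ k, ‖α k‖ ∂C.zoneMeasure) * ‖coherent ħ z.1 z.2 (y + m)‖ := fun m => by
      simp only [norm_mul, norm_planeWave, mul_one]
      rw [integral_mul_const]
    simp only [e]
    obtain ⟨K, hK, h⟩ := exists_coherent_decay (d := d) hħ
    refine Summable.mul_left _ (Summable.of_nonneg_of_le (fun _ => norm_nonneg _) (fun m => ?_)
      ((summable_decayWeight C.L).mul_left (K * (1 + ‖z.1‖) ^ (d + 1) * (1 + ‖y‖) ^ (d + 1))))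
    refine (norm_coherent_le (h z.1 z.2 (y + m))).trans ?_
    rw [mul_assoc _ ((1 + ‖y‖) ^ (d + 1))]
    exact mul_le_mul_of_nonneg_left (decayWeight_add_le y (m : Pos d)) (by positivity)
  have hi : ∀ m : C.L, Integrable (fun k => α k * planeWave k m * coherent ħ z.1 z.2 (y + m))
      C.zoneMeasure := fun m => (hαw m).mul_const _
  -- The coefficient found at `m` is the term at `-m` of `cohValue`, hence the reindexing.
  rw [h1, ← (hasSum_integral_of_summable_integral_norm hi hsum).tsum_eq, cohValue, ← (Equiv.neg C.L).tsum_eq]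
  refine tsum_congr fun m => ?_
  rw [hcoef, Equiv.neg_apply, Submodule.coe_neg, neg_neg]

end Crystal


/-! ### The Töplitz operator -/

namespace Crystal

variable {d : ℕ} (C : Crystal d)

variable {C} in
lemma IsAmalgam.norm_field_le {u : L2 d} (hu : C.IsAmalgam u) :
    ‖hu.field‖ ≤ ∑' ℓ : C.L, ‖C.cellAt ℓ u‖ := by
  have h0 : 0 ≤ ∑' ℓ : C.L, ‖C.cellAt ℓ u‖ := tsum_nonneg fun _ => norm_nonneg _
  refine (Lp.norm_le_of_ae_bound (f := hu.field) h0 ?_).trans ?_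
  · filter_upwards [hu.ae_norm_le, hu.coeFn_field] with k h1 h2
    rwa [h2]
  · simp

lemma norm_fiberOp_self_le (a : C.BddFiber) : ‖C.fiberOp a a‖ ≤ (‖C.synth‖ * ‖a‖) ^ 2 := by
  refine (ContinuousLinearMap.opNorm_comp_le _ _).trans ?_
  rw [LinearIsometryEquiv.norm_map, sq]
  have := C.synth.le_opNorm a
  gcongr

/-! ### The Bochner integral of the coherent projections and its kernel -/

variable {ħ : ℝ} (hħ : 0 < ħ)

/-- The bound is uniform in the momentum and polynomial in the centre, so it is essentially bounded
on the cell: integrability of `f` then suffices for the Bochner integral. -/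
lemma exists_norm_cohOp_le : ∃ K : ℝ, ∀ z : Pos d × Pos d,
    ‖C.cohOp hħ z‖ ≤ (K * (1 + ‖z.1‖) ^ (d + 1)) ^ 2 := by
  obtain ⟨K, hK, h⟩ := exists_coherent_decay (d := d) hħ
  obtain ⟨B, hB, hcell⟩ := C.exists_cellAt_bound
  refine ⟨‖C.synth‖ * (B * K * ∑' ℓ : C.L, decayWeight (ℓ : Pos d)), fun z => ?_⟩
  refine (C.norm_fiberOp_self_le _).trans ?_
  have h1 : ‖C.cohField hħ z‖ ≤
      B * K * (∑' ℓ : C.L, decayWeight (ℓ : Pos d)) * (1 + ‖z.1‖) ^ (d + 1) := by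
    refine (C.isAmalgam_cohL2 hħ z).norm_field_le.trans ?_
    rw [mul_right_comm, ← tsum_mul_left]
    refine (C.isAmalgam_cohL2 hħ z).tsum_le_tsum (fun ℓ => ?_)
      ((summable_decayWeight C.L).mul_left _)
    refine (hcell (cohL2 hħ z) (K * (1 + ‖z.1‖) ^ (d + 1)) ?_ ℓ).trans (le_of_eq (by ring))
    filter_upwards [coeFn_cohL2 hħ z] with y hy
    rw [hy]
    exact norm_coherent_le (h z.1 z.2 y)
  rw [mul_assoc ‖C.synth‖]
  gcongr

lemma ae_norm_fst_le {ρ : ℝ} (hρ : ∀ x : Pos d, ∃ ℓ ∈ C.L, ‖x - ℓ‖ ≤ ρ) :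
    ∀ᵐ z ∂(volume : Measure (Pos d × Pos d)).restrict C.phaseCell, ‖z.1‖ ≤ ρ := by
  have h : (volume : Measure (Pos d × Pos d)).restrict C.phaseCell =
      ((volume : Measure (Pos d)).restrict C.Γ).prod (volume.restrict Set.univ) := by
    rw [Measure.prod_restrict]
    rfl
  rw [h]
  exact Measure.quasiMeasurePreserving_fst.ae (C.unitCell.ae_norm_le hρ)

lemma integrableOn_smul_cohOp {f : Pos d × Pos d → ℝ} (hf : IntegrableOn f C.phaseCell) :
    IntegrableOn (fun z => (f z : ℂ) • C.cohOp hħ z) C.phaseCell := by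
  obtain ⟨K, hK⟩ := C.exists_norm_cohOp_le hħ
  obtain ⟨ρ, hρ, hρL⟩ := exists_covering_radius C.L
  refine Integrable.mono' (g := fun z => ‖f z‖ * (|K| * (1 + ρ) ^ (d + 1)) ^ 2)
    (hf.norm.mul_const _)
    ((Complex.continuous_ofReal.comp_aestronglyMeasurable hf.1).smul
      (C.continuous_cohOp hħ).aestronglyMeasurable) ?_
  filter_upwards [C.ae_norm_fst_le hρL] with z hz
  rw [norm_smul, Complex.norm_real]
  refine mul_le_mul_of_nonneg_left ((hK z).trans ?_) (norm_nonneg _)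
  rw [← sq_abs, abs_mul, abs_of_nonneg (a := (1 + ‖z.1‖) ^ (d + 1)) (by positivity)]
  gcongr

/-- The Töplitz operator as a Bochner integral of bounded operators. -/
def toepL (f : Pos d × Pos d → ℝ) : L2 d →L[ℂ] L2 d :=
  ∫ z in C.phaseCell, (f z : ℂ) • C.cohOp hħ z

lemma toepL_apply {f : Pos d × Pos d → ℝ} (hf : IntegrableOn f C.phaseCell) (φ : L2 d) :
    C.toepL hħ f φ = ∫ z in C.phaseCell, (f z : ℂ) • C.cohOp hħ z φ :=
  ContinuousLinearMap.integral_apply (C.integrableOn_smul_cohOp hħ hf) φ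

lemma inner_toepL {f : Pos d × Pos d → ℝ} (hf : IntegrableOn f C.phaseCell) (η φ : L2 d) :
    ⟪η, C.toepL hħ f φ⟫_ℂ = ∫ z in C.phaseCell, (f z : ℂ) * ⟪η, C.cohOp hħ z φ⟫_ℂ := by
  have h := (C.integrableOn_smul_cohOp hħ hf).apply_continuousLinearMap φ
  simp only [_root_.smul_apply] at h
  rw [C.toepL_apply hħ hf, ← integral_inner h]
  simp only [inner_smul_right]

/-- A Bochner integral in the space of operators has no pointwise meaning by itself. Both sides are
locally integrable and are compared against test functions, where Fubini's theorem exchanges `y` and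
`z`. -/
lemma coeFn_toepL {f : Pos d × Pos d → ℝ} (hf : IntegrableOn f C.phaseCell) (φ : L2 d) :
    C.toepL hħ f φ =ᵐ[volume]
      fun y => ∫ z in C.phaseCell, C.cohValue hħ φ z y * (f z : ℂ) := by
  obtain ⟨K, hK, hbound⟩ := C.exists_norm_cohValue_le hħ
  obtain ⟨ρ, hρ, hρL⟩ := exists_covering_radius C.L
  set ν := (volume : Measure (Pos d × Pos d)).restrict C.phaseCell with hν
  set M : ℝ := K * ‖φ‖ * (1 + ρ) ^ (d + 1) with hM
  have hle : ∀ z : Pos d × Pos d, ‖z.1‖ ≤ ρ → ∀ y,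
      ‖C.cohValue hħ φ z y * (f z : ℂ)‖ ≤ M * (1 + ‖y‖) ^ (d + 1) * ‖f z‖ := fun z hz y => by
    rw [norm_mul, Complex.norm_real]
    refine mul_le_mul_of_nonneg_right ((hbound φ z y).trans ?_) (norm_nonneg _)
    rw [hM]
    gcongr
  have hmeas : AEStronglyMeasurable (fun w : Pos d × (Pos d × Pos d) =>
      C.cohValue hħ φ w.2 w.1 * (f w.2 : ℂ)) (volume.prod ν) := by
    have h0 : Measurable fun w : Pos d × (Pos d × Pos d) => (w.2, w.1) :=
      measurable_snd.prodMk measurable_fst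
    have h1 := (C.measurable_cohValue hħ φ).comp h0
    simp only [Function.comp_def] at h1
    exact h1.aestronglyMeasurable.mul
      (Complex.continuous_ofReal.comp_aestronglyMeasurable (hf.1.comp_snd))
  have hGm : AEStronglyMeasurable (fun y => ∫ z, C.cohValue hħ φ z y * (f z : ℂ) ∂ν) volume :=
    hmeas.integral_prod_right'
  have hGle : ∀ y, ‖∫ z, C.cohValue hħ φ z y * (f z : ℂ) ∂ν‖ ≤
      M * (1 + ‖y‖) ^ (d + 1) * ∫ z, ‖f z‖ ∂ν := fun y => by
    rw [← integral_const_mul]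
    exact norm_integral_le_of_norm_le (hf.norm.const_mul _)
      ((C.ae_norm_fst_le hρL).mono fun z hz => hle z hz y)
  have hGloc : LocallyIntegrable (fun y => ∫ z, C.cohValue hħ φ z y * (f z : ℂ) ∂ν) volume := by
    have hc : Continuous fun y : Pos d => M * (1 + ‖y‖) ^ (d + 1) * ∫ z, ‖f z‖ ∂ν := by fun_prop
    exact hc.locallyIntegrable.mono hGm
      (ae_of_all _ fun y => (hGle y).trans (Real.le_norm_self _))
  have hRloc : LocallyIntegrable (C.toepL hħ f φ) volume :=
    (Lp.memLp _).locallyIntegrable (by norm_num)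
  have hzero := ae_eq_zero_of_integral_contDiff_smul_eq_zero (hRloc.sub hGloc)
    fun g hg hgs => ?_
  · filter_upwards [hzero] with y hy
    exact sub_eq_zero.1 hy
  have hgc : Continuous fun y => (g y : ℂ) := Complex.continuous_ofReal.comp hg.continuous
  have hgs' : HasCompactSupport fun y => (g y : ℂ) :=
    hgs.comp_left (g := fun t : ℝ => (t : ℂ)) Complex.ofReal_zero
  have hd := hasDecay_of_hasCompactSupport hgc hgs'
  have hprod : Integrable (fun w : Pos d × (Pos d × Pos d) =>
      (g w.1 : ℂ) * (C.cohValue hħ φ w.2 w.1 * (f w.2 : ℂ))) (volume.prod ν) := by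
    have hi : Integrable fun y => M * (1 + ‖y‖) ^ (d + 1) * ‖g y‖ := by
      refine Continuous.integrable_of_hasCompactSupport ?_ ?_
      · have := hg.continuous
        fun_prop
      · exact hgs.norm.mul_left (f := fun y => M * (1 + ‖y‖) ^ (d + 1))
    refine (hi.mul_prod hf.norm).mono'
      ((hgc.comp continuous_fst).aestronglyMeasurable.mul hmeas) ?_
    have hae := (Measure.quasiMeasurePreserving_snd (μ := (volume : Measure (Pos d)))
      (ν := ν)).ae (C.ae_norm_fst_le hρL)
    filter_upwards [hae] with w hw
    rw [norm_mul, Complex.norm_real]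
    calc ‖g w.1‖ * ‖C.cohValue hħ φ w.2 w.1 * (f w.2 : ℂ)‖
        ≤ ‖g w.1‖ * (M * (1 + ‖w.1‖) ^ (d + 1) * ‖f w.2‖) :=
          mul_le_mul_of_nonneg_left (hle w.2 hw w.1) (norm_nonneg _)
      _ = _ := by ring
  have e1 : ∫ y, g y • C.toepL hħ f φ y = ⟪hd.toL2, C.toepL hħ f φ⟫_ℂ := by
    rw [HasDecay.inner_toL2_left]
    simp only [Complex.conj_ofReal, Complex.real_smul]
  have e2 : ⟪hd.toL2, C.toepL hħ f φ⟫_ℂ =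
      ∫ z, (∫ y, (g y : ℂ) * (C.cohValue hħ φ z y * (f z : ℂ))) ∂ν := by
    rw [C.inner_toepL hħ hf]
    refine integral_congr_ae (ae_of_all _ fun z => ?_)
    dsimp only
    rw [HasDecay.inner_toL2_left, ← integral_const_mul]
    refine integral_congr_ae ?_
    filter_upwards [C.coeFn_cohOp hħ z φ] with y hy
    rw [hy, Complex.conj_ofReal]
    ring
  have e3 : ∫ y, g y • (∫ z, C.cohValue hħ φ z y * (f z : ℂ) ∂ν) =
      ∫ z, (∫ y, (g y : ℂ) * (C.cohValue hħ φ z y * (f z : ℂ))) ∂ν := by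
    rw [← integral_integral_swap hprod]
    refine integral_congr_ae (ae_of_all _ fun y => ?_)
    dsimp only
    rw [integral_const_mul, Complex.real_smul]
  simp only [Pi.sub_apply, smul_sub]
  rw [integral_sub (hRloc.integrable_smul_left_of_hasCompactSupport hg.continuous hgs)
    (hGloc.integrable_smul_left_of_hasCompactSupport hg.continuous hgs), e1, e2, e3, sub_self]

lemma toeplitz_eq {f : Pos d × Pos d → ℝ} (hf : IntegrableOn f C.phaseCell) :
    C.toeplitz ħ f = totalPMap (C.toepL hħ f) := by
  refine opOfRel_eq_totalPMap fun φ g => ?_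
  constructor
  · rintro ⟨u, hu, hg⟩
    refine Lp.ext ?_
    filter_upwards [hg, C.coeFn_toepL hħ hf φ] with y h1 h2
    rw [h1, h2]
    simp only [C.setAverage_eq_cohValue hħ hu]
  · rintro rfl
    refine ⟨C.bloch φ, C.isBlochTransform_bloch φ, ?_⟩
    filter_upwards [C.coeFn_toepL hħ hf φ] with y h2
    rw [h2]
    simp only [C.setAverage_eq_cohValue hħ (C.isBlochTransform_bloch φ)]

lemma re_inner_toepL {f : Pos d × Pos d → ℝ} (hf : IntegrableOn f C.phaseCell) (φ : L2 d) :
    (⟪φ, C.toepL hħ f φ⟫_ℂ).re =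
      ∫ z in C.phaseCell, f z * (⟪φ, C.cohOp hħ z φ⟫_ℂ).re := by
  have h : ∀ z, (f z : ℂ) * ⟪φ, C.cohOp hħ z φ⟫_ℂ =
      ((f z * (⟪φ, C.cohOp hħ z φ⟫_ℂ).re : ℝ) : ℂ) := fun z => by
    rw [cohOp, re_inner_fiberOp_self, inner_fiberOp_self]
    push_cast
    rfl
  rw [C.inner_toepL hħ hf]
  simp only [h]
  rw [integral_complex_ofReal, Complex.ofReal_re]

lemma isSelfAdjoint_toepL {f : Pos d × Pos d → ℝ} (hf : IntegrableOn f C.phaseCell) :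
    IsSelfAdjoint (C.toepL hħ f) := by
  rw [ContinuousLinearMap.isSelfAdjoint_iff_isSymmetric]
  intro φ η
  change ⟪C.toepL hħ f φ, η⟫_ℂ = ⟪φ, C.toepL hħ f η⟫_ℂ
  rw [← inner_conj_symm, C.inner_toepL hħ hf, C.inner_toepL hħ hf, ← integral_conj]
  refine integral_congr_ae (ae_of_all _ fun z => ?_)
  have h := (ContinuousLinearMap.isSelfAdjoint_iff_isSymmetric.1
    (C.isSelfAdjoint_fiberOp (C.cohField hħ z))) φ η
  change ⟪C.cohOp hħ z φ, η⟫_ℂ = ⟪φ, C.cohOp hħ z η⟫_ℂ at h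
  dsimp only
  rw [map_mul, Complex.conj_ofReal, inner_conj_symm, h]

lemma toepL_translate {f : Pos d × Pos d → ℝ} (hf : IntegrableOn f C.phaseCell) {m : Pos d}
    (hm : m ∈ C.L) (φ : L2 d) :
    C.toepL hħ f (translate m φ) = translate m (C.toepL hħ f φ) := by
  have h := (C.integrableOn_smul_cohOp hħ hf).apply_continuousLinearMap φ
  have e := ((translateₗᵢ m).toContinuousLinearMap : L2 d →L[ℂ] L2 d).integral_comp_comm h
  change _ = translate m _ at e
  rw [C.toepL_apply hħ hf, C.toepL_apply hħ hf]
  simp only [_root_.smul_apply] at e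
  rw [← e]
  refine integral_congr_ae (ae_of_all _ fun z => ?_)
  dsimp only
  rw [cohOp, C.fiberOp_translate _ _ hm, map_smul]
  rfl

/-! ### The coupling -/

/-- Coercivity: the real part of `⟨(1 + sT)φ, φ⟩` is at least `‖φ‖²`. -/
lemma isUnit_one_add_smul {H : Type*} [NormedAddCommGroup H] [InnerProductSpace ℂ H]
    [CompleteSpace H] {T : H →L[ℂ] H} (hT : ∀ φ, 0 ≤ (⟪φ, T φ⟫_ℂ).re) {s : ℝ} (hs : 0 ≤ s) :
    IsUnit (1 + (s : ℂ) • T) := by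
  refine ContinuousLinearMap.isUnit_of_forall_le_norm_inner_map _ (c := 1) one_pos fun φ => ?_
  have h1 : (⟪(1 + (s : ℂ) • T) φ, φ⟫_ℂ).re = ‖φ‖ ^ 2 + s * (⟪φ, T φ⟫_ℂ).re := by
    rw [_root_.add_apply, _root_.smul_apply, inner_add_left, inner_smul_left,
      Complex.conj_ofReal, Complex.add_re, Complex.re_ofReal_mul]
    congr 1
    · exact inner_self_eq_norm_sq (𝕜 := ℂ) φ
    · rw [← inner_conj_symm, Complex.conj_re]
  rw [NNReal.coe_one, mul_one]
  refine le_trans ?_ ((le_abs_self _).trans (Complex.abs_re_le_norm _))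
  rw [h1]
  exact le_add_of_nonneg_right (mul_nonneg hs (hT φ))

lemma continuous_inverse_apply {X H : Type*} [TopologicalSpace X] [NormedAddCommGroup H]
    [NormedSpace ℂ H] [CompleteSpace H] {A : X → H →L[ℂ] H} (hA : Continuous A)
    (hu : ∀ x, IsUnit (A x)) (ψ : H) : Continuous fun x => Ring.inverse (A x) ψ := by
  have h : Continuous fun x => Ring.inverse (A x) := by
    rw [continuous_iff_continuousAt]
    intro x
    have h3 := NormedRing.inverse_continuousAt (hu x).unit
    rw [IsUnit.unit_spec] at h3
    exact h3.comp hA.continuousAt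
  exact h.clm_apply continuous_const

lemma inverse_one_add_apply {H : Type*} [NormedAddCommGroup H] [NormedSpace ℂ H]
    {T : H →L[ℂ] H} (hu : IsUnit (1 + T)) (ψ : H) :
    ψ - Ring.inverse (1 + T) ψ = T (Ring.inverse (1 + T) ψ) := by
  have h := congrArg (fun A : H →L[ℂ] H => A ψ) (Ring.mul_inverse_cancel _ hu)
  exact sub_eq_iff_eq_add'.2 h.symm

/-- Clipping the scalar at `0` makes the resolvent defined and continuous on all of `ℝ` times phase
space, so that it can be composed with a measurable `f`. -/
lemma isUnit_one_add_cohOp (w : ℝ × (Pos d × Pos d)) :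
    IsUnit (1 + ((max w.1 0 : ℝ) : ℂ) • C.cohOp hħ w.2) :=
  isUnit_one_add_smul (C.re_inner_cohOp_nonneg hħ w.2) (le_max_right _ _)

lemma continuous_one_add_cohOp : Continuous fun w : ℝ × (Pos d × Pos d) =>
    1 + ((max w.1 0 : ℝ) : ℂ) • C.cohOp hħ w.2 :=
  continuous_const.add ((Complex.continuous_ofReal.comp (continuous_fst.max
    continuous_const)).smul ((C.continuous_cohOp hħ).comp continuous_snd))

/-- The resolvent of the coupling, applied to a vector. -/
def cohResolvent (ψ : L2 d) (w : ℝ × (Pos d × Pos d)) : L2 d :=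
  Ring.inverse (1 + ((max w.1 0 : ℝ) : ℂ) • C.cohOp hħ w.2) ψ

lemma continuous_cohResolvent (ψ : L2 d) : Continuous (C.cohResolvent hħ ψ) :=
  continuous_inverse_apply (C.continuous_one_add_cohOp hħ) (C.isUnit_one_add_cohOp hħ) ψ

lemma sub_cohResolvent (ψ : L2 d) {s : ℝ} (hs : 0 ≤ s) (z : Pos d × Pos d) :
    ψ - C.cohResolvent hħ ψ (s, z) = ((s : ℂ) • C.cohOp hħ z) (C.cohResolvent hħ ψ (s, z)) := by
  have h := inverse_one_add_apply (C.isUnit_one_add_cohOp hħ (s, z)) ψ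
  rw [← cohResolvent] at h
  rw [h, max_eq_left hs]

/-- The density is merely measurable, but the resolvent is a continuous function of the pair `(f z,
z)`. -/
lemma measurable_resolvent {f : Pos d × Pos d → ℝ} (hfm : AEStronglyMeasurable f volume)
    (hf0 : ∀ z, 0 ≤ f z) (ψ : L2 d) : ∃ g : Pos d × Pos d → L2 d,
      AEStronglyMeasurable g volume ∧ ∀ z, (g z, ψ - g z) ∈ (C.cohCoupling hħ f z).graph := by
  have hpair : AEStronglyMeasurable (fun z : Pos d × Pos d => (f z, z)) volume :=
    hfm.prodMk aestronglyMeasurable_id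
  refine ⟨fun z => C.cohResolvent hħ ψ (f z, z),
    (C.continuous_cohResolvent hħ ψ).comp_aestronglyMeasurable hpair, fun z => ?_⟩
  rw [cohCoupling, mem_graph_totalPMap]
  exact C.sub_cohResolvent hħ ψ (hf0 z) z

/-- All operators involved are bounded, so the right marginal in the sense of forms is the scalar
identity obtained by pairing the Bochner integral with `ψ`, transferred to lower integrals by
nonnegativity. -/
lemma isCoupling_cohCoupling {f : Pos d × Pos d → ℝ} (hf : C.IsPeriodicDensity f) :
    C.IsCoupling f (C.toeplitz ħ f) (C.cohCoupling hħ f) := by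
  have hint := hf.integrableOn
  have hpos : ∀ φ z, 0 ≤ f z * (⟪φ, C.cohOp hħ z φ⟫_ℂ).re := fun φ z =>
    mul_nonneg (hf.nonneg z) (C.re_inner_cohOp_nonneg hħ z φ)
  have hRpos : ∀ φ, 0 ≤ (⟪φ, C.toepL hħ f φ⟫_ℂ).re := fun φ => by
    rw [C.re_inner_toepL hħ hint]
    exact integral_nonneg (hpos φ)
  refine ⟨?_, fun z => (C.hasPeriodicTrace_cohCoupling hħ (hf.nonneg z)).1,
    C.measurable_resolvent hħ hf.locallyIntegrable.aestronglyMeasurable hf.nonneg,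
    fun m hm x ξ => ?_, fun z _ => C.hasPeriodicTrace_cohCoupling hħ (hf.nonneg z), fun ψ => ?_⟩
  · rw [C.toeplitz_eq hħ hint]
    exact C.totalPMap_mem_SPlus (C.isSelfAdjoint_toepL hħ hint) hRpos
      fun m hm φ => C.toepL_translate hħ hint hm φ
  · rw [cohCoupling, cohCoupling, C.cohOp_add hħ hm, hf.periodic m hm]
  · rw [C.toeplitz_eq hħ hint, opForm_totalPMap (C.isSelfAdjoint_toepL hħ hint) hRpos,
      C.re_inner_toepL hħ hint, ofReal_integral_eq_lintegral_ofReal ?_ (ae_of_all _ (hpos ψ))]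
    · refine lintegral_congr fun z => ?_
      have h1 : ∀ φ, (⟪φ, ((f z : ℂ) • C.cohOp hħ z) φ⟫_ℂ).re =
          f z * (⟪φ, C.cohOp hħ z φ⟫_ℂ).re := fun φ => by
        rw [_root_.smul_apply, inner_smul_right, Complex.re_ofReal_mul]
      have h2 : IsSelfAdjoint ((f z : ℂ) • C.cohOp hħ z) :=
        IsSelfAdjoint.smul (Complex.conj_ofReal _) (C.isSelfAdjoint_fiberOp _)
      rw [cohCoupling, opForm_totalPMap h2 fun φ => by rw [h1]; exact hpos φ z, h1]
    · have h := ((C.integrableOn_smul_cohOp hħ hint).apply_continuousLinearMap ψ).const_inner (𝕜 := ℂ) ψ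
      refine h.re.congr (ae_of_all _ fun z => ?_)
      dsimp only
      rw [_root_.smul_apply, inner_smul_right]
      exact Complex.re_ofReal_mul _ _

/-- The pseudo-distance from a density to its Töplitz operator. -/
lemma pseudoDist_toeplitz_le (hħ : 0 < ħ) (lam : ℝ) {f : Pos d × Pos d → ℝ} (hf : C.IsPeriodicDensity f) :
    C.pseudoDist ħ lam f (C.toeplitz ħ f) ≤
      ENNReal.ofReal (√((1 + lam ^ 2) / 2 * d * ħ)) := by
  refine (iInf₂_le_of_le (C.cohCoupling hħ f) (C.isCoupling_cohCoupling hħ hf)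
    (iInf₂_le_of_le _ (C.hasCost_cohCoupling (lam := lam) hħ hf) le_rfl)).trans ?_
  rw [ENNReal.ofReal_rpow_of_nonneg (by positivity) (by norm_num), ← Real.sqrt_eq_rpow]
  exact ENNReal.ofReal_le_ofReal (Real.sqrt_le_sqrt (C.sum_norm_gradL2_sq_le hħ 0))

end Crystal

end Bloch

end

theorem proposition3p3 {d : ℕ} (C : Bloch.Crystal d) (ħ lam : ℝ) (hħ : 0 < ħ) (hlam : 0 < lam)
    (f : Bloch.Pos d × Bloch.Pos d → ℝ) (hf : C.IsPeriodicDensity f)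
    (hf2 : C.FiniteSecondMoments f) :
    C.pseudoDist ħ lam f (C.toeplitz ħ f) ≤
      ENNReal.ofReal (Real.sqrt ((1 + lam ^ 2) / 2 * d * ħ)) :=
  C.pseudoDist_toeplitz_le hħ lam hf
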